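/- Let $n\ge 1$, let $\mathfrak b$ be a fractional ideal and $\mathfrak c$ a nonzero integral ideal of $\mathbb{Q}$ with $\mathfrak b^{-1}\subseteq 2\mathbb{Z}$ and $\mathfrak{bc}\subseteq 2\mathbb{Z}$, and let $p$ be a prime with $p\nmid\mathfrak c$. For a square matrix $r$ write $\tilde r=(r^T)^{-1}$. **Groups.** Let $G_p=Sp_n(\mathbb{Q}_p)$, with elements written in $n\times n$ blocks $\begin{pmatrix} a&b\\c&d\end{pmatrix}$, let $P_p=\{c=0\}$ be its Siegel parabolic subgroup, let $D_p=\{a,d\in M_n(\mathbb{Z}_p),\ b\in M_n(\mathfrak b_p^{-1}),\ c\in M_n(\mathfrak b_p\mathfrak c_p)\}\subseteq G_p$ and $(D_0)_p=D_p\cap P_p$. Let $M_p$ be the metaplectic group, i.e. the group of pairs $(\alpha,\sigma)$ with $\alpha\in G_p$ and $\sigma$ a unitary operator on $L^2(\mathbb{Q}_p^n)$ satisfying $\sigma^{-1}U(w)\sigma=U(w\alpha)$ for all $w=(u,v)\in\mathbb{Q}_p^{2n}$, where $(U(u,v)f)(x)=e_p(xv^T+\tfrac12uv^T)f(x+u)$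 and $e_p(x)=e^{-2\pi i\{x\}}$; it is an extension of $G_p$ by the unit circle $\mathbb{T}$. Let $r_P:P_p\to M_p$ be the lift $(r_P(\alpha)f)(x)=|\det a|_p^{1/2}e_p(\tfrac12xab^Tx^T)f(xa)$, and let $V\subset M_p$ consist of the elements over $D_p$ that fix the characteristic function of $\mathbb{Z}_p^n$; then $r_P((D_0)_p)\subseteq V$. **Hecke rings.** Let $\mathcal R_p$ be the Hecke ring of $(V,M_p)$ with complex coefficients, factored by the relations $V\sigma V=t\,V(t\sigma)V$ for $t\in\mathbb{T}$, and let $\mathcal S_{0p}$ be the Hecke ring of $((D_0)_p,P_p)$ with complex coefficients. Elements of both are formal finite sums of right cosets, multiplied by $(\sum_i a_iKg_i)(\sum_j b_jKh_j)=\sum_{i,j}a_ib_jKg_ih_j$. Let $\varepsilon:\mathcal R_p\to\mathcal S_{0p}$ be the $\mathbb{C}$-linear map that rewrites an element as a combination $\sum_g F(g)\,V r_P(g)$ with $g\in (D_0)_p\backslash P_p$ and sends it to $\sum_g F(g)\,(D_0)_p\,g$. Let $U_p=(D_0)_p\,\mathrm{diag}[p^{-1}I_n,pI_n]\,(D_0)_p\in\mathcal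 S_{0p}$. **Satake map.** Let $\omega_p':\mathcal S_{0p}\to\mathbb{C}[x_1^{\pm},\dots,x_n^{\pm}]$ be the linear map $\sum_gF(g)(D_0)_pg\mapsto\sum_gF(g)\prod_{i=1}^n(p^{-i}x_i)^{a_i(g)}$, where $GL_n(\mathbb{Z}_p)d_g$ contains an upper triangular matrix with diagonal $p^{a_1(g)},\dots,p^{a_n(g)}$, and let $\omega_p=\omega_p'\circ\varepsilon$ on $\mathcal R_p$. **Hecke polynomial.** Define $\widetilde T_m\in\mathbb{C}[x_1^\pm,\dots,x_n^\pm]$ for $0\le m\le 2^n$ by $$\prod_{\delta\in\{\pm1\}^n}\bigl(1-p^{n(n+1)/2}x_1^{\delta_1}\cdots x_n^{\delta_n}z\bigr)=\sum_{m=0}^{2^n}(-1)^m\widetilde T_mz^m,$$ let $T_m\in\mathcal R_p$ be the elements with $\omega_p(T_m)=\widetilde T_m$, and let $R_n(z)=\sum_{m=0}^{2^n}(-1)^mT_mz^m$. Identify $T_m$ with $\varepsilon(T_m)\in\mathcal S_{0p}$. **Claim.** In $\mathcal S_{0p}$, $$\sum_{m=0}^{2^n}(-1)^mT_mU_p^{2^n-m}=0,$$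 and in $\mathcal S_{0p}[z]$ (with $z$ central), $$R_n(z)=\Bigl(\sum_{m=0}^{2^n-1}V_mz^m\Bigr)(1-U_pz),\qquad V_m=\sum_{\ell=0}^m(-1)^\ell T_\ell U_p^{m-\ell}.$$ -/

import Mathlib

open scoped Matrix

namespace MetaHecke

section Abstract

variable {G : Type*} [Group G]

/-- The set `K \ G` of right cosets `K g`. -/
abbrev RightCosets (K : Subgroup G) : Type _ := Quotient (QuotientGroup.rightRel K)

/-- The right coset `K g`. -/
abbrev rightCoset (K : Subgroup G) (g : G) : RightCosets K := Quotient.mk (QuotientGroup.rightRel K) g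

theorem rightCoset_eq {K : Subgroup G} {g h : G} :
    rightCoset K g = rightCoset K h ↔ h * g⁻¹ ∈ K := by
  rw [Quotient.eq, QuotientGroup.rightRel_apply]

theorem out_spec (K : Subgroup G) (g : G) : ∃ k ∈ K, (rightCoset K g).out = k * g := by
  have h : rightCoset K g = rightCoset K (rightCoset K g).out := (Quotient.out_eq _).symm
  exact ⟨_, rightCoset_eq.1 h, by group⟩

/-- The Hecke algebra of `(K, G)` with respect to a character `χ` of `K`, as a vector space. An
element is a formal finite sum `∑ F(g) K g` over right cosets, recorded through its coefficient
function `F`; here `K k g` is identified with `χ(k)⁻¹ K g` (so that `F (k g) = χ(k) F(g)`), and the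
sum is invariant under right translation by `k` up to the scalar `χ(k)`. For `χ = 1` these are
exactly the linear combinations of double cosets `K g K`, decomposed into right cosets. -/
def heckeModule (K : Subgroup G) (χ : K →* ℂ) : Submodule ℂ (G → ℂ) where
  carrier := {F | (∀ (k : K) (g : G), F (k * g) = χ k * F g) ∧
    (∀ (k : K) (g : G), F (g * k) = χ k * F g) ∧
    (rightCoset K '' Function.support F).Finite}
  zero_mem' := by simp
  add_mem' := by
    rintro F₁ F₂ ⟨h1, h2, h3⟩ ⟨h1', h2', h3'⟩
    refine ⟨fun k g => ?_, fun k g => ?_, ?_⟩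
    · simp [h1, h1', mul_add]
    · simp [h2, h2', mul_add]
    · refine (h3.union h3').subset ?_
      rw [← Set.image_union]
      exact Set.image_mono (Function.support_add F₁ F₂)
  smul_mem' := by
    rintro c F ⟨h1, h2, h3⟩
    refine ⟨fun k g => ?_, fun k g => ?_, ?_⟩
    · simp [h1, mul_left_comm]
    · simp [h2, mul_left_comm]
    · exact h3.subset (Set.image_mono (Function.support_const_smul_subset c F))

/-- The Hecke algebra of `(K, G)` with respect to `χ`. -/
def HeckeAlg (K : Subgroup G) (χ : K →* ℂ) : Type _ := heckeModule K χ

namespace HeckeAlg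

variable {K : Subgroup G} {χ : K →* ℂ}

noncomputable instance : AddCommGroup (HeckeAlg K χ) := inferInstanceAs (AddCommGroup (heckeModule K χ))
noncomputable instance : Module ℂ (HeckeAlg K χ) := inferInstanceAs (Module ℂ (heckeModule K χ))

/-- The coefficient function of a formal sum of cosets. -/
instance : FunLike (HeckeAlg K χ) G ℂ := ⟨fun F => F.1, Subtype.val_injective⟩

/-- The formal sum of cosets with a given coefficient function. -/
def mk (F : G → ℂ) (h : F ∈ heckeModule K χ) : HeckeAlg K χ := ⟨F, h⟩

theorem mk_apply (F : G → ℂ) (h : F ∈ heckeModule K χ) (g : G) : mk F h g = F g := rfl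

@[ext] theorem ext {F₁ F₂ : HeckeAlg K χ} (h : ∀ g, F₁ g = F₂ g) : F₁ = F₂ :=
  DFunLike.ext _ _ h

theorem add_apply (F₁ F₂ : HeckeAlg K χ) (g : G) : (F₁ + F₂) g = F₁ g + F₂ g := rfl
theorem smul_apply (c : ℂ) (F : HeckeAlg K χ) (g : G) : (c • F) g = c * F g := rfl
theorem zero_apply (g : G) : (0 : HeckeAlg K χ) g = 0 := rfl

theorem left_eq (F : HeckeAlg K χ) {k : G} (hk : k ∈ K) (g : G) : F (k * g) = χ ⟨k, hk⟩ * F g :=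
  F.2.1 ⟨k, hk⟩ g

theorem right_eq (F : HeckeAlg K χ) {k : G} (hk : k ∈ K) (g : G) : F (g * k) = χ ⟨k, hk⟩ * F g :=
  F.2.2.1 ⟨k, hk⟩ g

theorem finite_supp (F : HeckeAlg K χ) : (rightCoset K '' Function.support F).Finite := F.2.2.2

theorem chi_inv_mul {k : G} (hk : k ∈ K) : χ ⟨k⁻¹, inv_mem hk⟩ * χ ⟨k, hk⟩ = 1 := by
  rw [← map_mul, ← map_one χ]; congr 1; ext; simp

/-- The sum of a left `K`-invariant function over `K \ G`. -/
noncomputable def cosetSum (K : Subgroup G) (φ : G → ℂ) : ℂ :=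
  ∑ᶠ c : RightCosets K, φ c.out

theorem cosetSum_const_mul (K : Subgroup G) (a : ℂ) (φ : G → ℂ) :
    cosetSum K (fun h => a * φ h) = a * cosetSum K φ :=
  (smul_finsum a (fun c : RightCosets K => φ c.out)).symm

theorem inv_out {φ : G → ℂ} (hφ : ∀ k ∈ K, ∀ g, φ (k * g) = φ g) (g : G) :
    φ (rightCoset K g).out = φ g := by
  obtain ⟨k, hk, h⟩ := out_spec K g
  rw [h, hφ k hk]

theorem cosetSum_translate {φ : G → ℂ} (hφ : ∀ k ∈ K, ∀ g, φ (k * g) = φ g) (y : G) :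
    cosetSum K (fun h => φ (h * y)) = cosetSum K φ := by
  have key : ∀ y : G, ∀ a b : G, (QuotientGroup.rightRel K) a b →
      rightCoset K (a * y) = rightCoset K (b * y) := by
    intro y a b hab
    rw [QuotientGroup.rightRel_apply] at hab
    rw [rightCoset_eq]; simpa [mul_assoc] using hab
  let e : RightCosets K ≃ RightCosets K :=
    { toFun := Quotient.lift (fun a => rightCoset K (a * y)) (key y)
      invFun := Quotient.lift (fun a => rightCoset K (a * y⁻¹)) (key y⁻¹)
      left_inv := by rintro ⟨a⟩; exact congrArg (rightCoset K) (by simp)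
      right_inv := by rintro ⟨a⟩; exact congrArg (rightCoset K) (by simp) }
  unfold cosetSum
  symm
  rw [← finsum_comp_equiv e]
  refine finsum_congr fun c => ?_
  have hc : e c = rightCoset K (c.out * y) := by
    conv_lhs => rw [← Quotient.out_eq c]
    rfl
  rw [hc, inv_out hφ]

theorem finite_support_out {F : HeckeAlg K χ} {φ : G → ℂ} (h : ∀ g, φ g ≠ 0 → F g ≠ 0) :
    (Function.support fun c : RightCosets K => φ c.out).Finite := by
  refine F.finite_supp.subset fun c hc => ⟨c.out, h _ hc, Quotient.out_eq c⟩

theorem kernel_inv (F₁ F₂ : HeckeAlg K χ) (g : G) :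
    ∀ k ∈ K, ∀ h, F₁ (g * (k * h)⁻¹) * F₂ (k * h) = F₁ (g * h⁻¹) * F₂ h := by
  intro k hk h
  rw [F₂.left_eq hk, mul_inv_rev, ← mul_assoc g, F₁.right_eq (inv_mem hk)]
  linear_combination F₁ (g * h⁻¹) * F₂ h * chi_inv_mul (χ := χ) hk

/-- The coefficient function of the product. -/
noncomputable def mulFun (F₁ F₂ : HeckeAlg K χ) (g : G) : ℂ :=
  cosetSum K fun h => F₁ (g * h⁻¹) * F₂ h

theorem mulFun_mem (F₁ F₂ : HeckeAlg K χ) : mulFun F₁ F₂ ∈ heckeModule K χ := by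
  refine ⟨fun k g => ?_, fun k g => ?_, ?_⟩
  · unfold mulFun
    rw [← cosetSum_const_mul]
    congr 1
    funext h
    rw [mul_assoc, F₁.left_eq k.2, mul_assoc]
  · have h1 := cosetSum_translate (K := K) (φ := fun h => F₁ (g * k * h⁻¹) * F₂ h)
      (kernel_inv F₁ F₂ (g * k)) (k : G)
    unfold mulFun
    rw [← h1, ← cosetSum_const_mul]
    congr 1
    funext h
    rw [F₂.right_eq k.2]
    simp only [mul_inv_rev, mul_assoc, mul_inv_cancel_left]
    ring
  · have hfin := (F₁.finite_supp.prod F₂.finite_supp).image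
      (fun q : RightCosets K × RightCosets K => rightCoset K (q.1.out * q.2.out))
    refine hfin.subset ?_
    rintro _ ⟨g, hg, rfl⟩
    have : ∃ c : RightCosets K, F₁ (g * c.out⁻¹) * F₂ c.out ≠ 0 := by
      by_contra! hcon
      exact hg (by simp [mulFun, cosetSum, hcon])
    obtain ⟨c, hc⟩ := this
    refine ⟨(rightCoset K (g * c.out⁻¹), c), ⟨⟨_, left_ne_zero_of_mul hc, rfl⟩,
      ⟨c.out, right_ne_zero_of_mul hc, Quotient.out_eq c⟩⟩, ?_⟩
    obtain ⟨k, hk, h⟩ := out_spec K (g * c.out⁻¹)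
    simp only [h]
    rw [eq_comm, rightCoset_eq]
    simpa [mul_assoc] using hk

/-- The product of formal sums of cosets: `(∑ aᵢ K gᵢ) (∑ bⱼ K hⱼ) = ∑ aᵢ bⱼ K gᵢ hⱼ`. The
coefficient of the product at `g` is therefore `∑ F₁(g h⁻¹) F₂(h)`, over `K h ∈ K \ G`. -/
noncomputable instance : Mul (HeckeAlg K χ) := ⟨fun F₁ F₂ => mk (mulFun F₁ F₂) (mulFun_mem F₁ F₂)⟩

theorem mul_apply (F₁ F₂ : HeckeAlg K χ) (g : G) :
    (F₁ * F₂) g = cosetSum K fun h => F₁ (g * h⁻¹) * F₂ h := rfl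

open Classical in
/-- The coefficient function of the trivial coset `K`. -/
noncomputable def oneFun (K : Subgroup G) (χ : K →* ℂ) (g : G) : ℂ :=
  if h : g ∈ K then χ ⟨g, h⟩ else 0

theorem oneFun_mem (K : Subgroup G) (χ : K →* ℂ) : oneFun K χ ∈ heckeModule K χ := by
  refine ⟨fun k g => ?_, fun k g => ?_, ?_⟩
  · by_cases h : g ∈ K
    · have h' : (k : G) * g ∈ K := mul_mem k.2 h
      rw [oneFun, oneFun, dif_pos h, dif_pos h', ← map_mul]; rfl
    · have h' : (k : G) * g ∉ K := by rwa [Subgroup.mul_mem_cancel_left _ k.2]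
      rw [oneFun, oneFun, dif_neg h, dif_neg h', mul_zero]
  · by_cases h : g ∈ K
    · have h' : g * (k : G) ∈ K := mul_mem h k.2
      rw [oneFun, oneFun, dif_pos h, dif_pos h', mul_comm, ← map_mul]; rfl
    · have h' : g * (k : G) ∉ K := by rwa [Subgroup.mul_mem_cancel_right _ k.2]
      rw [oneFun, oneFun, dif_neg h, dif_neg h', mul_zero]
  · refine (Set.finite_singleton (rightCoset K 1)).subset ?_
    rintro _ ⟨g, hg, rfl⟩
    have : g ∈ K := by
      by_contra h
      exact hg (dif_neg h)
    rw [Set.mem_singleton_iff, rightCoset_eq]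
    simpa using this

noncomputable instance : One (HeckeAlg K χ) := ⟨mk (oneFun K χ) (oneFun_mem K χ)⟩

theorem one_apply_of_mem {g : G} (h : g ∈ K) : (1 : HeckeAlg K χ) g = χ ⟨g, h⟩ := dif_pos h
theorem one_apply_of_notMem {g : G} (h : g ∉ K) : (1 : HeckeAlg K χ) g = 0 := dif_neg h

theorem cosetSum_single {φ : G → ℂ} (hφ : ∀ k ∈ K, ∀ g, φ (k * g) = φ g) (g : G)
    (h : ∀ x, φ x ≠ 0 → rightCoset K x = rightCoset K g) : cosetSum K φ = φ g := by
  unfold cosetSum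
  rw [finsum_eq_single _ (rightCoset K g), inv_out hφ]
  intro c hc
  by_contra hne
  exact hc (by rw [← h _ hne]; exact (Quotient.out_eq c).symm)

protected theorem mul_assoc' (F₁ F₂ F₃ : HeckeAlg K χ) : F₁ * F₂ * F₃ = F₁ * (F₂ * F₃) := by
  ext g
  simp only [mul_apply]
  have e1 : ∀ y : G, cosetSum K (fun x => F₁ (g * y⁻¹ * x⁻¹) * F₂ x) * F₃ y =
      cosetSum K (fun z => F₁ (g * z⁻¹) * F₂ (z * y⁻¹)) * F₃ y := by
    intro y
    congr 1
    have hi : ∀ k ∈ K, ∀ z, F₁ (g * (k * z)⁻¹) * F₂ (k * z * y⁻¹) =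
        F₁ (g * z⁻¹) * F₂ (z * y⁻¹) := by
      intro k hk z
      have := kernel_inv F₁ F₂ (g * y⁻¹) k hk (z * y⁻¹)
      simpa [mul_assoc] using this
    rw [← cosetSum_translate (K := K) (φ := fun z => F₁ (g * z⁻¹) * F₂ (z * y⁻¹)) hi y]
    simp [mul_assoc]
  simp only [e1]
  unfold cosetSum
  let A : Set (RightCosets K) := rightCoset K '' Function.support F₃
  have hA : A.Finite := F₃.finite_supp
  let B : Set (RightCosets K) := ⋃ c ∈ A,
    (fun d : RightCosets K => rightCoset K (d.out * c.out)) '' (rightCoset K '' Function.support F₂)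
  have hB : B.Finite := hA.biUnion fun c _ => F₂.finite_supp.image _
  have hA' : ∀ c : RightCosets K, F₃ c.out ≠ 0 → c ∈ A := fun c hc => ⟨_, hc, Quotient.out_eq c⟩
  have hB' : ∀ c d : RightCosets K, F₃ c.out ≠ 0 → F₂ (d.out * c.out⁻¹) ≠ 0 → d ∈ B := by
    intro c d hc hd
    refine Set.mem_biUnion (hA' c hc) ⟨rightCoset K (d.out * c.out⁻¹), ⟨_, hd, rfl⟩, ?_⟩
    obtain ⟨k, hk, h⟩ := out_spec K (d.out * c.out⁻¹)
    simp only [h]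
    conv_rhs => rw [← Quotient.out_eq d]
    rw [eq_comm, rightCoset_eq]
    simpa [mul_assoc] using hk
  have l1 : ∀ c : RightCosets K,
      (∑ᶠ d : RightCosets K, F₁ (g * d.out⁻¹) * F₂ (d.out * c.out⁻¹)) * F₃ c.out =
      ∑ d ∈ hB.toFinset, F₁ (g * d.out⁻¹) * F₂ (d.out * c.out⁻¹) * F₃ c.out := by
    intro c
    by_cases hc : F₃ c.out = 0
    · simp [hc]
    · rw [finsum_eq_sum_of_support_subset (s := hB.toFinset), Finset.sum_mul]
      intro d hd
      simpa using hB' c d hc (right_ne_zero_of_mul hd)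
  have l2 : ∀ d : RightCosets K,
      F₁ (g * d.out⁻¹) * (∑ᶠ c : RightCosets K, F₂ (d.out * c.out⁻¹) * F₃ c.out) =
      ∑ c ∈ hA.toFinset, F₁ (g * d.out⁻¹) * F₂ (d.out * c.out⁻¹) * F₃ c.out := by
    intro d
    rw [finsum_eq_sum_of_support_subset (s := hA.toFinset), Finset.mul_sum]
    · exact Finset.sum_congr rfl fun _ _ => by ring
    · intro c hc
      simpa using hA' c (right_ne_zero_of_mul hc)
  simp only [l1, l2]
  rw [finsum_eq_sum_of_support_subset (s := hA.toFinset),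
    finsum_eq_sum_of_support_subset (s := hB.toFinset), Finset.sum_comm]
  · intro d hd
    obtain ⟨c, -, hc⟩ := Finset.exists_ne_zero_of_sum_ne_zero hd
    simpa using hB' c d (right_ne_zero_of_mul hc) (right_ne_zero_of_mul (left_ne_zero_of_mul hc))
  · intro c hc
    obtain ⟨d, -, hd⟩ := Finset.exists_ne_zero_of_sum_ne_zero hc
    simpa using hA' c (right_ne_zero_of_mul hd)

protected theorem one_mul' (F : HeckeAlg K χ) : 1 * F = F := by
  ext g
  rw [mul_apply, cosetSum_single (kernel_inv 1 F g) g]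
  · rw [mul_inv_cancel, one_apply_of_mem (one_mem K)]
    have : χ ⟨1, one_mem K⟩ = 1 := map_one χ
    rw [this, one_mul]
  · intro x hx
    by_contra h
    rw [rightCoset_eq] at h
    exact hx (by rw [one_apply_of_notMem h, zero_mul])

protected theorem mul_one' (F : HeckeAlg K χ) : F * 1 = F := by
  ext g
  rw [mul_apply, cosetSum_single (kernel_inv F 1 g) 1]
  · rw [one_apply_of_mem (one_mem K)]
    have : χ ⟨1, one_mem K⟩ = 1 := map_one χ
    rw [this, mul_one, inv_one, mul_one]
  · intro x hx
    by_contra h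
    rw [rightCoset_eq] at h
    rw [one_mul, inv_mem_iff] at h
    exact hx (by rw [one_apply_of_notMem h, mul_zero])

protected theorem mul_add' (F₁ F₂ F₃ : HeckeAlg K χ) : F₁ * (F₂ + F₃) = F₁ * F₂ + F₁ * F₃ := by
  ext g
  simp only [mul_apply, add_apply, mul_add, cosetSum]
  exact finsum_add_distrib
    (finite_support_out (F := F₂) (φ := fun h => F₁ (g * h⁻¹) * F₂ h) fun h => right_ne_zero_of_mul)
    (finite_support_out (F := F₃) (φ := fun h => F₁ (g * h⁻¹) * F₃ h) fun h => right_ne_zero_of_mul)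

protected theorem add_mul' (F₁ F₂ F₃ : HeckeAlg K χ) : (F₁ + F₂) * F₃ = F₁ * F₃ + F₂ * F₃ := by
  ext g
  simp only [mul_apply, add_apply, add_mul, cosetSum]
  exact finsum_add_distrib
    (finite_support_out (F := F₃) (φ := fun h => F₁ (g * h⁻¹) * F₃ h) fun h => right_ne_zero_of_mul)
    (finite_support_out (F := F₃) (φ := fun h => F₂ (g * h⁻¹) * F₃ h) fun h => right_ne_zero_of_mul)

noncomputable instance : Ring (HeckeAlg K χ) :=
  { (inferInstance : AddCommGroup (HeckeAlg K χ)) with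
    mul := (· * ·)
    one := 1
    mul_assoc := HeckeAlg.mul_assoc'
    one_mul := HeckeAlg.one_mul'
    mul_one := HeckeAlg.mul_one'
    left_distrib := HeckeAlg.mul_add'
    right_distrib := HeckeAlg.add_mul'
    zero_mul := fun F => by ext g; simp [mul_apply, zero_apply, cosetSum]
    mul_zero := fun F => by ext g; simp [mul_apply, zero_apply, cosetSum] }

open Classical in
/-- The double coset `K g K`, a finite union of right cosets, as an element of the Hecke algebra of
`(K, G)` (with trivial character). -/
noncomputable def doubleCoset (K : Subgroup G) (g : G)
    (hfin : (rightCoset K '' {x | ∃ k₁ ∈ K, ∃ k₂ ∈ K, x = k₁ * g * k₂}).Finite) :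
    HeckeAlg K (1 : K →* ℂ) :=
  mk (fun x => if ∃ k₁ ∈ K, ∃ k₂ ∈ K, x = k₁ * g * k₂ then 1 else 0) (by
    refine ⟨fun k x => ?_, fun k x => ?_, hfin.subset (Set.image_mono fun x hx => ?_)⟩
    · rw [MonoidHom.one_apply, one_mul]
      refine if_congr ⟨?_, ?_⟩ rfl rfl
      · rintro ⟨k₁, h₁, k₂, h₂, h⟩
        exact ⟨k⁻¹ * k₁, mul_mem (inv_mem k.2) h₁, k₂, h₂, by
          rw [mul_assoc, mul_assoc, ← mul_assoc k₁, ← h]; simp⟩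
      · rintro ⟨k₁, h₁, k₂, h₂, rfl⟩
        exact ⟨k * k₁, mul_mem k.2 h₁, k₂, h₂, by simp [mul_assoc]⟩
    · rw [MonoidHom.one_apply, one_mul]
      refine if_congr ⟨?_, ?_⟩ rfl rfl
      · rintro ⟨k₁, h₁, k₂, h₂, h⟩
        exact ⟨k₁, h₁, k₂ * k⁻¹, mul_mem h₂ (inv_mem k.2), by rw [← mul_assoc, ← h]; simp⟩
      · rintro ⟨k₁, h₁, k₂, h₂, rfl⟩
        exact ⟨k₁, h₁, k₂ * k, mul_mem h₂ k.2, by simp [mul_assoc]⟩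
    · by_contra h
      exact hx (if_neg h))

/-- A formal sum of right cosets as a finitely supported function on `K \ G`. -/
noncomputable def toFormalSum (K : Subgroup G) :
    HeckeAlg K (1 : K →* ℂ) →ₗ[ℂ] (RightCosets K →₀ ℂ) where
  toFun F := Finsupp.ofSupportFinite (fun c => F c.out) (finite_support_out (F := F) fun _ h => h)
  map_add' _ _ := Finsupp.ext fun _ => rfl
  map_smul' _ _ := Finsupp.ext fun _ => rfl

end HeckeAlg

end Abstract

/-- A level: the fractional ideal `𝔟 = b ℤ` of `ℚ` and the integral ideal `𝔠 = c ℤ`, with the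
standing assumptions `𝔟⁻¹ ⊆ 2ℤ` and `𝔟𝔠 ⊆ 2ℤ` of the half-integral weight case. -/
structure Level where
  b : ℚ
  c : ℕ
  b_pos : 0 < b
  c_pos : 0 < c
  b_inv_mem : ∃ k : ℤ, b⁻¹ = 2 * k
  bc_mem : ∃ k : ℤ, b * c = 2 * k

section Symplectic

variable (p : ℕ) [Fact p.Prime] (n : ℕ)

/-- The group `G_p = Sp_n(ℚ_p)` of `2n × 2n` matrices `α` with `αᵀ ι α = ι`. -/
abbrev Sp : Type := Matrix.symplecticGroup (Fin n) ℚ_[p]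

variable {p n}

/-- The four `n × n` blocks `a, b, c, d` of a symplectic matrix. -/
def blkA (g : Sp p n) : Matrix (Fin n) (Fin n) ℚ_[p] := g.1.toBlocks₁₁
def blkB (g : Sp p n) : Matrix (Fin n) (Fin n) ℚ_[p] := g.1.toBlocks₁₂
def blkC (g : Sp p n) : Matrix (Fin n) (Fin n) ℚ_[p] := g.1.toBlocks₂₁
def blkD (g : Sp p n) : Matrix (Fin n) (Fin n) ℚ_[p] := g.1.toBlocks₂₂

theorem eq_fromBlocks (g : Sp p n) : g.1 = Matrix.fromBlocks (blkA g) (blkB g) (blkC g) (blkD g) :=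
  (Matrix.fromBlocks_toBlocks g.1).symm

theorem mul_eq_fromBlocks (g h : Sp p n) : (g * h).1 = Matrix.fromBlocks
    (blkA g * blkA h + blkB g * blkC h) (blkA g * blkB h + blkB g * blkD h)
    (blkC g * blkA h + blkD g * blkC h) (blkC g * blkB h + blkD g * blkD h) := by
  rw [Submonoid.coe_mul, eq_fromBlocks g, eq_fromBlocks h, Matrix.fromBlocks_multiply]

theorem blkA_mul (g h : Sp p n) : blkA (g * h) = blkA g * blkA h + blkB g * blkC h := by
  rw [blkA, mul_eq_fromBlocks, Matrix.toBlocks_fromBlocks₁₁]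
theorem blkB_mul (g h : Sp p n) : blkB (g * h) = blkA g * blkB h + blkB g * blkD h := by
  rw [blkB, mul_eq_fromBlocks, Matrix.toBlocks_fromBlocks₁₂]
theorem blkC_mul (g h : Sp p n) : blkC (g * h) = blkC g * blkA h + blkD g * blkC h := by
  rw [blkC, mul_eq_fromBlocks, Matrix.toBlocks_fromBlocks₂₁]
theorem blkD_mul (g h : Sp p n) : blkD (g * h) = blkC g * blkB h + blkD g * blkD h := by
  rw [blkD, mul_eq_fromBlocks, Matrix.toBlocks_fromBlocks₂₂]

theorem inv_eq_fromBlocks (g : Sp p n) : (g⁻¹).1 = Matrix.fromBlocks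
    (blkD g)ᵀ (-(blkB g)ᵀ) (-(blkC g)ᵀ) (blkA g)ᵀ := by
  rw [SymplecticGroup.coe_inv, eq_fromBlocks g]
  simp [Matrix.J, Matrix.fromBlocks_transpose, Matrix.fromBlocks_multiply, Matrix.fromBlocks_neg]

theorem blkA_inv (g : Sp p n) : blkA g⁻¹ = (blkD g)ᵀ := by
  rw [blkA, inv_eq_fromBlocks, Matrix.toBlocks_fromBlocks₁₁]
theorem blkB_inv (g : Sp p n) : blkB g⁻¹ = -(blkB g)ᵀ := by
  rw [blkB, inv_eq_fromBlocks, Matrix.toBlocks_fromBlocks₁₂]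
theorem blkC_inv (g : Sp p n) : blkC g⁻¹ = -(blkC g)ᵀ := by
  rw [blkC, inv_eq_fromBlocks, Matrix.toBlocks_fromBlocks₂₁]
theorem blkD_inv (g : Sp p n) : blkD g⁻¹ = (blkA g)ᵀ := by
  rw [blkD, inv_eq_fromBlocks, Matrix.toBlocks_fromBlocks₂₂]

theorem blkA_one : blkA (1 : Sp p n) = 1 := by
  rw [blkA, Submonoid.coe_one, ← Matrix.fromBlocks_one, Matrix.toBlocks_fromBlocks₁₁]
theorem blkB_one : blkB (1 : Sp p n) = 0 := by
  rw [blkB, Submonoid.coe_one, ← Matrix.fromBlocks_one, Matrix.toBlocks_fromBlocks₁₂]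
theorem blkC_one : blkC (1 : Sp p n) = 0 := by
  rw [blkC, Submonoid.coe_one, ← Matrix.fromBlocks_one, Matrix.toBlocks_fromBlocks₂₁]
theorem blkD_one : blkD (1 : Sp p n) = 1 := by
  rw [blkD, Submonoid.coe_one, ← Matrix.fromBlocks_one, Matrix.toBlocks_fromBlocks₂₂]

variable (p n) in
/-- The Siegel parabolic `P_p = {α ∈ G_p | c_α = 0}`. -/
def siegelP : Subgroup (Sp p n) where
  carrier := {g | blkC g = 0}
  mul_mem' {g h} hg hh := by
    simp only [Set.mem_ofPred_eq] at hg hh ⊢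
    rw [blkC_mul, hg, hh, zero_mul, mul_zero, add_zero]
  one_mem' := blkC_one
  inv_mem' {g} hg := by
    simp only [Set.mem_ofPred_eq] at hg ⊢
    rw [blkC_inv, hg, Matrix.transpose_zero, neg_zero]

/-- All entries of the matrix lie in the ideal `r ℤ_p`. -/
def EntriesIn (r : ℚ_[p]) (m : Matrix (Fin n) (Fin n) ℚ_[p]) : Prop := ∀ i j, ‖m i j‖ ≤ ‖r‖

theorem EntriesIn.add {r : ℚ_[p]} {m m' : Matrix (Fin n) (Fin n) ℚ_[p]} (h : EntriesIn r m)
    (h' : EntriesIn r m') : EntriesIn r (m + m') := fun i j =>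
  (IsUltrametricDist.norm_add_le_max (m i j) (m' i j)).trans (max_le (h i j) (h' i j))

theorem EntriesIn.neg {r : ℚ_[p]} {m : Matrix (Fin n) (Fin n) ℚ_[p]} (h : EntriesIn r m) :
    EntriesIn r (-m) := fun i j => by simpa using h i j

theorem EntriesIn.transpose {r : ℚ_[p]} {m : Matrix (Fin n) (Fin n) ℚ_[p]} (h : EntriesIn r m) :
    EntriesIn r mᵀ := fun i j => h j i

theorem EntriesIn.mul {r s : ℚ_[p]} {m m' : Matrix (Fin n) (Fin n) ℚ_[p]} (h : EntriesIn r m)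
    (h' : EntriesIn s m') : EntriesIn (r * s) (m * m') := fun i j => by
  rw [Matrix.mul_apply, norm_mul]
  refine IsUltrametricDist.norm_sum_le_of_forall_le_of_nonneg (by positivity) fun k _ => ?_
  rw [norm_mul]
  exact mul_le_mul (h i k) (h' k j) (norm_nonneg _) (norm_nonneg _)

theorem EntriesIn.one : EntriesIn (1 : ℚ_[p]) (1 : Matrix (Fin n) (Fin n) ℚ_[p]) := fun i j => by
  rw [Matrix.one_apply]; split_ifs <;> simp

theorem EntriesIn.zero (r : ℚ_[p]) : EntriesIn r (0 : Matrix (Fin n) (Fin n) ℚ_[p]) := fun i j => by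
  simp

theorem EntriesIn.mono {r s : ℚ_[p]} (hrs : ‖r‖ ≤ ‖s‖) {m : Matrix (Fin n) (Fin n) ℚ_[p]}
    (h : EntriesIn r m) : EntriesIn s m := fun i j => (h i j).trans hrs

variable (L : Level)

theorem Level.norm_bc (L : Level) : ‖((L.b : ℚ_[p])⁻¹ * (L.b * L.c))‖ ≤ ‖(1 : ℚ_[p])‖ := by
  have hb : (L.b : ℚ_[p]) ≠ 0 := by exact_mod_cast L.b_pos.ne'
  rw [inv_mul_cancel_left₀ hb, norm_one]
  exact_mod_cast Padic.norm_int_le_one (p := p) (L.c : ℤ)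

variable (p n) in
/-- The group `D_p = D_p[𝔟⁻¹, 𝔟𝔠]`: `a, d ∈ M_n(ℤ_p)`, `b ∈ M_n(𝔟_p⁻¹)`, `c ∈ M_n(𝔟_p 𝔠_p)`. -/
noncomputable def levelD : Subgroup (Sp p n) where
  carrier := {g | EntriesIn 1 (blkA g) ∧ EntriesIn (L.b : ℚ_[p])⁻¹ (blkB g) ∧
    EntriesIn (L.b * L.c : ℚ_[p]) (blkC g) ∧ EntriesIn 1 (blkD g)}
  mul_mem' {g h} := by
    rintro ⟨ha, hb, hc, hd⟩ ⟨ha', hb', hc', hd'⟩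
    have h1 := L.norm_bc (p := p)
    refine ⟨?_, ?_, ?_, ?_⟩
    · rw [blkA_mul]
      exact (by simpa using ha.mul ha' : EntriesIn 1 _).add ((hb.mul hc').mono h1)
    · rw [blkB_mul]
      exact (by simpa using ha.mul hb' : EntriesIn _ _).add (by simpa using hb.mul hd')
    · rw [blkC_mul]
      exact (by simpa using hc.mul ha' : EntriesIn _ _).add (by simpa using hd.mul hc')
    · rw [blkD_mul]
      refine ((hc.mul hb').mono ?_).add (by simpa using hd.mul hd' : EntriesIn 1 _)
      rwa [mul_comm]
  one_mem' := by
    refine ⟨?_, ?_, ?_, ?_⟩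
    · rw [blkA_one]; exact .one
    · rw [blkB_one]; exact .zero _
    · rw [blkC_one]; exact .zero _
    · rw [blkD_one]; exact .one
  inv_mem' {g} := by
    rintro ⟨ha, hb, hc, hd⟩
    refine ⟨?_, ?_, ?_, ?_⟩
    · rw [blkA_inv]; exact hd.transpose
    · rw [blkB_inv]; exact hb.transpose.neg
    · rw [blkC_inv]; exact hc.transpose.neg
    · rw [blkD_inv]; exact ha.transpose

variable (p n) in
/-- The group `(D_0)_p = D_p ∩ P_p`, as a subgroup of `P_p`. -/
noncomputable def levelD0 : Subgroup (siegelP p n) := (levelD p n L).subgroupOf (siegelP p n)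

theorem siegelP_mul_transpose (g : siegelP p n) : blkA g.1 * (blkD g.1)ᵀ = 1 := by
  have h := congrArg blkA (mul_inv_cancel g.1)
  rwa [blkA_mul, blkA_one, blkA_inv, blkC_inv, g.2, Matrix.transpose_zero, neg_zero, mul_zero,
    add_zero] at h

theorem siegelP_symm (g : siegelP p n) : blkB g.1 * (blkA g.1)ᵀ = blkA g.1 * (blkB g.1)ᵀ := by
  have h := congrArg blkB (mul_inv_cancel g.1)
  rw [blkB_mul, blkB_one, blkB_inv, blkD_inv, mul_neg] at h
  exact (neg_add_eq_zero.1 h).symm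

theorem siegelP_D_mul (g : siegelP p n) : blkD g.1 * (blkA g.1)ᵀ = 1 := by
  have := congrArg Matrix.transpose (siegelP_mul_transpose g)
  simpa using this

/-- The homomorphism `P_p → GL_n(ℚ_p)`, `α ↦ d_α`. -/
noncomputable def levi : siegelP p n →* GL (Fin n) ℚ_[p] where
  toFun g := ⟨blkD g.1, (blkA g.1)ᵀ, siegelP_D_mul g, mul_eq_one_comm.1 (siegelP_D_mul g)⟩
  map_one' := Units.ext blkD_one
  map_mul' g h := Units.ext (by
    change blkD (g.1 * h.1) = _
    rw [blkD_mul, g.2, zero_mul, zero_add]; rfl)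

/-- The homomorphism `P_p → GL_n(ℚ_p)`, `α ↦ a_α`. -/
noncomputable def leviA : siegelP p n →* GL (Fin n) ℚ_[p] where
  toFun g := ⟨blkA g.1, (blkD g.1)ᵀ, siegelP_mul_transpose g,
    mul_eq_one_comm.1 (siegelP_mul_transpose g)⟩
  map_one' := Units.ext blkA_one
  map_mul' g h := Units.ext (by
    change blkA (g.1 * h.1) = _
    rw [blkA_mul, h.2, mul_zero, add_zero]; rfl)

/-- The element `diag[r̃, r]` of `P_p`, where `r̃ = (rᵀ)⁻¹`. -/
noncomputable def siegelDiag (r : GL (Fin n) ℚ_[p]) : siegelP p n :=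
  ⟨⟨Matrix.fromBlocks ((r⁻¹).1ᵀ) 0 0 r.1, by
    rw [SymplecticGroup.fromBlocks_mem_iff]
    simp⟩, by
    change Matrix.toBlocks₂₁ _ = 0
    rw [Matrix.toBlocks_fromBlocks₂₁]⟩

end Symplectic

section Character

variable {p : ℕ} [Fact p.Prime]

/-- `r` is the fractional part of `x ∈ ℚ_p`: it lies in `ℤ[1/p] ∩ [0, 1)` and `x - r ∈ ℤ_p`. -/
def IsFracPart (x : ℚ_[p]) (r : ℚ) : Prop :=
  (∃ m N : ℕ, r = m / p ^ N ∧ m < p ^ N) ∧ ‖x - r‖ ≤ 1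

theorem exists_fracPart (x : ℚ_[p]) : ∃ r : ℚ, IsFracPart x r := by
  have hp : (p : ℚ_[p]) ≠ 0 := by exact_mod_cast (Fact.out : p.Prime).ne_zero
  obtain ⟨N, hN⟩ : ∃ N : ℕ, ‖(p : ℚ_[p]) ^ N * x‖ ≤ 1 := by
    obtain ⟨N, hN⟩ := exists_nat_gt (Padic.valuation x * (-1) : ℤ)
    refine ⟨(Padic.valuation x * (-1) : ℤ).toNat, ?_⟩
    by_cases hx : x = 0
    · simp [hx]
    rw [norm_mul, norm_pow, Padic.norm_p, Padic.norm_eq_zpow_neg_valuation hx, inv_pow,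
      ← zpow_natCast, ← zpow_neg, ← zpow_add₀ (by exact_mod_cast (Fact.out : p.Prime).ne_zero)]
    exact zpow_le_one_of_nonpos₀ (by exact_mod_cast (Fact.out : p.Prime).one_le) (by omega)
  let y : ℤ_[p] := ⟨_, hN⟩
  refine ⟨(y.appr N : ℚ) / p ^ N, ⟨y.appr N, N, rfl, PadicInt.appr_lt y N⟩, ?_⟩
  have h := PadicInt.appr_spec N y
  rw [← PadicInt.norm_le_pow_iff_mem_span_pow] at h
  have h' : ‖((y - (y.appr N : ℤ_[p]) : ℤ_[p]) : ℚ_[p])‖ ≤ (p : ℝ) ^ (-N : ℤ) := h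
  have e : x - (((y.appr N : ℚ) / p ^ N : ℚ) : ℚ_[p]) =
      ((p : ℚ_[p]) ^ N)⁻¹ * ((y - (y.appr N : ℤ_[p]) : ℤ_[p]) : ℚ_[p]) := by
    push_cast
    simp only [y]
    field_simp
  have hp' : (0 : ℝ) < p := by exact_mod_cast (Fact.out : p.Prime).pos
  rw [e, norm_mul, norm_inv, norm_pow, Padic.norm_p, inv_pow, inv_inv]
  calc (p : ℝ) ^ N * _ ≤ (p : ℝ) ^ N * (p : ℝ) ^ (-N : ℤ) := by gcongr
    _ = 1 := by rw [zpow_neg, zpow_natCast, mul_inv_cancel₀ (by positivity)]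

/-- The fractional part `{x} ∈ ℚ` of `x ∈ ℚ_p`. -/
noncomputable def fracPart (x : ℚ_[p]) : ℚ := (exists_fracPart x).choose

theorem fracPart_spec (x : ℚ_[p]) : IsFracPart x (fracPart x) := (exists_fracPart x).choose_spec

/-- The additive character `e_p(x) = exp(-2πi {x})` of `ℚ_p`. -/
noncomputable def ep (x : ℚ_[p]) : ℂ := Complex.exp (-(2 * Real.pi * Complex.I * (fracPart x : ℚ)))

theorem int_of_norm_le {M : ℤ} {N : ℕ} (h : ‖((M / p ^ N : ℚ) : ℚ_[p])‖ ≤ 1) :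
    ∃ k : ℤ, (M / p ^ N : ℚ) = k := by
  have hp' : (0 : ℝ) < p := by exact_mod_cast (Fact.out : p.Prime).pos
  have hpq : (p : ℚ) ≠ 0 := by exact_mod_cast (Fact.out : p.Prime).ne_zero
  have h2 : ‖(M : ℚ_[p])‖ ≤ (p : ℝ) ^ (-N : ℤ) := by
    push_cast at h
    rw [norm_div, norm_pow, Padic.norm_p, inv_pow, div_inv_eq_mul] at h
    rw [zpow_neg, zpow_natCast, ← one_div, le_div_iff₀ (by positivity)]
    simpa using h
  rw [Padic.norm_int_le_pow_iff_dvd] at h2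
  obtain ⟨k, rfl⟩ := h2
  exact ⟨k, by push_cast; field_simp⟩

theorem ep_eq_of {x : ℚ_[p]} {M : ℤ} {N : ℕ} (h : ‖x - ((M / p ^ N : ℚ) : ℚ_[p])‖ ≤ 1) :
    ep x = Complex.exp (-(2 * Real.pi * Complex.I * ((M / p ^ N : ℚ) : ℚ))) := by
  have hpq : (p : ℚ) ≠ 0 := by exact_mod_cast (Fact.out : p.Prime).ne_zero
  obtain ⟨⟨m, K, hr, -⟩, hx⟩ := fracPart_spec x
  have e : fracPart x - (M / p ^ N : ℚ) = ((m * p ^ N - M * p ^ K : ℤ) / p ^ (K + N) : ℚ) := by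
    rw [hr]; push_cast; field_simp; ring
  have hn : ‖((fracPart x - (M / p ^ N : ℚ) : ℚ) : ℚ_[p])‖ ≤ 1 := by
    have : ((fracPart x - (M / p ^ N : ℚ) : ℚ) : ℚ_[p]) =
        (x - ((M / p ^ N : ℚ) : ℚ_[p])) - (x - fracPart x) := by push_cast; ring
    rw [this, sub_eq_add_neg]
    exact (IsUltrametricDist.norm_add_le_max _ _).trans (max_le h (by rwa [norm_neg]))
  rw [e] at hn
  obtain ⟨k, hk⟩ := int_of_norm_le hn
  rw [← e] at hk
  unfold ep
  rw [Complex.exp_eq_exp_iff_exists_int]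
  refine ⟨-k, ?_⟩
  have : ((fracPart x : ℚ) : ℂ) = ((M / p ^ N : ℚ) : ℂ) + k := by
    rw [← sub_eq_iff_eq_add']; exact_mod_cast hk
  rw [this]; push_cast; ring

theorem ep_add (x y : ℚ_[p]) : ep (x + y) = ep x * ep y := by
  have hpq : (p : ℚ) ≠ 0 := by exact_mod_cast (Fact.out : p.Prime).ne_zero
  obtain ⟨⟨m, K, hr, -⟩, hx⟩ := fracPart_spec x
  obtain ⟨⟨m', K', hr', -⟩, hy⟩ := fracPart_spec y
  have e : fracPart x + fracPart y = ((m * p ^ K' + m' * p ^ K : ℤ) / p ^ (K + K') : ℚ) := by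
    rw [hr, hr']; push_cast; field_simp; ring
  have h : ‖x + y - (((m * p ^ K' + m' * p ^ K : ℤ) / p ^ (K + K') : ℚ) : ℚ_[p])‖ ≤ 1 := by
    rw [← e]
    have : x + y - ((fracPart x + fracPart y : ℚ) : ℚ_[p]) =
      (x - fracPart x) + (y - fracPart y) := by push_cast; ring
    rw [this]
    exact (IsUltrametricDist.norm_add_le_max _ _).trans (max_le hx hy)
  rw [ep_eq_of h, ← e, ep, ep, ← Complex.exp_add]
  congr 1; push_cast; ring

theorem ep_eq_one {x : ℚ_[p]} (h : ‖x‖ ≤ 1) : ep x = 1 := by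
  have := ep_eq_of (x := x) (M := 0) (N := 0) (by simpa using h)
  simpa using this

theorem norm_ep (x : ℚ_[p]) : ‖ep x‖ = 1 := by
  unfold ep
  rw [Complex.norm_exp]
  simp

theorem isLocallyConstant_ep : IsLocallyConstant (ep (p := p)) := by
  rw [IsLocallyConstant.iff_exists_open]
  intro x
  refine ⟨Metric.ball x 1, Metric.isOpen_ball, Metric.mem_ball_self one_pos, fun y hy => ?_⟩
  have : ‖y - x‖ ≤ 1 := by rw [← dist_eq_norm]; exact (Metric.mem_ball.1 hy).le
  rw [← sub_add_cancel y x, ep_add, ep_eq_one this, one_mul]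

end Character

section Weil

variable (p : ℕ) [Fact p.Prime] (n : ℕ)

/-- The Schwartz–Bruhat space of `ℚ_p^n` (row vectors): locally constant functions with compact
support. -/
def SB : Submodule ℂ ((Fin n → ℚ_[p]) → ℂ) where
  carrier := {f | IsLocallyConstant f ∧ HasCompactSupport f}
  zero_mem' := ⟨IsLocallyConstant.const 0, HasCompactSupport.zero⟩
  add_mem' := fun ⟨h1, h2⟩ ⟨h1', h2'⟩ => ⟨h1.add h1', h2.add h2'⟩
  smul_mem' := fun c _ ⟨h1, h2⟩ => ⟨h1.comp (fun z => c * z), h2.smul_left (f := fun _ => c)⟩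

variable {p n}

/-- The operator `f ↦ m · (f ∘ φ)` on Schwartz–Bruhat functions, for a locally constant function `m`
and a homeomorphism `φ`. -/
noncomputable def sbOp (m : (Fin n → ℚ_[p]) → ℂ) (hm : IsLocallyConstant m)
    (φ : (Fin n → ℚ_[p]) ≃ₜ (Fin n → ℚ_[p])) : SB p n →ₗ[ℂ] SB p n where
  toFun f := ⟨fun x => m x * f.1 (φ x),
    hm.mul (f.2.1.comp_continuous φ.continuous), (f.2.2.comp_homeomorph φ).mul_left⟩
  map_add' f g := by ext x; simp [mul_add]
  map_smul' c f := by ext x; simp [mul_left_comm]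

theorem sbOp_apply (m : (Fin n → ℚ_[p]) → ℂ) (hm : IsLocallyConstant m)
    (φ : (Fin n → ℚ_[p]) ≃ₜ (Fin n → ℚ_[p])) (f : SB p n) (x : Fin n → ℚ_[p]) :
    (sbOp m hm φ f).1 x = m x * f.1 (φ x) := rfl

/-- The Heisenberg operator `(U(u, v) f)(x) = e_p(x vᵀ + u vᵀ / 2) f(x + u)`. -/
noncomputable def heis (u v : Fin n → ℚ_[p]) : SB p n →ₗ[ℂ] SB p n :=
  sbOp (fun x => ep (x ⬝ᵥ v + u ⬝ᵥ v / 2))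
    (isLocallyConstant_ep.comp_continuous (by fun_prop)) (Homeomorph.addRight u)

theorem heis_apply (u v : Fin n → ℚ_[p]) (f : SB p n) (x : Fin n → ℚ_[p]) :
    (heis u v f).1 x = ep (x ⬝ᵥ v + u ⬝ᵥ v / 2) * f.1 (x + u) := rfl

theorem heis_congr {u u' v v' : Fin n → ℚ_[p]} (hu : u = u') (hv : v = v') :
    heis (p := p) u v = heis u' v' := by rw [hu, hv]

/-- The squared `L²` norm `∫ |f|²`, with respect to a Haar measure on `ℚ_p^n`. -/
noncomputable def l2NormSq (f : SB p n) : ℝ :=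
  letI : MeasurableSpace (Fin n → ℚ_[p]) := borel _
  haveI : BorelSpace (Fin n → ℚ_[p]) := ⟨rfl⟩
  ∫ x, ‖f.1 x‖ ^ 2 ∂(MeasureTheory.Measure.addHaar : MeasureTheory.Measure (Fin n → ℚ_[p]))

variable (p n) in
/-- The metaplectic group `M_p` (an extension of `Sp_n(ℚ_p)` by the unit circle), as a group of
unitary operators: pairs `(α, σ)` with `α ∈ Sp_n(ℚ_p)` and `σ` a unitary operator such that
`σ⁻¹ U(w) σ = U(w α)` for all `w = (u, v) ∈ ℚ_p^{2n}`. The operators are given on the dense subspace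
of Schwartz–Bruhat functions of `L²(ℚ_p^n)`, which all of them preserve. -/
noncomputable def Mp : Subgroup (Sp p n × (SB p n ≃ₗ[ℂ] SB p n)) where
  carrier := {σ | (∀ u v f, heis u v (σ.2 f) =
      σ.2 (heis (u ᵥ* blkA σ.1 + v ᵥ* blkC σ.1) (u ᵥ* blkB σ.1 + v ᵥ* blkD σ.1) f)) ∧
    ∀ f, l2NormSq (σ.2 f) = l2NormSq f}
  mul_mem' {σ τ} := by
    rintro ⟨h1, h2⟩ ⟨h1', h2'⟩
    refine ⟨fun u v f => ?_, fun f => ?_⟩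
    · change heis u v (σ.2 (τ.2 f)) = σ.2 (τ.2 _)
      rw [h1, h1']
      refine congrArg (fun T : SB p n →ₗ[ℂ] SB p n => σ.2 (τ.2 (T f))) (heis_congr ?_ ?_)
      · rw [Prod.fst_mul, blkA_mul, blkC_mul]
        simp only [Matrix.vecMul_add, Matrix.add_vecMul, Matrix.vecMul_vecMul]
        abel
      · rw [Prod.fst_mul, blkB_mul, blkD_mul]
        simp only [Matrix.vecMul_add, Matrix.add_vecMul, Matrix.vecMul_vecMul]
        abel
    · change l2NormSq (σ.2 (τ.2 f)) = _
      rw [h2, h2']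
  one_mem' := by
    refine ⟨fun u v f => ?_, fun f => rfl⟩
    simp [blkA_one, blkB_one, blkC_one, blkD_one]
  inv_mem' {σ} := by
    rintro ⟨h1, h2⟩
    refine ⟨fun u v f => ?_, fun f => ?_⟩
    · change heis u v (σ.2.symm f) = σ.2.symm _
      rw [LinearEquiv.eq_symm_apply]
      have e : ∀ w z : Fin n → ℚ_[p], ∀ f, σ.2 (heis (w ᵥ* blkA σ.1 + z ᵥ* blkC σ.1)
          (w ᵥ* blkB σ.1 + z ᵥ* blkD σ.1) (σ.2.symm f)) = heis w z f := by
        intro w z f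
        rw [← h1, LinearEquiv.apply_symm_apply]
      have h := inv_mul_cancel σ.1
      have hA := congrArg blkA h
      have hB := congrArg blkB h
      have hC := congrArg blkC h
      have hD := congrArg blkD h
      rw [blkA_mul, blkA_one] at hA
      rw [blkB_mul, blkB_one] at hB
      rw [blkC_mul, blkC_one] at hC
      rw [blkD_mul, blkD_one] at hD
      refine Eq.trans ?_ (e _ _ f)
      rw [Prod.fst_inv]
      refine congrArg (fun T : SB p n →ₗ[ℂ] SB p n => σ.2 (T (σ.2.symm f))) (heis_congr ?_ ?_)
      · simp only [Matrix.add_vecMul, Matrix.vecMul_vecMul]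
        rw [add_add_add_comm, ← Matrix.vecMul_add, ← Matrix.vecMul_add, hA, hC]
        simp
      · simp only [Matrix.add_vecMul, Matrix.vecMul_vecMul]
        rw [add_add_add_comm, ← Matrix.vecMul_add, ← Matrix.vecMul_add, hB, hD]
        simp
    · change l2NormSq (σ.2.symm f) = _
      rw [← h2, LinearEquiv.apply_symm_apply]

/-- The projection `pr : M_p → Sp_n(ℚ_p)`. -/
noncomputable def mpProj : Mp p n →* Sp p n := (MonoidHom.fst _ _).comp (Mp p n).subtype

end Weil

section Lifts

variable {p : ℕ} [Fact p.Prime] {n : ℕ}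

/-- The lattice `ℤ_p^n` of `ℚ_p^n`. -/
def zLattice (p : ℕ) [Fact p.Prime] (n : ℕ) : Set (Fin n → ℚ_[p]) := Metric.closedBall 0 1

theorem isOpen_zLattice : IsOpen (zLattice p n) := IsUltrametricDist.isOpen_closedBall _ one_ne_zero

theorem isCompact_zLattice : IsCompact (zLattice p n) := isCompact_closedBall _ _

theorem mem_zLattice {x : Fin n → ℚ_[p]} : x ∈ zLattice p n ↔ ∀ i, ‖x i‖ ≤ 1 := by
  rw [zLattice, mem_closedBall_zero_iff, pi_norm_le_iff_of_nonneg zero_le_one]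

open Classical in
/-- The characteristic function `φ₀` of `ℤ_p^n`. -/
noncomputable def phi0 (p : ℕ) [Fact p.Prime] (n : ℕ) : SB p n :=
  ⟨(zLattice p n).indicator 1, by
    refine ⟨?_, HasCompactSupport.intro isCompact_zLattice fun x hx => Set.indicator_of_notMem hx _⟩
    rw [IsLocallyConstant.iff_exists_open]
    intro x
    by_cases hx : x ∈ zLattice p n
    · refine ⟨_, isOpen_zLattice, hx, fun y hy => ?_⟩
      rw [Set.indicator_of_mem hx, Set.indicator_of_mem hy]; rfl
    · refine ⟨_, isCompact_zLattice.isClosed.isOpen_compl, hx, fun y hy => ?_⟩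
      rw [Set.indicator_of_notMem hx, Set.indicator_of_notMem hy]⟩

theorem phi0_of_mem {x : Fin n → ℚ_[p]} (h : x ∈ zLattice p n) : (phi0 p n).1 x = 1 :=
  Set.indicator_of_mem h _

theorem phi0_of_notMem {x : Fin n → ℚ_[p]} (h : x ∉ zLattice p n) : (phi0 p n).1 x = 0 :=
  Set.indicator_of_notMem h _

theorem phi0_zero : (phi0 p n).1 0 = 1 := phi0_of_mem (mem_zLattice.2 fun i => by simp)

theorem phi0_ne_zero : phi0 p n ≠ 0 := fun h => by
  have := phi0_zero (p := p) (n := n)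
  rw [h] at this
  exact zero_ne_one this

variable (p n) in
/-- The subgroup `𝕋 · V` of `M_p`, where `V` is the lift of `D_p` consisting of the elements over
`D_p` that fix `φ₀`: it consists of the elements over `D_p` that act on `φ₀` by a scalar. -/
noncomputable def metaTV (L : Level) : Subgroup (Mp p n) where
  carrier := {σ | mpProj σ ∈ levelD p n L ∧ ∃ t : ℂ, σ.1.2 (phi0 p n) = t • phi0 p n}
  mul_mem' {σ τ} := by
    rintro ⟨h1, t, h2⟩ ⟨h1', t', h2'⟩
    refine ⟨by rw [map_mul]; exact mul_mem h1 h1', t' * t, ?_⟩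
    change σ.1.2 (τ.1.2 _) = _
    rw [h2', map_smul, h2, smul_smul]
  one_mem' := ⟨by rw [map_one]; exact one_mem _, 1, by rw [one_smul]; rfl⟩
  inv_mem' {σ} := by
    rintro ⟨h1, t, h2⟩
    refine ⟨by rw [map_inv]; exact inv_mem h1, t⁻¹, ?_⟩
    have ht : t ≠ 0 := by
      rintro rfl
      rw [zero_smul, LinearEquiv.map_eq_zero_iff] at h2
      exact phi0_ne_zero h2
    change σ.1.2.symm _ = _
    rw [LinearEquiv.symm_apply_eq, map_smul, h2, smul_smul, inv_mul_cancel₀ ht, one_smul]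

theorem metaTV_spec {L : Level} (σ : metaTV p n L) :
    σ.1.1.2 (phi0 p n) = (σ.1.1.2 (phi0 p n)).1 0 • phi0 p n := by
  obtain ⟨t, h⟩ := σ.2.2
  have : (σ.1.1.2 (phi0 p n)).1 0 = t := by
    rw [h]
    change t * (phi0 p n).1 0 = t
    rw [phi0_zero, mul_one]
  rw [this, h]

variable (p n) in
/-- The character `t v ↦ t` of `𝕋 · V`: the scalar by which an element acts on `φ₀`. -/
noncomputable def metaChar (L : Level) : metaTV p n L →* ℂ where
  toFun σ := (σ.1.1.2 (phi0 p n)).1 0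
  map_one' := phi0_zero
  map_mul' σ τ := by
    change (σ.1.1.2 (τ.1.1.2 (phi0 p n))).1 0 = _
    rw [metaTV_spec τ, map_smul]
    change _ * (σ.1.1.2 (phi0 p n)).1 0 = (σ.1.1.2 (phi0 p n)).1 0 *
      ((τ.1.1.2 (phi0 p n)).1 0 • (phi0 p n)).1 0
    change _ = _ * (_ * (phi0 p n).1 0)
    rw [phi0_zero, mul_one, mul_comm]

/-- Right multiplication `x ↦ x a` on row vectors. -/
noncomputable def rowMul (a : GL (Fin n) ℚ_[p]) : (Fin n → ℚ_[p]) ≃ₜ+ (Fin n → ℚ_[p]) where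
  toFun x := x ᵥ* a.1
  invFun x := x ᵥ* (a⁻¹).1
  left_inv x := by
    beta_reduce
    rw [Matrix.vecMul_vecMul, ← Units.val_mul, mul_inv_cancel, Units.val_one, Matrix.vecMul_one]
  right_inv x := by
    beta_reduce
    rw [Matrix.vecMul_vecMul, ← Units.val_mul, inv_mul_cancel, Units.val_one, Matrix.vecMul_one]
  map_add' x y := Matrix.add_vecMul _ _ _
  continuous_toFun := by fun_prop
  continuous_invFun := by fun_prop

theorem rowMul_apply (a : GL (Fin n) ℚ_[p]) (x : Fin n → ℚ_[p]) : rowMul a x = x ᵥ* a.1 := rfl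

/-- The normalised absolute value `|det a|_p`, as the modulus of `x ↦ x a` (the factor by which it
scales Haar measures on `ℚ_p^n`). -/
noncomputable def absDet (a : GL (Fin n) ℚ_[p]) : ℝ :=
  letI : MeasurableSpace (Fin n → ℚ_[p]) := borel _
  haveI : BorelSpace (Fin n → ℚ_[p]) := ⟨rfl⟩
  (MeasureTheory.addEquivAddHaarChar (rowMul a) : ℝ)

theorem absDet_pos (a : GL (Fin n) ℚ_[p]) : 0 < absDet a := by
  unfold absDet
  let _ : MeasurableSpace (Fin n → ℚ_[p]) := borel _
  have _ : BorelSpace (Fin n → ℚ_[p]) := ⟨rfl⟩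
  exact NNReal.coe_pos.2 (MeasureTheory.addEquivAddHaarChar_pos (rowMul a))

theorem absDet_mul (a a' : GL (Fin n) ℚ_[p]) : absDet (a * a') = absDet a * absDet a' := by
  unfold absDet
  let _ : MeasurableSpace (Fin n → ℚ_[p]) := borel _
  have _ : BorelSpace (Fin n → ℚ_[p]) := ⟨rfl⟩
  have : rowMul (a * a') = (rowMul a).trans (rowMul a') := by
    ext x : 1
    change x ᵥ* (a.1 * a'.1) = (x ᵥ* a.1) ᵥ* a'.1
    rw [Matrix.vecMul_vecMul]
  rw [this, MeasureTheory.addEquivAddHaarChar_trans, NNReal.coe_mul]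

theorem absDet_one : absDet (1 : GL (Fin n) ℚ_[p]) = 1 := by
  have h := absDet_mul (1 : GL (Fin n) ℚ_[p]) 1
  rw [mul_one] at h
  have := absDet_pos (1 : GL (Fin n) ℚ_[p])
  nlinarith

theorem absDet_eq_one {a : GL (Fin n) ℚ_[p]} (h : ∀ x, x ᵥ* a.1 ∈ zLattice p n ↔ x ∈ zLattice p n) :
    absDet a = 1 := by
  unfold absDet
  let _ : MeasurableSpace (Fin n → ℚ_[p]) := borel _
  have _ : BorelSpace (Fin n → ℚ_[p]) := ⟨rfl⟩
  let μ : MeasureTheory.Measure (Fin n → ℚ_[p]) := MeasureTheory.Measure.addHaar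
  have h1 := MeasureTheory.addEquivAddHaarChar_smul_preimage μ (X := zLattice p n) (rowMul a)
  have h2 : rowMul a ⁻¹' zLattice p n = zLattice p n := Set.ext h
  rw [h2] at h1
  have h3 : μ (zLattice p n) ≠ 0 :=
    (isOpen_zLattice.measure_pos μ ⟨0, mem_zLattice.2 fun i => by simp⟩).ne'
  have h4 : μ (zLattice p n) ≠ ⊤ := isCompact_zLattice.measure_lt_top.ne
  rw [ENNReal.smul_def, smul_eq_mul] at h1
  have h5 : ((MeasureTheory.addEquivAddHaarChar (rowMul a) : NNReal) : ENNReal) = 1 := by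
    rw [← ENNReal.div_self h3 h4]
    exact (ENNReal.eq_div_iff h3 h4).2 (by rw [mul_comm]; exact h1)
  exact_mod_cast h5

theorem l2NormSq_twist (a : GL (Fin n) ℚ_[p]) (f : SB p n) :
    (letI : MeasurableSpace (Fin n → ℚ_[p]) := borel _
    haveI : BorelSpace (Fin n → ℚ_[p]) := ⟨rfl⟩
    absDet a * ∫ x, ‖f.1 (x ᵥ* a.1)‖ ^ 2
      ∂(MeasureTheory.Measure.addHaar : MeasureTheory.Measure (Fin n → ℚ_[p]))) = l2NormSq f := by
  let _ : MeasurableSpace (Fin n → ℚ_[p]) := borel _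
  have _ : BorelSpace (Fin n → ℚ_[p]) := ⟨rfl⟩
  have h := MeasureTheory.addEquivAddHaarChar_smul_integral_map
    (MeasureTheory.Measure.addHaar : MeasureTheory.Measure (Fin n → ℚ_[p]))
    (f := fun x => ‖f.1 x‖ ^ 2) (rowMul a)
  have e : MeasurableEmbedding (rowMul a) := (rowMul a).toHomeomorph.measurableEmbedding
  rw [e.integral_map] at h
  exact h

/-- The quadratic form `x a bᵀ xᵀ / 2` attached to an element of `P_p`. -/
noncomputable def quadP (g : siegelP p n) (x : Fin n → ℚ_[p]) : ℚ_[p] :=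
  (x ᵥ* (blkA g.1 * (blkB g.1)ᵀ)) ⬝ᵥ x / 2

theorem continuous_quadP (g : siegelP p n) : Continuous (quadP g) := by
  unfold quadP
  fun_prop

/-- The operator `(r_P(α) f)(x) = |det a|^{1/2} e_p(x a bᵀ xᵀ / 2) f(x a)` for `α ∈ P_p`. -/
noncomputable def rPLin (g : siegelP p n) : SB p n →ₗ[ℂ] SB p n :=
  sbOp (fun x => (Real.sqrt (absDet (leviA g)) : ℂ) * ep (quadP g x))
    ((IsLocallyConstant.const _).mul (isLocallyConstant_ep.comp_continuous (continuous_quadP g)))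
    (rowMul (leviA g)).toHomeomorph

theorem rPLin_apply (g : siegelP p n) (f : SB p n) (x : Fin n → ℚ_[p]) :
    (rPLin g f).1 x = Real.sqrt (absDet (leviA g)) * ep (quadP g x) * f.1 (x ᵥ* blkA g.1) := rfl

theorem quadP_mul (g h : siegelP p n) (x : Fin n → ℚ_[p]) :
    quadP (g * h) x = quadP g x + quadP h (x ᵥ* blkA g.1) := by
  have hA : blkA (g * h).1 = blkA g.1 * blkA h.1 := by
    change blkA (g.1 * h.1) = _
    rw [blkA_mul, h.2, mul_zero, add_zero]
  have hB : blkB (g * h).1 = blkA g.1 * blkB h.1 + blkB g.1 * blkD h.1 := blkB_mul _ _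
  have e : blkA (g * h).1 * (blkB (g * h).1)ᵀ = blkA g.1 * (blkB g.1)ᵀ +
      blkA g.1 * (blkA h.1 * (blkB h.1)ᵀ) * (blkA g.1)ᵀ := by
    rw [hA, hB, Matrix.transpose_add, Matrix.transpose_mul, Matrix.transpose_mul, mul_add, add_comm]
    congr 1
    · rw [mul_assoc (blkA g.1), ← mul_assoc (blkA h.1), siegelP_mul_transpose, one_mul]
    · simp only [mul_assoc]
  unfold quadP
  rw [e, Matrix.vecMul_add, add_dotProduct, add_div]
  congr 2
  rw [← Matrix.vecMul_vecMul, Matrix.vecMul_transpose, ← Matrix.vecMul_vecMul, dotProduct_comm,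
    Matrix.dotProduct_mulVec, dotProduct_comm]

theorem rPLin_mul (g h : siegelP p n) : rPLin (g * h) = rPLin g ∘ₗ rPLin h := by
  ext f x
  rw [LinearMap.comp_apply, rPLin_apply, rPLin_apply, rPLin_apply, quadP_mul, ep_add, map_mul,
    absDet_mul, Real.sqrt_mul (absDet_pos _).le]
  have hA : blkA (g * h).1 = blkA g.1 * blkA h.1 := by
    change blkA (g.1 * h.1) = _
    rw [blkA_mul, h.2, mul_zero, add_zero]
  rw [hA, Matrix.vecMul_vecMul]
  push_cast
  ring

theorem rPLin_one : rPLin (1 : siegelP p n) = LinearMap.id := by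
  ext f x
  have hA : blkA (1 : siegelP p n).1 = 1 := blkA_one
  have hB : blkB (1 : siegelP p n).1 = 0 := blkB_one
  rw [rPLin_apply, map_one, absDet_one, quadP, hA, hB]
  simp [ep_eq_one]

/-- The operator `r_P(α)` as a linear automorphism. -/
noncomputable def rPEquiv (g : siegelP p n) : SB p n ≃ₗ[ℂ] SB p n :=
  LinearEquiv.ofLinearMap (rPLin g) (rPLin g⁻¹)
    (by rw [← rPLin_mul, mul_inv_cancel, rPLin_one])
    (by rw [← rPLin_mul, inv_mul_cancel, rPLin_one])

theorem rPEquiv_apply (g : siegelP p n) (f : SB p n) : rPEquiv g f = rPLin g f := rfl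

theorem rP_mem (g : siegelP p n) : ((g.1, rPEquiv g) : Sp p n × (SB p n ≃ₗ[ℂ] SB p n)) ∈ Mp p n := by
  refine ⟨fun u v f => ?_, fun f => ?_⟩
  · simp only [rPEquiv_apply]
    ext x
    rw [heis_apply, rPLin_apply, rPLin_apply, heis_apply, g.2]
    have hs := siegelP_symm g
    have h1 : quadP g (x + u) = quadP g x + quadP g u + (x ᵥ* blkA g.1) ⬝ᵥ (u ᵥ* blkB g.1) := by
      have e1 : (x ᵥ* (blkA g.1 * (blkB g.1)ᵀ)) ⬝ᵥ u = (x ᵥ* blkA g.1) ⬝ᵥ (u ᵥ* blkB g.1) := by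
        rw [← Matrix.vecMul_vecMul, Matrix.vecMul_transpose, dotProduct_comm,
          Matrix.dotProduct_mulVec, dotProduct_comm]
      have e2 : (u ᵥ* (blkA g.1 * (blkB g.1)ᵀ)) ⬝ᵥ x = (x ᵥ* blkA g.1) ⬝ᵥ (u ᵥ* blkB g.1) := by
        rw [← hs, ← Matrix.vecMul_vecMul, Matrix.vecMul_transpose, dotProduct_comm,
          Matrix.dotProduct_mulVec]
      unfold quadP
      rw [Matrix.add_vecMul, add_dotProduct, dotProduct_add, dotProduct_add, e1, e2]
      ring
    have h2 : (u ᵥ* blkA g.1) ⬝ᵥ (u ᵥ* blkB g.1) = 2 * quadP g u := by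
      unfold quadP
      rw [← Matrix.vecMul_vecMul, Matrix.vecMul_transpose, dotProduct_comm (_ *ᵥ _),
        Matrix.dotProduct_mulVec, dotProduct_comm]
      ring
    have h3 : ∀ w : Fin n → ℚ_[p], (w ᵥ* blkA g.1) ⬝ᵥ (v ᵥ* blkD g.1) = w ⬝ᵥ v := by
      intro w
      rw [← Matrix.mulVec_transpose (blkD g.1), Matrix.dotProduct_mulVec, Matrix.vecMul_vecMul,
        siegelP_mul_transpose, Matrix.vecMul_one]
    rw [Matrix.add_vecMul, Matrix.vecMul_zero, add_zero]
    have h4 : ep (x ⬝ᵥ v + u ⬝ᵥ v / 2) * ep (quadP g (x + u)) = ep (quadP g x) *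
        ep ((x ᵥ* blkA g.1) ⬝ᵥ (u ᵥ* blkB g.1 + v ᵥ* blkD g.1) +
          (u ᵥ* blkA g.1) ⬝ᵥ (u ᵥ* blkB g.1 + v ᵥ* blkD g.1) / 2) := by
      rw [← ep_add, ← ep_add, dotProduct_add, dotProduct_add, h3, h3, h2, h1]
      congr 1
      ring
    linear_combination (Real.sqrt (absDet (leviA g)) : ℂ) *
      f.1 (x ᵥ* blkA g.1 + u ᵥ* blkA g.1) * h4
  · rw [← l2NormSq_twist (leviA g) f]
    unfold l2NormSq
    rw [← MeasureTheory.integral_const_mul]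
    congr 1
    funext x
    simp only [rPEquiv_apply, rPLin_apply, norm_mul, norm_ep, mul_one, mul_pow]
    rw [Complex.norm_real, Real.norm_of_nonneg (Real.sqrt_nonneg _),
      Real.sq_sqrt (absDet_pos _).le]
    rfl

theorem rPEquiv_one : rPEquiv (1 : siegelP p n) = 1 :=
  LinearEquiv.ext fun f => by rw [rPEquiv_apply, rPLin_one]; rfl

theorem rPEquiv_mul (g h : siegelP p n) : rPEquiv (g * h) = rPEquiv g * rPEquiv h :=
  LinearEquiv.ext fun f => by rw [rPEquiv_apply, rPLin_mul]; rfl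

variable (p n) in
/-- The lift `r_P : P_p → M_p`. -/
noncomputable def rP : siegelP p n →* Mp p n where
  toFun g := ⟨(g.1, rPEquiv g), rP_mem g⟩
  map_one' := Subtype.ext (by
    change ((1 : siegelP p n).1, rPEquiv 1) = 1
    rw [rPEquiv_one]; rfl)
  map_mul' g h := Subtype.ext (by
    change ((g * h).1, rPEquiv (g * h)) = (g.1, rPEquiv g) * (h.1, rPEquiv h)
    rw [rPEquiv_mul, Prod.mk_mul_mk, Subgroup.coe_mul])

theorem vecMul_mem_zLattice {m : Matrix (Fin n) (Fin n) ℚ_[p]} (hm : EntriesIn 1 m)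
    {x : Fin n → ℚ_[p]} (hx : x ∈ zLattice p n) : x ᵥ* m ∈ zLattice p n := by
  rw [mem_zLattice] at hx ⊢
  intro j
  change ‖∑ k, x k * m k j‖ ≤ 1
  refine IsUltrametricDist.norm_sum_le_of_forall_le_of_nonneg zero_le_one fun k _ => ?_
  rw [norm_mul]
  exact mul_le_one₀ (hx k) (norm_nonneg _) ((hm k j).trans norm_one.le)

theorem rP_fix {L : Level} {g : siegelP p n} (hg : g ∈ levelD0 p n L) :
    rPLin g (phi0 p n) = phi0 p n := by
  obtain ⟨ha, hb, -, hd⟩ := Subgroup.mem_subgroupOf.1 hg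
  have hz : ∀ x, x ᵥ* blkA g.1 ∈ zLattice p n ↔ x ∈ zLattice p n := by
    refine fun x => ⟨fun h => ?_, vecMul_mem_zLattice ha⟩
    have := vecMul_mem_zLattice hd.transpose h
    rwa [Matrix.vecMul_vecMul, siegelP_mul_transpose, Matrix.vecMul_one] at this
  have hdet : absDet (leviA g) = 1 := absDet_eq_one hz
  ext x
  rw [rPLin_apply, hdet]
  by_cases hx : x ∈ zLattice p n
  · rw [phi0_of_mem hx, phi0_of_mem ((hz x).2 hx)]
    have : ‖quadP g x‖ ≤ 1 := by
      have h2 : ‖((2 : ℚ_[p]))⁻¹ * (L.b : ℚ_[p])⁻¹‖ ≤ 1 := by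
        obtain ⟨k, hk⟩ := L.b_inv_mem
        have : ((L.b : ℚ_[p])⁻¹) = 2 * (k : ℚ_[p]) := by exact_mod_cast congrArg (Rat.cast) hk
        rw [this, inv_mul_cancel_left₀ two_ne_zero]
        exact Padic.norm_int_le_one k
      unfold quadP
      rw [div_eq_mul_inv, mul_comm, norm_mul, dotProduct]
      have h3 : ‖∑ i, (x ᵥ* (blkA g.1 * (blkB g.1)ᵀ)) i * x i‖ ≤ ‖(L.b : ℚ_[p])⁻¹‖ := by
        refine IsUltrametricDist.norm_sum_le_of_forall_le_of_nonneg (norm_nonneg _) fun i _ => ?_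
        rw [norm_mul]
        refine (mul_le_of_le_one_right (norm_nonneg _) (mem_zLattice.1 hx i)).trans ?_
        change ‖∑ k, x k * (blkA g.1 * (blkB g.1)ᵀ) k i‖ ≤ _
        refine IsUltrametricDist.norm_sum_le_of_forall_le_of_nonneg (norm_nonneg _) fun k _ => ?_
        rw [norm_mul]
        refine (mul_le_of_le_one_left (norm_nonneg _) (mem_zLattice.1 hx k)).trans ?_
        have := (ha.mul hb.transpose) k i
        rwa [one_mul] at this
      calc _ ≤ ‖(2 : ℚ_[p])⁻¹‖ * ‖(L.b : ℚ_[p])⁻¹‖ := by gcongr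
        _ ≤ 1 := by rwa [← norm_mul]
    rw [ep_eq_one this]
    simp
  · rw [phi0_of_notMem hx, phi0_of_notMem (fun h => hx ((hz x).1 h)), mul_zero]

theorem rP_mem_metaTV {L : Level} {g : siegelP p n} (hg : g ∈ levelD0 p n L) :
    rP p n g ∈ metaTV p n L :=
  ⟨Subgroup.mem_subgroupOf.1 hg, 1, by rw [one_smul]; exact rP_fix hg⟩

theorem metaChar_rP {L : Level} {g : siegelP p n} (hg : g ∈ levelD0 p n L) :
    metaChar p n L ⟨rP p n g, rP_mem_metaTV hg⟩ = 1 := by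
  change (rPLin g (phi0 p n)).1 0 = 1
  rw [rP_fix hg, phi0_zero]

end Lifts

section LocalRings

variable (p : ℕ) [Fact p.Prime] (n : ℕ) (L : Level)

/-- The local Hecke ring `R_p`: the Hecke ring of `(V, M_p)`, factored by the relations
`V σ V = t · V (t σ) V` for `t ∈ 𝕋`. In terms of formal sums `∑ F(σ) V σ` over
right cosets of `𝕋 V`, these relations say `F (t σ) = t F(σ)`. -/
abbrev HeckeR : Type := HeckeAlg (metaTV p n L) (metaChar p n L)

/-- The local Hecke ring `S_{0p}` of the pair `((D_0)_p, P_p)`. (The preimage of `P_p` in `M_p` is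
identified with `𝕋 × P_p` through the lift `r_P`, so the metaplectic Hecke ring of the parabolic
subgroup, factored by the relations `V₀ α V₀ = t · V₀ (t α) V₀`, is this ring.) -/
abbrev HeckeS0 : Type := HeckeAlg (levelD0 p n L) (1 : levelD0 p n L →* ℂ)

variable {p n L} in
theorem eps_mem (F : HeckeR p n L) :
    (fun g => F (rP p n g)) ∈ heckeModule (levelD0 p n L) (1 : levelD0 p n L →* ℂ) := by
  refine ⟨fun k g => ?_, fun k g => ?_, ?_⟩
  · beta_reduce
    rw [map_mul, F.left_eq (rP_mem_metaTV k.2), metaChar_rP k.2, MonoidHom.one_apply]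
  · beta_reduce
    rw [map_mul, F.right_eq (rP_mem_metaTV k.2), metaChar_rP k.2, MonoidHom.one_apply]
  · have h : ∀ c d : siegelP p n, rightCoset (metaTV p n L) (rP p n c) =
        rightCoset (metaTV p n L) (rP p n d) →
        rightCoset (levelD0 p n L) c = rightCoset (levelD0 p n L) d := by
      intro c d hcd
      rw [rightCoset_eq, ← map_inv, ← map_mul] at hcd
      exact rightCoset_eq.2 (Subgroup.mem_subgroupOf.2 hcd.1)
    refine Set.Finite.of_finite_image (f := fun c : RightCosets (levelD0 p n L) =>
      rightCoset (metaTV p n L) (rP p n c.out)) (F.finite_supp.subset ?_) ?_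
    · rintro _ ⟨_, ⟨g, hg, rfl⟩, rfl⟩
      obtain ⟨k, hk, h⟩ := out_spec (levelD0 p n L) g
      refine ⟨rP p n g, hg, ?_⟩
      simp only [h]
      rw [rightCoset_eq, map_mul, mul_assoc, mul_inv_cancel, mul_one]
      exact rP_mem_metaTV hk
    · intro c _ d _ hcd
      have := h _ _ hcd
      rwa [rightCoset, rightCoset, Quotient.out_eq, Quotient.out_eq] at this

/-- The embedding `ε : R_p → S_{0p}`, `V g ↦ (D_0)_p g`: every coset of `𝕋 V` is written with a
representative in `r_P(P_p)`, and `∑ F(r_P(g)) V r_P(g)` is sent to `∑ F(r_P(g)) (D_0)_p g`. -/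
noncomputable def eps : HeckeR p n L →ₗ[ℂ] HeckeS0 p n L where
  toFun F := HeckeAlg.mk (fun g => F (rP p n g)) (eps_mem F)
  map_add' _ _ := rfl
  map_smul' _ _ := rfl

/-- The scalar matrix `p I_n`. -/
noncomputable def scalarP : GL (Fin n) ℚ_[p] :=
  Units.map (Matrix.scalar (Fin n)).toMonoidHom
    (Units.mk0 (p : ℚ_[p]) (by exact_mod_cast (Fact.out : p.Prime).ne_zero))

/-- The element `diag[p⁻¹ I_n, p I_n]` of `P_p`. -/
noncomputable def frobElt : siegelP p n := siegelDiag (scalarP p n)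

theorem blkA_frob : blkA (frobElt p n).1 = (p : ℚ_[p])⁻¹ • (1 : Matrix (Fin n) (Fin n) ℚ_[p]) := by
  change Matrix.toBlocks₁₁ (Matrix.fromBlocks _ _ _ _) = _
  rw [Matrix.toBlocks_fromBlocks₁₁, scalarP, ← map_inv]
  ext i j
  simp [Matrix.one_apply, Matrix.diagonal_apply, eq_comm]

theorem blkD_frob : blkD (frobElt p n).1 = (p : ℚ_[p]) • (1 : Matrix (Fin n) (Fin n) ℚ_[p]) := by
  change Matrix.toBlocks₂₂ (Matrix.fromBlocks _ _ _ _) = _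
  rw [Matrix.toBlocks_fromBlocks₂₂, scalarP]
  ext i j
  simp [Matrix.one_apply, Matrix.natCast_apply]

theorem blkB_frob : blkB (frobElt p n).1 = 0 := by
  change Matrix.toBlocks₁₂ (Matrix.fromBlocks _ _ _ _) = _
  rw [Matrix.toBlocks_fromBlocks₁₂]

variable {p n L} in
/-- The conjugate of `e ∈ (D_0)_p` by `diag[p⁻¹, p]` is in `(D_0)_p` if `b_e ∈ p² 𝔟_p⁻¹`. -/
theorem frob_conj_mem {e : siegelP p n} (he : e ∈ levelD0 p n L)
    (hB : EntriesIn ((p : ℚ_[p]) ^ 2 * (L.b : ℚ_[p])⁻¹) (blkB e.1)) :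
    frobElt p n * e * (frobElt p n)⁻¹ ∈ levelD0 p n L := by
  have hp : (p : ℚ_[p]) ≠ 0 := by exact_mod_cast (Fact.out : p.Prime).ne_zero
  obtain ⟨ha, -, -, hd⟩ := Subgroup.mem_subgroupOf.1 he
  refine Subgroup.mem_subgroupOf.2 ⟨?_, ?_, ?_, ?_⟩
  · change EntriesIn 1 (blkA ((frobElt p n).1 * e.1 * (frobElt p n).1⁻¹))
    rw [blkA_mul, blkA_mul, blkC_inv, blkA_inv, blkB_frob, blkA_frob, blkD_frob, (frobElt p n).2]
    simpa [smul_smul, hp] using ha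
  · change EntriesIn (L.b : ℚ_[p])⁻¹ (blkB ((frobElt p n).1 * e.1 * (frobElt p n).1⁻¹))
    rw [blkB_mul, blkA_mul, blkB_mul, blkB_inv, blkD_inv, blkB_frob, blkA_frob]
    intro i j
    have h := hB i j
    have hp2 : 0 < ‖(p : ℚ_[p])‖ := norm_pos_iff.2 hp
    rw [norm_mul, norm_pow] at h
    simp only [Matrix.transpose_zero, neg_zero, mul_zero, zero_mul, add_zero, zero_add,
      Matrix.smul_mul, one_mul, Matrix.transpose_smul, Matrix.transpose_one, Matrix.mul_smul,
      mul_one, Matrix.smul_apply, smul_eq_mul, norm_mul, norm_inv] at h ⊢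
    rw [← mul_assoc, ← mul_inv, ← sq, inv_mul_le_iff₀ (by positivity)]
    exact h
  · have h := (frobElt p n * e * (frobElt p n)⁻¹).2
    change EntriesIn _ (blkC _)
    rw [show blkC (frobElt p n * e * (frobElt p n)⁻¹).1 = 0 from h]
    exact .zero _
  · change EntriesIn 1 (blkD ((frobElt p n).1 * e.1 * (frobElt p n).1⁻¹))
    rw [blkD_mul, blkD_mul, blkC_mul, blkB_inv, blkD_inv, blkB_frob, blkA_frob, blkD_frob,
      (frobElt p n).2]
    simpa [smul_smul, hp] using hd

variable {p} in
theorem norm_le_of_toZModPow_eq {x y : ℤ_[p]}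
    (h : PadicInt.toZModPow 2 x = PadicInt.toZModPow 2 y) :
    ‖(x : ℚ_[p]) - y‖ ≤ ‖(p : ℚ_[p]) ^ 2‖ := by
  have h1 : x - y ∈ RingHom.ker (PadicInt.toZModPow (p := p) 2) := by
    rw [RingHom.mem_ker, map_sub, h, sub_self]
  rw [PadicInt.ker_toZModPow, ← PadicInt.norm_le_pow_iff_mem_span_pow] at h1
  rw [Padic.norm_p_pow]
  exact h1

theorem frob_finite : (rightCoset (levelD0 p n L) '' {x | ∃ k₁ ∈ levelD0 p n L,
    ∃ k₂ ∈ levelD0 p n L, x = k₁ * frobElt p n * k₂}).Finite := by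
  have hb : (L.b : ℚ_[p]) ≠ 0 := by exact_mod_cast L.b_pos.ne'
  have hBint : ∀ k : levelD0 p n L, ∀ i j, ‖(L.b : ℚ_[p]) * blkB k.1.1 i j‖ ≤ 1 := by
    intro k i j
    have h := (Subgroup.mem_subgroupOf.1 k.2).2.1 i j
    rw [norm_mul]
    calc _ ≤ ‖(L.b : ℚ_[p])‖ * ‖(L.b : ℚ_[p])⁻¹‖ := by gcongr
      _ = 1 := by rw [← norm_mul, mul_inv_cancel₀ hb, norm_one]
  have hAint : ∀ k : levelD0 p n L, ∀ i j, ‖blkA k.1.1 i j‖ ≤ 1 := fun k i j =>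
    ((Subgroup.mem_subgroupOf.1 k.2).1 i j).trans norm_one.le
  have : NeZero (p ^ 2) := ⟨pow_ne_zero _ (Fact.out : p.Prime).ne_zero⟩
  let res : levelD0 p n L → (Fin n → Fin n → ZMod (p ^ 2)) × (Fin n → Fin n → ZMod (p ^ 2)) :=
    fun k => (fun i j => PadicInt.toZModPow 2 ⟨_, hAint k i j⟩,
      fun i j => PadicInt.toZModPow 2 ⟨_, hBint k i j⟩)
  have key : ∀ k k' : levelD0 p n L, res k = res k' →
      rightCoset (levelD0 p n L) (frobElt p n * k.1) =
      rightCoset (levelD0 p n L) (frobElt p n * k'.1) := by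
    intro k k' h
    have hA : EntriesIn ((p : ℚ_[p]) ^ 2) (blkA k'.1.1 - blkA k.1.1) := fun i j =>
      norm_le_of_toZModPow_eq (congrFun (congrFun (congrArg Prod.fst h.symm) i) j)
    have hB : EntriesIn ((p : ℚ_[p]) ^ 2 * (L.b : ℚ_[p])⁻¹) (blkB k'.1.1 - blkB k.1.1) := by
      intro i j
      have h1 := norm_le_of_toZModPow_eq (congrFun (congrFun (congrArg Prod.snd h.symm) i) j)
      change ‖(L.b : ℚ_[p]) * blkB k'.1.1 i j - (L.b : ℚ_[p]) * blkB k.1.1 i j‖ ≤ _ at h1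
      rw [← mul_sub, norm_mul] at h1
      rw [norm_mul, norm_inv, ← div_eq_mul_inv, le_div_iff₀ (norm_pos_iff.2 hb), mul_comm]
      exact h1
    rw [rightCoset_eq]
    have e : frobElt p n * k'.1 * (frobElt p n * k.1)⁻¹ =
        frobElt p n * (k'.1 * k.1⁻¹) * (frobElt p n)⁻¹ := by group
    rw [e]
    refine frob_conj_mem (mul_mem k'.2 (inv_mem k.2)) ?_
    have e2 : blkB (k'.1 * k.1⁻¹).1 = (blkB k'.1.1 - blkB k.1.1) * (blkA k.1.1)ᵀ +
        -((blkA k'.1.1 - blkA k.1.1) * (blkB k.1.1)ᵀ) := by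
      change blkB (k'.1.1 * k.1.1⁻¹) = _
      rw [blkB_mul, blkB_inv, blkD_inv, sub_mul, sub_mul, siegelP_symm k.1, mul_neg]
      abel
    rw [e2]
    obtain ⟨ha, hb', -, -⟩ := Subgroup.mem_subgroupOf.1 k.2
    exact (by simpa using hB.mul ha.transpose : EntriesIn _ _).add (hA.mul hb'.transpose).neg
  have hfin : (Set.range fun k : levelD0 p n L =>
      rightCoset (levelD0 p n L) (frobElt p n * k.1)).Finite := by
    refine Set.Finite.subset (Set.finite_range fun r : Set.range res =>
      rightCoset (levelD0 p n L) (frobElt p n * (r.2.choose).1)) ?_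
    rintro _ ⟨k, rfl⟩
    have hr : res k ∈ Set.range res := ⟨k, rfl⟩
    exact ⟨⟨res k, hr⟩, key _ _ hr.choose_spec⟩
  refine hfin.subset ?_
  rintro _ ⟨_, ⟨k₁, h₁, k₂, h₂, rfl⟩, rfl⟩
  refine ⟨⟨k₂, h₂⟩, ?_⟩
  rw [rightCoset_eq, mul_assoc k₁, mul_assoc, mul_inv_cancel, mul_one]
  exact h₁

/-- The Frobenius element `U_p = (D_0)_p diag[p⁻¹ I_n, p I_n] (D_0)_p` of `S_{0p}`. -/
noncomputable def frobU : HeckeS0 p n L := HeckeAlg.doubleCoset _ (frobElt p n) (frob_finite p n L)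

/-- `GL_n(ℤ_p)` as a subgroup of `GL_n(ℚ_p)`. -/
noncomputable def glZ : Subgroup (GL (Fin n) ℚ_[p]) :=
  (Matrix.GeneralLinearGroup.map (algebraMap ℤ_[p] ℚ_[p])).range

/-- The map `Φ'_p : ∑ F(g) (D_0)_p g ↦ ∑ F(g) GL_n(ℤ_p) d_g` from `S_{0p}` to formal sums of cosets
in `GL_n(ℤ_p) \ GL_n(ℚ_p)`. -/
noncomputable def phiMap : HeckeS0 p n L →ₗ[ℂ] (RightCosets (glZ p n) →₀ ℂ) :=
  (Finsupp.lmapDomain ℂ ℂ fun c : RightCosets (levelD0 p n L) =>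
    rightCoset (glZ p n) (levi c.out)) ∘ₗ HeckeAlg.toFormalSum (levelD0 p n L)

/-- The Laurent polynomial ring `ℂ[x₁^±, …, x_n^±]`; the monomial `x^a` is `single a 1`. -/
abbrev Laurent (n : ℕ) : Type := AddMonoidAlgebra ℂ (Fin n → ℤ)

variable {p n} in
/-- The coset `GL_n(ℤ_p) d` contains an upper triangular matrix with diagonal `p^{a_1}, …, p^{a_n}`.
For each coset this holds for exactly one `a`. -/
def HasDiag (c : RightCosets (glZ p n)) (a : Fin n → ℤ) : Prop :=
  ∃ d : GL (Fin n) ℚ_[p], rightCoset (glZ p n) d = c ∧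
    (∀ i j, j < i → d.1 i j = 0) ∧ ∀ i, d.1 i i = (p : ℚ_[p]) ^ a i

open Classical in
variable {p n} in
/-- `ω_{0p}(GL_n(ℤ_p) d) = ∏ (p^{-i} x_i)^{a_i}` (with `i = 1, …, n`) if the coset contains an upper
triangular matrix with diagonal `p^{a_1}, …, p^{a_n}`. -/
noncomputable def cosetMonomial (c : RightCosets (glZ p n)) : Laurent n :=
  if h : ∃ a, HasDiag c a then
    AddMonoidAlgebra.single h.choose (∏ i : Fin n, ((p : ℂ) ^ (-((i : ℤ) + 1))) ^ h.choose i)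
  else 0

/-- The linear map `ω_{0p}` on formal sums of cosets. -/
noncomputable def omega0 : (RightCosets (glZ p n) →₀ ℂ) →ₗ[ℂ] Laurent n :=
  Finsupp.linearCombination ℂ cosetMonomial

/-- The map `ω'_p = ω_{0p} ∘ Φ'_p` on `S_{0p}`. -/
noncomputable def omegaS : HeckeS0 p n L →ₗ[ℂ] Laurent n := omega0 p n ∘ₗ phiMap p n L

/-- The Satake map `ω_p = ω'_p ∘ ε` on `R_p`. -/
noncomputable def omegaR : HeckeR p n L →ₗ[ℂ] Laurent n := omegaS p n L ∘ₗ eps p n L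

open Polynomial in
/-- `R̃_n(z) = ∏_δ (1 - p^{n(n+1)/2} x₁^{δ₁} ⋯ x_n^{δ_n} z)`, over all `δ ∈ {±1}^n`. -/
noncomputable def heckePolyTilde : (Laurent n)[X] :=
  ∏ δ : Fin n → ℤˣ,
    (1 - C (AddMonoidAlgebra.single (fun i => (δ i : ℤ)) ((p : ℂ) ^ (n * (n + 1) / 2))) * X)

/-- The Laurent polynomials `T̃_m`, defined by `R̃_n(z) = ∑ (-1)^m T̃_m z^m`. -/
noncomputable def TTilde (m : ℕ) : Laurent n := (-1) ^ m * (heckePolyTilde p n).coeff m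

variable {p n L}

/-- `V_m = ∑_{l ≤ m} (-1)^l T_l U_p^{m-l}` in `S_{0p}`, with `T_l` embedded by `ε`. -/
noncomputable def heckeV (T : ℕ → HeckeR p n L) (m : ℕ) : HeckeS0 p n L :=
  ∑ l ∈ Finset.range (m + 1), (-1) ^ l * eps p n L (T l) * frobU p n L ^ (m - l)

open Polynomial in
/-- `R_n(z) = ∑_{m ≤ 2^n} (-1)^m T_m z^m` as a polynomial over `S_{0p}`, with `T_m` embedded
by `ε`. -/
noncomputable def heckePoly (T : ℕ → HeckeR p n L) : (HeckeS0 p n L)[X] :=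
  ∑ m ∈ Finset.range (2 ^ n + 1), C ((-1) ^ m * eps p n L (T m)) * X ^ m

end LocalRings

end MetaHecke

namespace MetaHecke

section Integrality

variable {p : ℕ} [Fact p.Prime] {n : ℕ} {L : Level}

theorem Level.norm_b_inv_le (L : Level) : ‖(L.b : ℚ_[p])⁻¹‖ ≤ ‖(2 : ℚ_[p])‖ := by
  obtain ⟨k, hk⟩ := L.b_inv_mem
  have : ((L.b : ℚ_[p])⁻¹) = 2 * (k : ℚ_[p]) := by exact_mod_cast congrArg (Rat.cast) hk
  rw [this, norm_mul]
  exact mul_le_of_le_one_right (norm_nonneg _) (Padic.norm_int_le_one k)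

theorem Level.norm_c (hp : ¬ p ∣ L.c) : ‖(L.c : ℚ_[p])‖ = 1 := by
  rw [Padic.norm_natCast_eq_one_iff]
  exact (Nat.Prime.coprime_iff_not_dvd Fact.out).2 hp

theorem Level.norm_b_le (hp : ¬ p ∣ L.c) : ‖(L.b : ℚ_[p])‖ ≤ ‖(2 : ℚ_[p])‖ := by
  obtain ⟨k, hk⟩ := L.bc_mem
  have : ((L.b : ℚ_[p]) * L.c) = 2 * (k : ℚ_[p]) := by exact_mod_cast congrArg (Rat.cast) hk
  have h := congrArg norm this
  rw [norm_mul, Level.norm_c hp, mul_one, norm_mul] at h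
  rw [h]
  exact mul_le_of_le_one_right (norm_nonneg _) (Padic.norm_int_le_one k)

theorem norm_two_le_one : ‖(2 : ℚ_[p])‖ ≤ 1 := by
  exact_mod_cast Padic.norm_int_le_one (p := p) 2

theorem Level.norm_b (hp : ¬ p ∣ L.c) : ‖(L.b : ℚ_[p])‖ = 1 := by
  have hb : 0 < ‖(L.b : ℚ_[p])‖ := norm_pos_iff.2 (by exact_mod_cast L.b_pos.ne')
  refine le_antisymm ((Level.norm_b_le hp).trans norm_two_le_one) ?_
  have := (L.norm_b_inv_le (p := p)).trans norm_two_le_one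
  rw [norm_inv] at this
  exact (inv_le_one₀ hb).1 this

theorem Level.norm_two (hp : ¬ p ∣ L.c) : ‖(2 : ℚ_[p])‖ = 1 :=
  le_antisymm norm_two_le_one ((Level.norm_b hp).symm.le.trans (Level.norm_b_le hp))

/-- All entries of the matrix are `p`-adic integers. -/
def Integral {ι κ : Type*} (m : Matrix ι κ ℚ_[p]) : Prop := ∀ i j, ‖m i j‖ ≤ 1

theorem Integral.mul {ι κ τ : Type*} [Fintype κ] {m : Matrix ι κ ℚ_[p]} {m' : Matrix κ τ ℚ_[p]}
    (h : Integral m) (h' : Integral m') : Integral (m * m') := fun i j => by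
  rw [Matrix.mul_apply]
  refine IsUltrametricDist.norm_sum_le_of_forall_le_of_nonneg zero_le_one fun k _ => ?_
  rw [norm_mul]
  exact mul_le_one₀ (h i k) (norm_nonneg _) (h' k j)

theorem Integral.add {ι κ : Type*} {m m' : Matrix ι κ ℚ_[p]} (h : Integral m) (h' : Integral m') :
    Integral (m + m') := fun i j =>
  (IsUltrametricDist.norm_add_le_max (m i j) (m' i j)).trans (max_le (h i j) (h' i j))

theorem Integral.neg {ι κ : Type*} {m : Matrix ι κ ℚ_[p]} (h : Integral m) : Integral (-m) :=
  fun i j => by simpa using h i j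

theorem Integral.sub {ι κ : Type*} {m m' : Matrix ι κ ℚ_[p]} (h : Integral m) (h' : Integral m') :
    Integral (m - m') := by
  rw [sub_eq_add_neg]; exact h.add h'.neg

theorem Integral.transpose {ι κ : Type*} {m : Matrix ι κ ℚ_[p]} (h : Integral m) : Integral mᵀ :=
  fun i j => h j i

theorem Integral.zero {ι κ : Type*} : Integral (0 : Matrix ι κ ℚ_[p]) := fun i j => by simp

theorem Integral.one {ι : Type*} [DecidableEq ι] : Integral (1 : Matrix ι ι ℚ_[p]) := fun i j => by
  rw [Matrix.one_apply]; split_ifs <;> simp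

theorem Integral.diagonal {ι : Type*} [DecidableEq ι] {v : ι → ℚ_[p]} (h : ∀ i, ‖v i‖ ≤ 1) :
    Integral (Matrix.diagonal v) := fun i j => by
  rw [Matrix.diagonal_apply]; split_ifs
  · exact h i
  · simp

theorem entriesIn_iff {r : ℚ_[p]} (hr : ‖r‖ = 1) {m : Matrix (Fin n) (Fin n) ℚ_[p]} :
    EntriesIn r m ↔ Integral m := by
  unfold EntriesIn Integral; rw [hr]

theorem integral_iff_blk {g : Sp p n} : Integral g.1 ↔
    Integral (blkA g) ∧ Integral (blkB g) ∧ Integral (blkC g) ∧ Integral (blkD g) := by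
  constructor
  · exact fun h => ⟨fun i j => h _ _, fun i j => h _ _, fun i j => h _ _, fun i j => h _ _⟩
  · rintro ⟨ha, hb, hc, hd⟩ (i | i) (j | j)
    · exact ha i j
    · exact hb i j
    · exact hc i j
    · exact hd i j

theorem mem_levelD (hp : ¬ p ∣ L.c) {g : Sp p n} : g ∈ levelD p n L ↔ Integral g.1 := by
  change (_ ∧ _ ∧ _ ∧ _) ↔ _
  rw [integral_iff_blk, entriesIn_iff norm_one, entriesIn_iff norm_one, entriesIn_iff,
    entriesIn_iff]
  · rw [norm_mul, Level.norm_b hp, Level.norm_c hp, mul_one]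
  · rw [norm_inv, Level.norm_b hp, inv_one]

theorem mem_levelD0 (hp : ¬ p ∣ L.c) {g : siegelP p n} : g ∈ levelD0 p n L ↔ Integral g.1.1 := by
  rw [levelD0, Subgroup.mem_subgroupOf, mem_levelD hp]

theorem mem_levelD0_of {g : siegelP p n} (hp : ¬ p ∣ L.c) (ha : Integral (blkA g.1))
    (hb : Integral (blkB g.1)) (hd : Integral (blkD g.1)) : g ∈ levelD0 p n L := by
  rw [mem_levelD0 hp, integral_iff_blk]
  exact ⟨ha, hb, by rw [show blkC g.1 = 0 from g.2]; exact .zero, hd⟩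

theorem mem_glZ {d : GL (Fin n) ℚ_[p]} : d ∈ glZ p n ↔ Integral d.1 ∧ Integral (d⁻¹).1 := by
  constructor
  · rintro ⟨u, rfl⟩
    refine ⟨fun i j => PadicInt.norm_le_one _, ?_⟩
    rw [← map_inv]
    exact fun i j => PadicInt.norm_le_one _
  · rintro ⟨h1, h2⟩
    let A : Matrix (Fin n) (Fin n) ℤ_[p] := fun i j => ⟨d.1 i j, h1 i j⟩
    let A' : Matrix (Fin n) (Fin n) ℤ_[p] := fun i j => ⟨(d⁻¹).1 i j, h2 i j⟩
    have hA : (algebraMap ℤ_[p] ℚ_[p]).mapMatrix A = d.1 := rfl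
    have hA' : (algebraMap ℤ_[p] ℚ_[p]).mapMatrix A' = (d⁻¹).1 := rfl
    have inj : Function.Injective ((algebraMap ℤ_[p] ℚ_[p]).mapMatrix (m := Fin n)) :=
      Matrix.map_injective (FaithfulSMul.algebraMap_injective ℤ_[p] ℚ_[p])
    refine ⟨⟨A, A', inj ?_, inj ?_⟩, Units.ext hA⟩
    · rw [map_mul, hA, hA', map_one]; exact Units.mul_inv d
    · rw [map_mul, hA, hA', map_one]; exact Units.inv_mul d

/-- The unipotent element `(1, S; 0, 1)` of `P_p`. -/
noncomputable def siegelN (S : Matrix (Fin n) (Fin n) ℚ_[p]) (hS : Sᵀ = S) : siegelP p n :=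
  ⟨⟨Matrix.fromBlocks 1 S 0 1, by
    rw [SymplecticGroup.fromBlocks_mem_iff]; simp [hS]⟩, by
    change Matrix.toBlocks₂₁ _ = 0
    rw [Matrix.toBlocks_fromBlocks₂₁]⟩

theorem blkA_siegelN {S : Matrix (Fin n) (Fin n) ℚ_[p]} (hS : Sᵀ = S) :
    blkA (siegelN S hS).1 = 1 := Matrix.toBlocks_fromBlocks₁₁ _ _ _ _
theorem blkB_siegelN {S : Matrix (Fin n) (Fin n) ℚ_[p]} (hS : Sᵀ = S) :
    blkB (siegelN S hS).1 = S := Matrix.toBlocks_fromBlocks₁₂ _ _ _ _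
theorem blkD_siegelN {S : Matrix (Fin n) (Fin n) ℚ_[p]} (hS : Sᵀ = S) :
    blkD (siegelN S hS).1 = 1 := Matrix.toBlocks_fromBlocks₂₂ _ _ _ _

theorem blkA_siegelDiag (r : GL (Fin n) ℚ_[p]) : blkA (siegelDiag r).1 = (r⁻¹).1ᵀ :=
  Matrix.toBlocks_fromBlocks₁₁ _ _ _ _
theorem blkB_siegelDiag (r : GL (Fin n) ℚ_[p]) : blkB (siegelDiag r).1 = 0 :=
  Matrix.toBlocks_fromBlocks₁₂ _ _ _ _
theorem blkD_siegelDiag (r : GL (Fin n) ℚ_[p]) : blkD (siegelDiag r).1 = r.1 :=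
  Matrix.toBlocks_fromBlocks₂₂ _ _ _ _

theorem siegelP_ext {g h : siegelP p n} (ha : blkA g.1 = blkA h.1) (hb : blkB g.1 = blkB h.1)
    (hd : blkD g.1 = blkD h.1) : g = h := by
  refine Subtype.ext (Subtype.ext ?_)
  rw [eq_fromBlocks g.1, eq_fromBlocks h.1, ha, hb, hd, show blkC g.1 = 0 from g.2,
    show blkC h.1 = 0 from h.2]

theorem blkA_mulP (g h : siegelP p n) : blkA (g * h).1 = blkA g.1 * blkA h.1 := by
  change blkA (g.1 * h.1) = _
  rw [blkA_mul, show blkC h.1 = 0 from h.2, mul_zero, add_zero]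
theorem blkB_mulP (g h : siegelP p n) :
    blkB (g * h).1 = blkA g.1 * blkB h.1 + blkB g.1 * blkD h.1 := blkB_mul g.1 h.1
theorem blkD_mulP (g h : siegelP p n) : blkD (g * h).1 = blkD g.1 * blkD h.1 := by
  change blkD (g.1 * h.1) = _
  rw [blkD_mul, show blkC g.1 = 0 from g.2, zero_mul, zero_add]

theorem siegelDiag_mul (r s : GL (Fin n) ℚ_[p]) :
    siegelDiag (r * s) = siegelDiag r * siegelDiag s := by
  refine siegelP_ext ?_ ?_ ?_
  · rw [blkA_mulP, blkA_siegelDiag, blkA_siegelDiag, blkA_siegelDiag, mul_inv_rev, Units.val_mul,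
      Matrix.transpose_mul]
  · rw [blkB_mulP, blkB_siegelDiag, blkB_siegelDiag, blkB_siegelDiag, mul_zero, zero_mul, add_zero]
  · rw [blkD_mulP, blkD_siegelDiag, blkD_siegelDiag, blkD_siegelDiag, Units.val_mul]

theorem levi_siegelDiag (r : GL (Fin n) ℚ_[p]) : levi (siegelDiag r) = r :=
  Units.ext (blkD_siegelDiag r)

theorem siegelDiag_mem (hp : ¬ p ∣ L.c) {u : GL (Fin n) ℚ_[p]} (hu : u ∈ glZ p n) :
    siegelDiag u ∈ levelD0 p n L := by
  obtain ⟨h1, h2⟩ := mem_glZ.1 hu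
  refine mem_levelD0_of hp ?_ ?_ ?_
  · rw [blkA_siegelDiag]; exact h2.transpose
  · rw [blkB_siegelDiag]; exact .zero
  · rw [blkD_siegelDiag]; exact h1

theorem siegelN_mem (hp : ¬ p ∣ L.c) {S : Matrix (Fin n) (Fin n) ℚ_[p]} (hS : Sᵀ = S)
    (h : Integral S) : siegelN S hS ∈ levelD0 p n L := by
  refine mem_levelD0_of hp ?_ ?_ ?_
  · rw [blkA_siegelN]; exact .one
  · rw [blkB_siegelN]; exact h
  · rw [blkD_siegelN]; exact .one

theorem levi_mem (hp : ¬ p ∣ L.c) {g : siegelP p n} (hg : g ∈ levelD0 p n L) :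
    levi g ∈ glZ p n := by
  obtain ⟨ha, -, -, hd⟩ := integral_iff_blk.1 ((mem_levelD0 hp).1 hg)
  exact mem_glZ.2 ⟨hd, ha.transpose⟩

/-- Elements of `P_p` factor as `m(d) n(S)`, with `S = dᵀ b`. -/
theorem siegelP_transpose_D_mul_B (g : siegelP p n) :
    ((blkD g.1)ᵀ * blkB g.1)ᵀ = (blkD g.1)ᵀ * blkB g.1 := by
  have h := congrArg blkB (inv_mul_cancel g.1)
  rw [blkB_mul, blkB_one, blkA_inv, blkB_inv, Matrix.neg_mul, add_neg_eq_zero] at h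
  rw [Matrix.transpose_mul, Matrix.transpose_transpose, h]

theorem siegelP_eq (g : siegelP p n) : g = siegelDiag (levi g) *
    siegelN ((blkD g.1)ᵀ * blkB g.1) (siegelP_transpose_D_mul_B g) := by
  have ha : blkA (siegelDiag (levi g)).1 = blkA g.1 := by
    rw [blkA_siegelDiag]; exact Matrix.transpose_transpose _
  have hd : blkD (siegelDiag (levi g)).1 = blkD g.1 := blkD_siegelDiag _
  refine siegelP_ext ?_ ?_ ?_
  · rw [blkA_mulP, blkA_siegelN, mul_one, ha]
  · rw [blkB_mulP, blkB_siegelN, blkB_siegelDiag, zero_mul, add_zero, ha, ← mul_assoc,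
      siegelP_mul_transpose, one_mul]
  · rw [blkD_mulP, blkD_siegelN, mul_one, hd]

end Integrality

section Heisenberg

variable {p : ℕ} [Fact p.Prime] {n : ℕ} {L : Level}

/-- The Heisenberg operator `U(w)` for `w = (u, v)`. -/
noncomputable def heisW (w : (Fin n → ℚ_[p]) × (Fin n → ℚ_[p])) : SB p n →ₗ[ℂ] SB p n :=
    heis w.1 w.2

theorem heisW_apply (w : (Fin n → ℚ_[p]) × (Fin n → ℚ_[p])) (f : SB p n) (x : Fin n → ℚ_[p]) :
    (heisW w f).1 x = ep (x ⬝ᵥ w.2 + w.1 ⬝ᵥ w.2 / 2) * f.1 (x + w.1) := rfl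

/-- The symplectic form on `ℚ_p^{2n}`. -/
noncomputable def sympl (w w' : (Fin n → ℚ_[p]) × (Fin n → ℚ_[p])) : ℚ_[p] :=
  w.1 ⬝ᵥ w'.2 - w'.1 ⬝ᵥ w.2

/-- The right action of `Sp_n(ℚ_p)` on row vectors. -/
noncomputable def actR (w : (Fin n → ℚ_[p]) × (Fin n → ℚ_[p])) (g : Sp p n) :
    (Fin n → ℚ_[p]) × (Fin n → ℚ_[p]) :=
  (w.1 ᵥ* blkA g + w.2 ᵥ* blkC g, w.1 ᵥ* blkB g + w.2 ᵥ* blkD g)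

theorem actR_mul (w : (Fin n → ℚ_[p]) × (Fin n → ℚ_[p])) (g h : Sp p n) :
    actR w (g * h) = actR (actR w g) h := by
  unfold actR
  rw [blkA_mul, blkB_mul, blkC_mul, blkD_mul]
  simp only [Matrix.vecMul_add, Matrix.add_vecMul, Matrix.vecMul_vecMul]
  ext1
  · dsimp only; abel
  · dsimp only; abel

theorem actR_one (w : (Fin n → ℚ_[p]) × (Fin n → ℚ_[p])) : actR w 1 = w := by
  unfold actR
  rw [blkA_one, blkB_one, blkC_one, blkD_one]
  simp

theorem actR_sub (w w' : (Fin n → ℚ_[p]) × (Fin n → ℚ_[p])) (g : Sp p n) :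
    actR (w - w') g = actR w g - actR w' g := by
  unfold actR
  simp only [Prod.fst_sub, Prod.snd_sub, Matrix.sub_vecMul]
  ext1
  · simp only [Prod.fst_sub]; abel
  · simp only [Prod.snd_sub]; abel

theorem actR_add (w w' : (Fin n → ℚ_[p]) × (Fin n → ℚ_[p])) (g : Sp p n) :
    actR (w + w') g = actR w g + actR w' g := by
  unfold actR
  simp only [Prod.fst_add, Prod.snd_add, Matrix.add_vecMul]
  ext1
  · simp only [Prod.fst_add]; abel
  · simp only [Prod.snd_add]; abel

theorem vecMul_dotProduct_vecMul (u v : Fin n → ℚ_[p]) (A B : Matrix (Fin n) (Fin n) ℚ_[p]) :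
    (u ᵥ* A) ⬝ᵥ (v ᵥ* B) = u ⬝ᵥ ((A * Bᵀ) *ᵥ v) := by
  rw [← Matrix.mulVec_mulVec, Matrix.mulVec_transpose, Matrix.dotProduct_mulVec]

theorem sympl_actR (w w' : (Fin n → ℚ_[p]) × (Fin n → ℚ_[p])) (g : Sp p n) :
    sympl (actR w g) (actR w' g) = sympl w w' := by
  have h := mul_inv_cancel g
  have hA := congrArg blkA h
  have hB := congrArg blkB h
  have hC := congrArg blkC h
  rw [blkA_mul, blkA_one, blkA_inv, blkC_inv] at hA
  rw [blkB_mul, blkB_one, blkB_inv, blkD_inv] at hB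
  rw [blkC_mul, blkC_one, blkA_inv, blkC_inv] at hC
  have hA' : blkA g * (blkD g)ᵀ = 1 + blkB g * (blkC g)ᵀ := by rw [← hA]; simp
  have hB' : blkB g * (blkA g)ᵀ = blkA g * (blkB g)ᵀ := by
    rw [mul_neg, neg_add_eq_zero] at hB; exact hB.symm
  have hC' : blkC g * (blkD g)ᵀ = blkD g * (blkC g)ᵀ := by
    rw [mul_neg, add_neg_eq_zero] at hC; exact hC
  unfold sympl actR
  simp only [add_dotProduct, dotProduct_add, vecMul_dotProduct_vecMul]
  have e1 : w.2 ⬝ᵥ ((blkC g * (blkB g)ᵀ) *ᵥ w'.1) = w'.1 ⬝ᵥ ((blkB g * (blkC g)ᵀ) *ᵥ w.2) := by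
    rw [Matrix.dotProduct_mulVec, ← Matrix.mulVec_transpose, dotProduct_comm]
    simp
  have e2 : w'.2 ⬝ᵥ ((blkC g * (blkB g)ᵀ) *ᵥ w.1) = w.1 ⬝ᵥ ((blkB g * (blkC g)ᵀ) *ᵥ w'.2) := by
    rw [Matrix.dotProduct_mulVec, ← Matrix.mulVec_transpose, dotProduct_comm]
    simp
  have e3 : w'.1 ⬝ᵥ ((blkA g * (blkB g)ᵀ) *ᵥ w.1) = w.1 ⬝ᵥ ((blkA g * (blkB g)ᵀ) *ᵥ w'.1) := by
    rw [Matrix.dotProduct_mulVec, ← Matrix.mulVec_transpose, dotProduct_comm,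
      Matrix.transpose_mul, Matrix.transpose_transpose, hB']
  have e4 : w'.2 ⬝ᵥ ((blkC g * (blkD g)ᵀ) *ᵥ w.2) = w.2 ⬝ᵥ ((blkC g * (blkD g)ᵀ) *ᵥ w'.2) := by
    rw [Matrix.dotProduct_mulVec, ← Matrix.mulVec_transpose, dotProduct_comm,
      Matrix.transpose_mul, Matrix.transpose_transpose, hC']
  rw [e1, e2, e3, e4, hA', Matrix.add_mulVec, Matrix.add_mulVec, dotProduct_add, dotProduct_add,
    Matrix.one_mulVec, Matrix.one_mulVec]
  ring

/-- Row vectors with entries in `ℤ_p`. -/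
def IntW (w : (Fin n → ℚ_[p]) × (Fin n → ℚ_[p])) : Prop :=
  w.1 ∈ zLattice p n ∧ w.2 ∈ zLattice p n

theorem zLattice_add {x y : Fin n → ℚ_[p]} (hx : x ∈ zLattice p n) (hy : y ∈ zLattice p n) :
    x + y ∈ zLattice p n := by
  rw [mem_zLattice] at *
  exact fun i => (IsUltrametricDist.norm_add_le_max _ _).trans (max_le (hx i) (hy i))

theorem zLattice_neg {x : Fin n → ℚ_[p]} (hx : x ∈ zLattice p n) : -x ∈ zLattice p n := by
  rw [mem_zLattice] at *
  exact fun i => by simpa using hx i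

theorem zLattice_dot {x y : Fin n → ℚ_[p]} (hx : x ∈ zLattice p n) (hy : y ∈ zLattice p n) :
    ‖x ⬝ᵥ y‖ ≤ 1 := by
  rw [mem_zLattice] at *
  refine IsUltrametricDist.norm_sum_le_of_forall_le_of_nonneg zero_le_one fun k _ => ?_
  rw [norm_mul]
  exact mul_le_one₀ (hx k) (norm_nonneg _) (hy k)

theorem zLattice_add_iff {x y : Fin n → ℚ_[p]} (hy : y ∈ zLattice p n) :
    x + y ∈ zLattice p n ↔ x ∈ zLattice p n := by
  refine ⟨fun h => ?_, fun h => zLattice_add h hy⟩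
  simpa using zLattice_add h (zLattice_neg hy)

theorem IntW.actR {w : (Fin n → ℚ_[p]) × (Fin n → ℚ_[p])} (hw : IntW w) {g : Sp p n}
    (hg : Integral g.1) : IntW (actR w g) := by
  obtain ⟨ha, hb, hc, hd⟩ := integral_iff_blk.1 hg
  have conv : ∀ {m : Matrix (Fin n) (Fin n) ℚ_[p]}, Integral m → EntriesIn 1 m :=
    fun h => (entriesIn_iff norm_one).2 h
  exact ⟨zLattice_add (vecMul_mem_zLattice (conv ha) hw.1) (vecMul_mem_zLattice (conv hc) hw.2),
    zLattice_add (vecMul_mem_zLattice (conv hb) hw.1) (vecMul_mem_zLattice (conv hd) hw.2)⟩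

theorem heisW_heisW (w w' : (Fin n → ℚ_[p]) × (Fin n → ℚ_[p])) (f : SB p n) :
    heisW w (heisW w' f) = ep (sympl w w' / 2) • heisW (w + w') f := by
  ext x
  change _ = _ * (heisW (w + w') f).1 x
  rw [heisW_apply, heisW_apply, heisW_apply, ← mul_assoc, ← mul_assoc, ← ep_add, ← ep_add]
  congr 2
  · unfold sympl
    simp only [Prod.fst_add, Prod.snd_add, add_dotProduct, dotProduct_add]
    ring
  · rw [Prod.fst_add, add_assoc]

theorem heisW_zero : heisW (0 : (Fin n → ℚ_[p]) × (Fin n → ℚ_[p])) = LinearMap.id := by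
  ext f x
  rw [heisW_apply]
  simp [ep_eq_one]

theorem heisW_phi0 (h2 : ‖(2 : ℚ_[p])‖ = 1) {w : (Fin n → ℚ_[p]) × (Fin n → ℚ_[p])} (hw : IntW w) :
    heisW w (phi0 p n) = phi0 p n := by
  ext x
  rw [heisW_apply]
  by_cases hx : x ∈ zLattice p n
  · rw [phi0_of_mem hx, phi0_of_mem ((zLattice_add_iff hw.1).2 hx), ep_eq_one, one_mul]
    refine (IsUltrametricDist.norm_add_le_max _ _).trans (max_le (zLattice_dot hx hw.2) ?_)
    rw [norm_div, h2, div_one]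
    exact zLattice_dot hw.1 hw.2
  · rw [phi0_of_notMem hx, phi0_of_notMem (fun h => hx ((zLattice_add_iff hw.1).1 h)), mul_zero]

theorem ep_zero : ep (0 : ℚ_[p]) = 1 := ep_eq_one (by simp)

theorem norm_le_of_ep_eq_one {x : ℚ_[p]} (h : ep x = 1) : ‖x‖ ≤ 1 := by
  obtain ⟨⟨m, N, hr, hlt⟩, hx⟩ := fracPart_spec x
  unfold ep at h
  rw [Complex.exp_eq_one_iff] at h
  obtain ⟨k, hk⟩ := h
  have h1 : (fracPart x : ℂ) = ((-k : ℤ) : ℂ) := by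
    have h0 : (2 * Real.pi * Complex.I : ℂ) ≠ 0 := Complex.two_pi_I_ne_zero
    apply mul_left_cancel₀ h0
    push_cast
    linear_combination -hk
  have h2 : fracPart x = ((-k : ℤ) : ℚ) := by exact_mod_cast h1
  have h3 : ‖((fracPart x : ℚ) : ℚ_[p])‖ ≤ 1 := by
    rw [h2]
    exact_mod_cast Padic.norm_int_le_one (p := p) (-k)
  have : x = (x - fracPart x) + fracPart x := by ring
  rw [this]
  exact (IsUltrametricDist.norm_add_le_max _ _).trans (max_le hx h3)

theorem single_mem_zLattice (i : Fin n) : (Pi.single i 1 : Fin n → ℚ_[p]) ∈ zLattice p n := by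
  rw [mem_zLattice]; intro j
  rw [Pi.single_apply]; split_ifs <;> simp

/-- The lattice `ℤ_p^{2n}` is its own dual with respect to the character `e_p` of the symplectic
form. -/
theorem intW_of_forall {w : (Fin n → ℚ_[p]) × (Fin n → ℚ_[p])}
    (h : ∀ l, IntW l → ep (sympl l w) = 1) : IntW w := by
  have z : (0 : Fin n → ℚ_[p]) ∈ zLattice p n := by rw [mem_zLattice]; simp
  constructor
  · rw [mem_zLattice]; intro i
    have := norm_le_of_ep_eq_one (h (0, Pi.single i 1) ⟨z, single_mem_zLattice i⟩)
    simpa [sympl] using this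
  · rw [mem_zLattice]; intro i
    have := norm_le_of_ep_eq_one (h (Pi.single i 1, 0) ⟨single_mem_zLattice i, z⟩)
    simpa [sympl] using this

end Heisenberg

section InnerProduct

variable {p : ℕ} [Fact p.Prime] {n : ℕ}

theorem continuous_SB (f : SB p n) : Continuous f.1 := f.2.1.continuous

/-- The `L²` inner product of Schwartz–Bruhat functions. -/
noncomputable def ip (f g : SB p n) : ℂ :=
  letI : MeasurableSpace (Fin n → ℚ_[p]) := borel _
  haveI : BorelSpace (Fin n → ℚ_[p]) := ⟨rfl⟩
  ∫ x, f.1 x * (starRingEnd ℂ) (g.1 x)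
    ∂(MeasureTheory.Measure.addHaar : MeasureTheory.Measure (Fin n → ℚ_[p]))

theorem ip_integrable (f g : SB p n) :
    letI : MeasurableSpace (Fin n → ℚ_[p]) := borel _
    haveI : BorelSpace (Fin n → ℚ_[p]) := ⟨rfl⟩
    MeasureTheory.Integrable (fun x => f.1 x * (starRingEnd ℂ) (g.1 x))
      (MeasureTheory.Measure.addHaar : MeasureTheory.Measure (Fin n → ℚ_[p])) := by
  let _ : MeasurableSpace (Fin n → ℚ_[p]) := borel _
  have _ : BorelSpace (Fin n → ℚ_[p]) := ⟨rfl⟩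
  refine Continuous.integrable_of_hasCompactSupport ?_ f.2.2.mul_right
  exact (continuous_SB f).mul (Complex.continuous_conj.comp (continuous_SB g))

theorem ip_add_left (f f' g : SB p n) : ip (f + f') g = ip f g + ip f' g := by
  let _ : MeasurableSpace (Fin n → ℚ_[p]) := borel _
  have _ : BorelSpace (Fin n → ℚ_[p]) := ⟨rfl⟩
  unfold ip
  rw [← MeasureTheory.integral_add (ip_integrable f g) (ip_integrable f' g)]
  congr 1; funext x
  exact add_mul _ _ _

theorem ip_add_right (f g g' : SB p n) : ip f (g + g') = ip f g + ip f g' := by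
  let _ : MeasurableSpace (Fin n → ℚ_[p]) := borel _
  have _ : BorelSpace (Fin n → ℚ_[p]) := ⟨rfl⟩
  unfold ip
  rw [← MeasureTheory.integral_add (ip_integrable f g) (ip_integrable f g')]
  congr 1; funext x
  change _ * (starRingEnd ℂ) (g.1 x + g'.1 x) = _
  rw [map_add, mul_add]

theorem ip_smul_left (c : ℂ) (f g : SB p n) : ip (c • f) g = c * ip f g := by
  let _ : MeasurableSpace (Fin n → ℚ_[p]) := borel _
  have _ : BorelSpace (Fin n → ℚ_[p]) := ⟨rfl⟩
  unfold ip
  rw [← MeasureTheory.integral_const_mul]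
  congr 1; funext x
  exact mul_assoc _ _ _

theorem ip_smul_right (c : ℂ) (f g : SB p n) : ip f (c • g) = (starRingEnd ℂ) c * ip f g := by
  let _ : MeasurableSpace (Fin n → ℚ_[p]) := borel _
  have _ : BorelSpace (Fin n → ℚ_[p]) := ⟨rfl⟩
  unfold ip
  rw [← MeasureTheory.integral_const_mul]
  congr 1; funext x
  change _ * (starRingEnd ℂ) (c * g.1 x) = _
  rw [map_mul]; ring

theorem ip_zero_left (g : SB p n) : ip 0 g = 0 := by
  have := ip_smul_left 0 (0 : SB p n) g
  rwa [zero_smul, zero_mul] at this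

theorem ip_zero_right (g : SB p n) : ip g 0 = 0 := by
  have := ip_smul_right 0 g (0 : SB p n)
  rwa [zero_smul, map_zero, zero_mul] at this

theorem ip_self (f : SB p n) : ip f f = l2NormSq f := by
  let _ : MeasurableSpace (Fin n → ℚ_[p]) := borel _
  have _ : BorelSpace (Fin n → ℚ_[p]) := ⟨rfl⟩
  unfold ip l2NormSq
  rw [← integral_complex_ofReal]
  congr 1; funext x
  rw [Complex.mul_conj, Complex.normSq_eq_norm_sq]

theorem eq_zero_of_l2NormSq {f : SB p n} (h : l2NormSq f = 0) : f = 0 := by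
  let _ : MeasurableSpace (Fin n → ℚ_[p]) := borel _
  have _ : BorelSpace (Fin n → ℚ_[p]) := ⟨rfl⟩
  by_contra hf
  have hx : ∃ x, f.1 x ≠ 0 := by
    by_contra! hx
    exact hf (Subtype.ext (funext hx))
  obtain ⟨x, hx⟩ := hx
  have hpos := Continuous.integral_pos_of_hasCompactSupport_nonneg_nonzero
    (μ := (MeasureTheory.Measure.addHaar : MeasureTheory.Measure (Fin n → ℚ_[p])))
    (f := fun x => ‖f.1 x‖ ^ 2) (x := x) ((continuous_SB f).norm.pow 2)
    (f.2.2.comp_left (g := fun z : ℂ => ‖z‖ ^ 2) (by simp)) (fun _ => by positivity)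
    (by simpa using hx)
  exact hpos.ne' h

theorem ip_heisW (w : (Fin n → ℚ_[p]) × (Fin n → ℚ_[p])) (f g : SB p n) :
    ip (heisW w f) (heisW w g) = ip f g := by
  let _ : MeasurableSpace (Fin n → ℚ_[p]) := borel _
  have _ : BorelSpace (Fin n → ℚ_[p]) := ⟨rfl⟩
  unfold ip
  rw [← MeasureTheory.integral_add_right_eq_self
    (fun x => f.1 x * (starRingEnd ℂ) (g.1 x)) w.1]
  congr 1; funext x
  simp only [heisW_apply, map_mul]
  have : ep (x ⬝ᵥ w.2 + w.1 ⬝ᵥ w.2 / 2) * (starRingEnd ℂ) (ep (x ⬝ᵥ w.2 + w.1 ⬝ᵥ w.2 / 2)) = 1 := by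
    rw [Complex.mul_conj, Complex.normSq_eq_norm_sq, norm_ep]; simp
  linear_combination (f.1 (x + w.1) * (starRingEnd ℂ) (g.1 (x + w.1))) * this

end InnerProduct

section Spanning

variable {p : ℕ} [Fact p.Prime] {n : ℕ}

theorem span_stable {w : (Fin n → ℚ_[p]) × (Fin n → ℚ_[p])} {f : SB p n}
    (hf : f ∈ Submodule.span ℂ (Set.range fun w => heisW w (phi0 p n))) :
    heisW w f ∈ Submodule.span ℂ (Set.range fun w => heisW w (phi0 p n)) := by
  induction hf using Submodule.span_induction with
  | mem f hf =>
    obtain ⟨w', rfl⟩ := hf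
    dsimp only
    rw [heisW_heisW]
    exact Submodule.smul_mem _ _ (Submodule.subset_span ⟨_, rfl⟩)
  | zero => rw [map_zero]; exact Submodule.zero_mem _
  | add f g _ _ hf hg => rw [map_add]; exact Submodule.add_mem _ hf hg
  | smul c f _ hf => rw [map_smul]; exact Submodule.smul_mem _ _ hf

open Classical in
/-- The characteristic function of a closed ball of positive radius. -/
noncomputable def ballInd (y : Fin n → ℚ_[p]) {r : ℝ} (hr : 0 < r) : SB p n :=
  ⟨(Metric.closedBall y r).indicator 1, by
    have hc : IsCompact (Metric.closedBall y r) := isCompact_closedBall _ _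
    have ho : IsOpen (Metric.closedBall y r) := IsUltrametricDist.isOpen_closedBall _ hr.ne'
    refine ⟨?_, HasCompactSupport.intro hc fun x hx => Set.indicator_of_notMem hx _⟩
    rw [IsLocallyConstant.iff_exists_open]
    intro x
    by_cases hx : x ∈ Metric.closedBall y r
    · refine ⟨_, ho, hx, fun z hz => ?_⟩
      rw [Set.indicator_of_mem hx, Set.indicator_of_mem hz]; rfl
    · refine ⟨_, hc.isClosed.isOpen_compl, hx, fun z hz => ?_⟩
      rw [Set.indicator_of_notMem hx, Set.indicator_of_notMem hz]⟩

theorem ballInd_of_mem {x y : Fin n → ℚ_[p]} {r : ℝ} (hr : 0 < r) (h : x ∈ Metric.closedBall y r) :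
    (ballInd y hr).1 x = 1 := Set.indicator_of_mem h _

theorem ballInd_of_notMem {x y : Fin n → ℚ_[p]} {r : ℝ} (hr : 0 < r)
    (h : x ∉ Metric.closedBall y r) : (ballInd y hr).1 x = 0 := Set.indicator_of_notMem h _

theorem ep_nsmul (x : ℚ_[p]) (k : ℕ) : ep ((k : ℚ_[p]) * x) = ep x ^ k := by
  induction k with
  | zero => simp [ep_zero]
  | succ k ih => rw [Nat.cast_succ, add_mul, one_mul, ep_add, ih, pow_succ]

theorem sum_ep (M : ℕ) {x : ℚ_[p]} (hx : ‖x‖ ≤ 1) :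
    ∑ k : Fin (p ^ M), ep (x * (((k : ℕ) : ℚ_[p]) / (p : ℚ_[p]) ^ M)) =
      if ‖x‖ ≤ ((p : ℝ) ^ M)⁻¹ then (p : ℂ) ^ M else 0 := by
  have hp : (p : ℚ_[p]) ≠ 0 := by exact_mod_cast (Fact.out : p.Prime).ne_zero
  have hpr : (0 : ℝ) < p := by exact_mod_cast (Fact.out : p.Prime).pos
  have e : ∀ k : Fin (p ^ M), ep (x * (((k : ℕ) : ℚ_[p]) / (p : ℚ_[p]) ^ M)) =
      ep (x / (p : ℚ_[p]) ^ M) ^ (k : ℕ) := by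
    intro k
    rw [← ep_nsmul]; congr 1; ring
  have hn : ‖x / (p : ℚ_[p]) ^ M‖ ≤ 1 ↔ ‖x‖ ≤ ((p : ℝ) ^ M)⁻¹ := by
    rw [norm_div, norm_pow, Padic.norm_p, inv_pow, div_inv_eq_mul, ← one_div,
      le_div_iff₀ (by positivity)]
  simp only [e]
  rw [Fin.sum_univ_eq_sum_range (fun k => ep (x / (p : ℚ_[p]) ^ M) ^ k)]
  split_ifs with h
  · rw [ep_eq_one (hn.2 h)]; simp
  · have h1 : ep (x / (p : ℚ_[p]) ^ M) ≠ 1 := fun h1 => h (hn.1 (norm_le_of_ep_eq_one h1))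
    rw [geom_sum_eq h1, ← ep_nsmul]
    have : ((p ^ M : ℕ) : ℚ_[p]) * (x / (p : ℚ_[p]) ^ M) = x := by push_cast; field_simp
    rw [this, ep_eq_one hx, sub_self, zero_div]

theorem inv_pow_pos (M : ℕ) : 0 < ((p : ℝ) ^ M)⁻¹ := by
  have hpr : (0 : ℝ) < p := by exact_mod_cast (Fact.out : p.Prime).pos
  positivity

theorem ballInd_zero_mem_span (M : ℕ) : ballInd (0 : Fin n → ℚ_[p]) (inv_pow_pos (p := p) M) ∈
    Submodule.span ℂ (Set.range fun w => heisW w (phi0 p n)) := by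
  have hpc : ((p : ℂ) ^ M) ^ n ≠ 0 := by
    have : (p : ℂ) ≠ 0 := by exact_mod_cast (Fact.out : p.Prime).ne_zero
    positivity
  have key : ballInd (0 : Fin n → ℚ_[p]) (inv_pow_pos (p := p) M) = (((p : ℂ) ^ M) ^ n)⁻¹ •
      ∑ k : Fin n → Fin (p ^ M),
          heisW (0, fun i => ((k i : ℕ) : ℚ_[p]) / (p : ℚ_[p]) ^ M) (phi0 p n) := by
    rw [eq_inv_smul_iff₀ hpc]
    ext x
    rw [AddSubmonoidClass.coe_finsetSum, Finset.sum_apply]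
    simp only [heisW_apply, zero_dotProduct, zero_div, add_zero]
    rw [← Finset.sum_mul]
    change _ * (ballInd 0 _).1 x = _
    by_cases hx : x ∈ zLattice p n
    · rw [phi0_of_mem hx, mul_one]
      have e1 : ∀ s : Finset (Fin n), ∀ y : Fin n → ℚ_[p],
          ep (∑ i ∈ s, y i) = ∏ i ∈ s, ep (y i) := by
        intro s y
        induction s using Finset.induction_on with
        | empty => simp [ep_zero]
        | insert a s ha ih => rw [Finset.sum_insert ha, Finset.prod_insert ha, ep_add, ih]
      simp only [dotProduct, e1]
      have e2 := Finset.prod_univ_sum (fun _ : Fin n => (Finset.univ : Finset (Fin (p ^ M))))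
        (fun i k => ep (x i * (((k : ℕ) : ℚ_[p]) / (p : ℚ_[p]) ^ M)))
      rw [Fintype.piFinset_univ] at e2
      rw [← e2]
      rw [Finset.prod_congr rfl fun i _ => sum_ep M (mem_zLattice.1 hx i)]
      by_cases hb : x ∈ Metric.closedBall 0 ((p : ℝ) ^ M)⁻¹
      · rw [ballInd_of_mem _ hb, mul_one]
        rw [mem_closedBall_zero_iff, pi_norm_le_iff_of_nonneg (inv_pow_pos M).le] at hb
        rw [Finset.prod_congr rfl fun i _ => if_pos (hb i)]
        simp
      · rw [ballInd_of_notMem _ hb, mul_zero]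
        rw [mem_closedBall_zero_iff, pi_norm_le_iff_of_nonneg (inv_pow_pos M).le] at hb
        push Not at hb
        obtain ⟨i, hi⟩ := hb
        exact (Finset.prod_eq_zero (Finset.mem_univ i) (if_neg (not_le.2 hi))).symm
    · rw [phi0_of_notMem hx, mul_zero, ballInd_of_notMem, mul_zero]
      intro hb
      refine hx (Metric.closedBall_subset_closedBall ?_ hb)
      refine inv_le_one_of_one_le₀ (one_le_pow₀ ?_)
      exact_mod_cast (Fact.out : p.Prime).one_le
  rw [key]
  exact Submodule.smul_mem _ _ (Submodule.sum_mem _ fun k _ => Submodule.subset_span ⟨_, rfl⟩)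

theorem ballInd_mem_span (y : Fin n → ℚ_[p]) (M : ℕ) : ballInd y (inv_pow_pos (p := p) M) ∈
    Submodule.span ℂ (Set.range fun w => heisW w (phi0 p n)) := by
  have : ballInd y (inv_pow_pos (p := p) M) =
      heisW (-y, 0) (ballInd 0 (inv_pow_pos (p := p) M)) := by
    ext x
    rw [heisW_apply]
    have h : x + -y ∈ Metric.closedBall 0 ((p : ℝ) ^ M)⁻¹ ↔
        x ∈ Metric.closedBall y ((p : ℝ) ^ M)⁻¹ := by
      rw [mem_closedBall_zero_iff, mem_closedBall_iff_norm, sub_eq_add_neg]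
    by_cases hx : x ∈ Metric.closedBall y ((p : ℝ) ^ M)⁻¹
    · rw [ballInd_of_mem _ hx, ballInd_of_mem _ (h.2 hx)]; simp [ep_zero]
    · rw [ballInd_of_notMem _ hx, ballInd_of_notMem _ (fun h' => hx (h.1 h'))]; simp
  rw [this]
  exact span_stable (ballInd_zero_mem_span M)

/-- A Schwartz–Bruhat function is constant on all balls of some positive radius. -/
theorem exists_const_on_balls (f : SB p n) : ∃ δ > 0, ∀ x y, dist y x < δ → f.1 y = f.1 x := by
  obtain ⟨δ, hδ, h⟩ := lebesgue_number_lemma_of_metric (s := tsupport f.1) (c := fun z : ℂ =>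
    f.1 ⁻¹' {z}) f.2.2 (fun z => f.2.1.isOpen_fiber z) (fun x _ => Set.mem_iUnion.2 ⟨f.1 x, rfl⟩)
  refine ⟨δ, hδ, fun x y hxy => ?_⟩
  by_cases hx : x ∈ tsupport f.1
  · obtain ⟨z, hz⟩ := h x hx
    rw [hz (Metric.mem_ball_self hδ), hz hxy]
  · by_cases hy : y ∈ tsupport f.1
    · obtain ⟨z, hz⟩ := h y hy
      rw [hz (Metric.mem_ball_self hδ), hz (Metric.mem_ball'.2 hxy)]
    · rw [image_eq_zero_of_notMem_tsupport hx, image_eq_zero_of_notMem_tsupport hy]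

theorem span_eq_top : Submodule.span ℂ (Set.range fun w => heisW w (phi0 p n)) = ⊤ := by
  classical
  rw [eq_top_iff]
  rintro f -
  obtain ⟨δ, hδ, h⟩ := exists_const_on_balls f
  obtain ⟨M, hM⟩ : ∃ M : ℕ, ((p : ℝ) ^ M)⁻¹ < δ := by
    obtain ⟨M, hM⟩ := exists_pow_lt_of_lt_one hδ (y := (p : ℝ)⁻¹)
      (inv_lt_one_of_one_lt₀ (by exact_mod_cast (Fact.out : p.Prime).one_lt))
    exact ⟨M, by rwa [inv_pow] at hM⟩
  obtain ⟨t, ht, hcov⟩ := (show IsCompact (tsupport f.1) from f.2.2).elim_nhds_subcover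
    (fun x => Metric.closedBall x ((p : ℝ) ^ M)⁻¹)
    (fun x _ => Metric.closedBall_mem_nhds x (inv_pow_pos M))
  let 𝓑 : Finset (Set (Fin n → ℚ_[p])) := t.image fun x => Metric.closedBall x ((p : ℝ) ^ M)⁻¹
  have hB : ∀ B ∈ 𝓑, ∃ x, B = Metric.closedBall x ((p : ℝ) ^ M)⁻¹ := by
    intro B hB
    obtain ⟨x, -, rfl⟩ := Finset.mem_image.1 hB
    exact ⟨x, rfl⟩
  choose! c hc using hB
  have key : f = ∑ B ∈ 𝓑, f.1 (c B) • ballInd (c B) (inv_pow_pos (p := p) M) := by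
    ext x
    rw [AddSubmonoidClass.coe_finsetSum, Finset.sum_apply]
    change _ = ∑ B ∈ 𝓑, f.1 (c B) * (ballInd (c B) (inv_pow_pos (p := p) M)).1 x
    by_cases hx : x ∈ tsupport f.1
    · have := hcov hx
      simp only [Set.mem_iUnion] at this
      obtain ⟨y, hy, hxy⟩ := this
      have hyB : Metric.closedBall y ((p : ℝ) ^ M)⁻¹ ∈ 𝓑 := Finset.mem_image.2 ⟨y, hy, rfl⟩
      have hxc : x ∈
          Metric.closedBall (c (Metric.closedBall y ((p : ℝ) ^ M)⁻¹)) ((p : ℝ) ^ M)⁻¹ := by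
        rwa [← hc _ hyB]
      rw [Finset.sum_eq_single_of_mem _ hyB, ballInd_of_mem _ hxc, mul_one]
      · exact h _ _ ((Metric.mem_closedBall.1 hxc).trans_lt hM)
      · intro B hB hne
        rw [ballInd_of_notMem, mul_zero]
        intro hxB
        apply hne
        rw [hc B hB]
        exact (IsUltrametricDist.closedBall_eq_of_mem hxB).trans
          (IsUltrametricDist.closedBall_eq_of_mem hxy).symm
    · rw [image_eq_zero_of_notMem_tsupport hx, Finset.sum_eq_zero]
      intro B hB
      by_cases hxB : x ∈ Metric.closedBall (c B) ((p : ℝ) ^ M)⁻¹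
      · rw [← h _ _ ((Metric.mem_closedBall.1 hxB).trans_lt hM),
          image_eq_zero_of_notMem_tsupport hx, zero_mul]
      · rw [ballInd_of_notMem _ hxB, mul_zero]
  rw [key]
  exact Submodule.sum_mem _ fun B _ => Submodule.smul_mem _ _ (ballInd_mem_span _ _)

end Spanning

section Lifting

variable {p : ℕ} [Fact p.Prime] {n : ℕ} {L : Level}

theorem linearMap_ext_heisW {A B : SB p n →ₗ[ℂ] SB p n}
    (h : ∀ w, A (heisW w (phi0 p n)) = B (heisW w (phi0 p n))) : A = B :=
  LinearMap.ext_on span_eq_top (by rintro _ ⟨w, rfl⟩; exact h w)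

theorem sympl_neg_left (w w' : (Fin n → ℚ_[p]) × (Fin n → ℚ_[p])) :
    sympl (-w) w' = -sympl w w' := by
  unfold sympl
  simp only [Prod.fst_neg, Prod.snd_neg, neg_dotProduct, dotProduct_neg]; ring

theorem sympl_swap (w w' : (Fin n → ℚ_[p]) × (Fin n → ℚ_[p])) : sympl w w' = -sympl w' w := by
  unfold sympl; ring

theorem heisW_comm (l w : (Fin n → ℚ_[p]) × (Fin n → ℚ_[p])) (f : SB p n) :
    heisW l (heisW w f) = ep (sympl l w) • heisW w (heisW l f) := by
  rw [heisW_heisW, heisW_heisW, smul_smul, ← ep_add, add_comm l w]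
  congr 2
  rw [sympl_swap w l]; ring

theorem ip_heisW_phi0_int (h2 : ‖(2 : ℚ_[p])‖ = 1) {w : (Fin n → ℚ_[p]) × (Fin n → ℚ_[p])}
    (hw : IntW w) : ip (heisW w (phi0 p n)) (phi0 p n) = ip (phi0 p n) (phi0 p n) := by
  rw [heisW_phi0 h2 hw]

theorem ip_heisW_phi0_zero (h2 : ‖(2 : ℚ_[p])‖ = 1) {w : (Fin n → ℚ_[p]) × (Fin n → ℚ_[p])}
    (hw : ¬ IntW w) : ip (heisW w (phi0 p n)) (phi0 p n) = 0 := by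
  have : ∃ l, IntW l ∧ ep (sympl l w) ≠ 1 := by
    by_contra! h
    exact hw (intW_of_forall h)
  obtain ⟨l, hl, hne⟩ := this
  have h := ip_heisW l (heisW w (phi0 p n)) (phi0 p n)
  rw [heisW_comm, heisW_phi0 h2 hl, ip_smul_left] at h
  have h' : (ep (sympl l w) - 1) * ip (heisW w (phi0 p n)) (phi0 p n) = 0 := by
    linear_combination h
  exact (mul_eq_zero.1 h').resolve_left (sub_ne_zero.2 hne)

theorem intW_actR_iff {g : Sp p n} (hg : Integral g.1) (hg' : Integral (g⁻¹).1)
    {w : (Fin n → ℚ_[p]) × (Fin n → ℚ_[p])} : IntW (actR w g) ↔ IntW w := by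
  refine ⟨fun h => ?_, fun h => h.actR hg⟩
  have := h.actR hg'
  rwa [← actR_mul, mul_inv_cancel, actR_one] at this

theorem ip_gram (w w' : (Fin n → ℚ_[p]) × (Fin n → ℚ_[p])) :
    ip (heisW w (phi0 p n)) (heisW w' (phi0 p n)) =
      ep (-sympl w' w / 2) * ip (heisW (w - w') (phi0 p n)) (phi0 p n) := by
  rw [← ip_heisW (-w'), heisW_heisW, heisW_heisW, neg_add_cancel, heisW_zero, ip_smul_left,
    ip_smul_right, sympl_neg_left, sympl_neg_left, neg_add_eq_sub]
  have : sympl w' w' = 0 := by unfold sympl; ring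
  rw [this, neg_zero, zero_div, ep_zero, map_one, one_mul]
  rfl

theorem ip_gram_actR (h2 : ‖(2 : ℚ_[p])‖ = 1) {g : Sp p n} (hg : Integral g.1)
    (hg' : Integral (g⁻¹).1) (w w' : (Fin n → ℚ_[p]) × (Fin n → ℚ_[p])) :
    ip (heisW (actR w g) (phi0 p n)) (heisW (actR w' g) (phi0 p n)) =
      ip (heisW w (phi0 p n)) (heisW w' (phi0 p n)) := by
  rw [ip_gram, ip_gram, sympl_actR, ← actR_sub]
  by_cases h : IntW (w - w')
  · rw [ip_heisW_phi0_int h2 h, ip_heisW_phi0_int h2 (h.actR hg)]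
  · rw [ip_heisW_phi0_zero h2 h, ip_heisW_phi0_zero h2 (fun h' => h ((intW_actR_iff hg hg').1 h'))]

theorem exists_linear_lift (h2 : ‖(2 : ℚ_[p])‖ = 1) {g : Sp p n} (hg : Integral g.1)
    (hg' : Integral (g⁻¹).1) : ∃ Φ : SB p n →ₗ[ℂ] SB p n,
      (∀ w, Φ (heisW w (phi0 p n)) = heisW (actR w g) (phi0 p n)) ∧
      ∀ f, l2NormSq (Φ f) = l2NormSq f := by
  let T := Finsupp.linearCombination ℂ fun w => heisW w (phi0 p n)
  let Tg := Finsupp.linearCombination ℂ fun w => heisW (actR w g) (phi0 p n)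
  have hT : Function.Surjective T := by
    rw [← LinearMap.range_eq_top, Finsupp.range_linearCombination, span_eq_top]
  have hip : ∀ x y, ip (Tg x) (Tg y) = ip (T x) (T y) := by
    intro x y
    induction x using Finsupp.induction_linear with
    | zero => rw [map_zero, map_zero, ip_zero_left, ip_zero_left]
    | add x x' h h' => rw [map_add, map_add, ip_add_left, ip_add_left, h, h']
    | single w c =>
      induction y using Finsupp.induction_linear with
      | zero => rw [map_zero, map_zero, ip_zero_right, ip_zero_right]
      | add x x' h h' => rw [map_add, map_add, ip_add_right, ip_add_right, h, h']
      | single w' c' =>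
        simp only [T, Tg, Finsupp.linearCombination_single, ip_smul_left, ip_smul_right]
        rw [ip_gram_actR h2 hg hg']
  have hn : ∀ x, l2NormSq (Tg x) = l2NormSq (T x) := by
    intro x
    have := hip x x
    rw [ip_self, ip_self] at this
    exact_mod_cast this
  have hker : ∀ x y, T x = T y → Tg x = Tg y := by
    intro x y h
    rw [← sub_eq_zero, ← map_sub]
    apply eq_zero_of_l2NormSq
    rw [hn, map_sub, h, sub_self]
    have := ip_self (0 : SB p n)
    rw [ip_zero_left] at this
    exact_mod_cast this.symm
  have hs := fun f => Function.surjInv_eq hT f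
  let Φ : SB p n →ₗ[ℂ] SB p n :=
    { toFun := fun f => Tg (Function.surjInv hT f)
      map_add' := fun f f' => by
        rw [← map_add]; apply hker; rw [map_add, hs, hs, hs]
      map_smul' := fun c f => by
        rw [RingHom.id_apply, ← map_smul]; apply hker; rw [map_smul, hs, hs] }
  have hΦ : ∀ x, Φ (T x) = Tg x := fun x => hker _ _ (hs _)
  refine ⟨Φ, fun w => ?_, fun f => ?_⟩
  · have := hΦ (Finsupp.single w 1)
    simpa [T, Tg] using this
  · change l2NormSq (Tg _) = _
    rw [hn, hs]

theorem integral_inv {g : Sp p n} (hg : Integral g.1) : Integral (g⁻¹).1 := by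
  rw [integral_iff_blk] at hg ⊢
  rw [blkA_inv, blkB_inv, blkC_inv, blkD_inv]
  exact ⟨hg.2.2.2.transpose, hg.2.1.transpose.neg, hg.2.2.1.transpose.neg, hg.1.transpose⟩

/-- Every element of `D_p` lifts to an element of `M_p` that fixes `φ₀`. -/
theorem exists_lift (hp : ¬ p ∣ L.c) {g : Sp p n} (hg : g ∈ levelD p n L) :
    ∃ σ ∈ metaTV p n L, mpProj σ = g := by
  have h2 := Level.norm_two hp
  have h1 := (mem_levelD hp).1 hg
  have h1' := integral_inv h1
  obtain ⟨Φ, hΦ, hn⟩ := exists_linear_lift h2 h1' (by rwa [inv_inv])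
  obtain ⟨Ψ, hΨ, -⟩ := exists_linear_lift h2 h1 h1'
  have e1 : Φ ∘ₗ Ψ = LinearMap.id := linearMap_ext_heisW fun w => by
    rw [LinearMap.comp_apply, hΨ, hΦ, ← actR_mul, mul_inv_cancel, actR_one]; rfl
  have e2 : Ψ ∘ₗ Φ = LinearMap.id := linearMap_ext_heisW fun w => by
    rw [LinearMap.comp_apply, hΦ, hΨ, ← actR_mul, inv_mul_cancel, actR_one]; rfl
  let σ : Sp p n × (SB p n ≃ₗ[ℂ] SB p n) := (g, LinearEquiv.ofLinearMap Φ Ψ e1 e2)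
  have hσ : σ ∈ Mp p n := by
    refine ⟨fun u v f => ?_, hn⟩
    change heisW (u, v) (Φ f) = Φ (heisW (actR (u, v) g) f)
    suffices h : heisW (u, v) ∘ₗ Φ = Φ ∘ₗ heisW (actR (u, v) g) from LinearMap.congr_fun h f
    refine linearMap_ext_heisW fun w => ?_
    rw [LinearMap.comp_apply, LinearMap.comp_apply, hΦ, heisW_heisW, heisW_heisW, map_smul, hΦ,
      actR_add, ← actR_mul, mul_inv_cancel, actR_one, ← sympl_actR _ w g⁻¹, ← actR_mul,
      mul_inv_cancel, actR_one]
  refine ⟨⟨σ, hσ⟩, ⟨hg, 1, ?_⟩, rfl⟩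
  have := hΦ 0
  have h0 : actR (0 : (Fin n → ℚ_[p]) × (Fin n → ℚ_[p])) g⁻¹ = 0 := by
    unfold actR; simp
  rw [h0, heisW_zero] at this
  rw [one_smul]
  exact this

/-- Schur's lemma for the Schrödinger representation. -/
theorem eq_smul_of_commute (h2 : ‖(2 : ℚ_[p])‖ = 1) {A : SB p n →ₗ[ℂ] SB p n}
    (hA : ∀ w f, A (heisW w f) = heisW w (A f)) : ∃ t : ℂ, ∀ f, A f = t • f := by
  have z : (0 : Fin n → ℚ_[p]) ∈ zLattice p n := by rw [mem_zLattice]; simp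
  have h0 : ∀ l, IntW l → heisW l (A (phi0 p n)) = A (phi0 p n) := by
    intro l hl
    rw [← hA, heisW_phi0 h2 hl]
  have h1 : A (phi0 p n) = (A (phi0 p n)).1 0 • phi0 p n := by
    ext x
    change _ = _ * (phi0 p n).1 x
    by_cases hx : x ∈ zLattice p n
    · rw [phi0_of_mem hx, mul_one]
      have := congrFun (congrArg Subtype.val (h0 (x, 0) ⟨hx, z⟩)) 0
      rw [heisW_apply] at this
      simpa [ep_zero] using this
    · rw [phi0_of_notMem hx, mul_zero]
      by_contra hne
      apply hx
      rw [mem_zLattice]; intro i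
      have := congrFun (congrArg Subtype.val (h0 (0, Pi.single i 1) ⟨z, single_mem_zLattice i⟩)) x
      rw [heisW_apply] at this
      have h3 : ep (x i) * (A (phi0 p n)).1 x = 1 * (A (phi0 p n)).1 x := by simpa using this
      exact norm_le_of_ep_eq_one (mul_right_cancel₀ hne h3)
  refine ⟨_, fun f => LinearMap.congr_fun (g := (A (phi0 p n)).1 0 • LinearMap.id)
    (linearMap_ext_heisW fun w => ?_) f⟩
  rw [hA, h1, map_smul, ← h1]
  rfl

theorem mem_metaTV_of_proj_eq_one (h2 : ‖(2 : ℚ_[p])‖ = 1) {σ : Mp p n} (h : mpProj σ = 1) :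
    σ ∈ metaTV p n L := by
  have h' : σ.1.1 = 1 := h
  obtain ⟨t, ht⟩ := eq_smul_of_commute h2 (A := σ.1.2.toLinearMap) fun w f => by
    have := (σ.2.1 w.1 w.2 f).symm
    rw [h', blkA_one, blkB_one, blkC_one, blkD_one] at this
    simpa [heisW] using this
  exact ⟨by rw [h]; exact one_mem _, t, ht _⟩

/-- The support of an element of `R_p`, restricted to `P_p`, is the intersection of `P_p` with a
union of double cosets of `D_p`. -/
theorem heckeR_ne_zero (hp : ¬ p ∣ L.c) (F : HeckeR p n L) {g g' : siegelP p n} {k₁ k₂ : Sp p n}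
    (h₁ : k₁ ∈ levelD p n L) (h₂ : k₂ ∈ levelD p n L) (h : g'.1 = k₁ * g.1 * k₂)
    (hF : F (rP p n g) ≠ 0) : F (rP p n g') ≠ 0 := by
  obtain ⟨κ₁, hκ₁, rfl⟩ := exists_lift hp h₁
  obtain ⟨κ₂, hκ₂, rfl⟩ := exists_lift hp h₂
  have hχ : ∀ κ : metaTV p n L, metaChar p n L κ ≠ 0 := by
    intro κ h0
    have := map_mul (metaChar p n L) κ κ⁻¹
    rw [h0, mul_inv_cancel, map_one, zero_mul] at this
    exact one_ne_zero this
  let σ : Mp p n := rP p n g' * (κ₁ * rP p n g * κ₂)⁻¹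
  have hσ : σ ∈ metaTV p n L := by
    refine mem_metaTV_of_proj_eq_one (Level.norm_two hp) ?_
    have e : ∀ x : siegelP p n, mpProj (rP p n x) = x.1 := fun x => rfl
    rw [map_mul, map_inv, map_mul, map_mul, e, e, h, mul_inv_cancel]
  have e : rP p n g' = σ * (κ₁ * rP p n g * κ₂) := by simp only [σ, inv_mul_cancel_right]
  rw [e, F.left_eq hσ, F.right_eq hκ₂, F.left_eq hκ₁]
  exact mul_ne_zero (hχ _) (mul_ne_zero (hχ _) (mul_ne_zero (hχ _) hF))

end Lifting

section Cartan

variable {p : ℕ} [Fact p.Prime] {n : ℕ} {L : Level}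

theorem p_ne_zero : (p : ℚ_[p]) ≠ 0 := by exact_mod_cast (Fact.out : p.Prime).ne_zero

theorem norm_p_zpow_le_iff {a b : ℤ} : ‖(p : ℚ_[p]) ^ a‖ ≤ ‖(p : ℚ_[p]) ^ b‖ ↔ b ≤ a := by
  rw [Padic.norm_p_zpow, Padic.norm_p_zpow,
    zpow_le_zpow_iff_right₀ (by exact_mod_cast (Fact.out : p.Prime).one_lt)]
  omega

theorem norm_p_zpow_inj {a b : ℤ} (h : ‖(p : ℚ_[p]) ^ a‖ = ‖(p : ℚ_[p]) ^ b‖) : a = b :=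
  le_antisymm (norm_p_zpow_le_iff.1 h.ge) (norm_p_zpow_le_iff.1 h.le)

theorem exists_norm_eq {x : ℚ_[p]} (hx : x ≠ 0) : ∃ a : ℤ, ‖x‖ = ‖(p : ℚ_[p]) ^ a‖ :=
  ⟨x.valuation, by rw [Padic.norm_p_zpow, Padic.norm_eq_zpow_neg_valuation hx]⟩

/-- An invertible diagonal matrix. -/
noncomputable def diagGL (v : Fin n → ℚ_[p]ˣ) : GL (Fin n) ℚ_[p] :=
  ⟨Matrix.diagonal fun i => (v i : ℚ_[p]), Matrix.diagonal fun i => ((v i)⁻¹ : ℚ_[p]ˣ).1,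
    by rw [Matrix.diagonal_mul_diagonal]; simp, by rw [Matrix.diagonal_mul_diagonal]; simp⟩

variable (p) in
/-- The diagonal matrix `diag[p^{a_1}, …, p^{a_n}]`. -/
noncomputable def diagP (a : Fin n → ℤ) : GL (Fin n) ℚ_[p] :=
  diagGL fun i => Units.mk0 (p : ℚ_[p]) p_ne_zero ^ a i

theorem diagP_val (a : Fin n → ℤ) :
    (diagP p a).1 = Matrix.diagonal fun i => (p : ℚ_[p]) ^ a i := by
  change Matrix.diagonal _ = _
  simp

/-- The transpose of a symplectic matrix. -/
noncomputable def spT (g : Sp p n) : Sp p n := ⟨g.1ᵀ, SymplecticGroup.transpose_mem g.2⟩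

theorem spT_mul (g h : Sp p n) : spT (g * h) = spT h * spT g :=
  Subtype.ext (Matrix.transpose_mul g.1 h.1)

theorem spT_spT (g : Sp p n) : spT (spT g) = g := rfl

theorem spT_apply (g : Sp p n) (t s : Fin n ⊕ Fin n) : (spT g).1 t s = g.1 s t := rfl

/-- The row and the column of index `n + i` vanish off the diagonal. -/
def Isolated (g : Sp p n) (i : Fin n) : Prop :=
  ∀ t, t ≠ Sum.inr i → g.1 (Sum.inr i) t = 0 ∧ g.1 t (Sum.inr i) = 0

theorem Isolated.spT {g : Sp p n} {i : Fin n} (h : Isolated g i) : Isolated (spT g) i :=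
  fun t ht => (h t ht).symm

theorem Isolated.inl_col {g : Sp p n} {i : Fin n} (h : Isolated g i) :
    g.1 (Sum.inl i) (Sum.inl i) * g.1 (Sum.inr i) (Sum.inr i) = 1 ∧
      ∀ t, t ≠ Sum.inl i → g.1 t (Sum.inl i) = 0 := by
  have hg := mul_inv_cancel g
  have hA := congrArg blkA hg
  have hC := congrArg blkC hg
  rw [blkA_mul, blkA_one, blkA_inv, blkC_inv] at hA
  rw [blkC_mul, blkC_one, blkA_inv, blkC_inv] at hC
  have c0 : ∀ k, blkC g i k = 0 := fun k => (h (Sum.inl k) (by simp)).1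
  have d0 : ∀ k, k ≠ i → blkD g i k = 0 := fun k hk => (h (Sum.inr k) (by simpa using hk)).1
  have sA : ∀ l, (blkA g * (blkD g)ᵀ) l i = blkA g l i * blkD g i i := fun l => by
    rw [Matrix.mul_apply, Finset.sum_eq_single i]
    · rfl
    · intro k _ hk; rw [Matrix.transpose_apply, d0 k hk, mul_zero]
    · simp
  have sC : ∀ l, (blkC g * (blkD g)ᵀ) l i = blkC g l i * blkD g i i := fun l => by
    rw [Matrix.mul_apply, Finset.sum_eq_single i]
    · rfl
    · intro k _ hk; rw [Matrix.transpose_apply, d0 k hk, mul_zero]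
    · simp
  have zB : ∀ l, (blkB g * -(blkC g)ᵀ) l i = 0 := fun l => by
    rw [Matrix.mul_apply]
    exact Finset.sum_eq_zero fun k _ => by
      rw [Matrix.neg_apply, Matrix.transpose_apply, c0, neg_zero, mul_zero]
  have zD : ∀ l, (blkD g * -(blkC g)ᵀ) l i = 0 := fun l => by
    rw [Matrix.mul_apply]
    exact Finset.sum_eq_zero fun k _ => by
      rw [Matrix.neg_apply, Matrix.transpose_apply, c0, neg_zero, mul_zero]
  have eA : ∀ l, blkA g l i * blkD g i i = (1 : Matrix (Fin n) (Fin n) ℚ_[p]) l i := fun l => by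
    have := congrFun (congrFun hA l) i
    rwa [Matrix.add_apply, sA, zB, add_zero] at this
  have eC : ∀ l, blkC g l i * blkD g i i = 0 := fun l => by
    have := congrFun (congrFun hC l) i
    rwa [Matrix.add_apply, sC, zD, add_zero] at this
  have e1 : blkA g i i * blkD g i i = 1 := by rw [eA, Matrix.one_apply_eq]
  have hne : blkD g i i ≠ 0 := right_ne_zero_of_mul_eq_one e1
  refine ⟨e1, ?_⟩
  rintro (l | l) hl
  · have := eA l
    rw [Matrix.one_apply_ne (by simpa using hl)] at this
    exact (mul_eq_zero.1 this).resolve_right hne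
  · exact (mul_eq_zero.1 (eC l)).resolve_right hne

theorem Isolated.inl_row {g : Sp p n} {i : Fin n} (h : Isolated g i) (t : Fin n ⊕ Fin n)
    (ht : t ≠ Sum.inl i) : g.1 (Sum.inl i) t = 0 := h.spT.inl_col.2 t ht

theorem Isolated.ne_zero {g : Sp p n} {i : Fin n} (h : Isolated g i) :
    g.1 (Sum.inr i) (Sum.inr i) ≠ 0 := right_ne_zero_of_mul_eq_one h.inl_col.1

/-- The position of an index in its block. -/
def ht : Fin n ⊕ Fin n → Fin n := Sum.elim id id

theorem Isolated.zero_of_ht {g : Sp p n} {i : Fin n} (h : Isolated g i) {r s : Fin n ⊕ Fin n}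
    (hr : ht r = i) (hs : ht s ≠ i) : g.1 r s = 0 := by
  rcases r with r | r
  · obtain rfl : r = i := hr
    exact h.inl_row s (by rintro rfl; exact hs rfl)
  · obtain rfl : r = i := hr
    exact (h s (by rintro rfl; exact hs rfl)).1

theorem exists_swap (i j : Fin n) : ∃ k : Sp p n, Integral k.1 ∧ ∀ (g : Sp p n) t s,
    (k * g).1 t s = g.1 (Sum.map (Equiv.swap i j) (Equiv.swap i j) t) s := by
  let P : Matrix (Fin n) (Fin n) ℚ_[p] :=
      (1 : Matrix (Fin n) (Fin n) ℚ_[p]).submatrix (Equiv.swap i j) id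
  have hP : ∀ M : Matrix (Fin n) (Fin n) ℚ_[p], P * M = M.submatrix (Equiv.swap i j) id := by
    intro M
    ext a b
    simp [P, Matrix.mul_apply, Matrix.one_apply]
  have hPt : Pᵀ = P := by
    ext a b
    simp only [P, Matrix.transpose_apply, Matrix.submatrix_apply, id, Matrix.one_apply]
    refine if_congr ⟨?_, ?_⟩ rfl rfl
    · rintro rfl; simp
    · rintro rfl; simp
  have hPP : P * P = 1 := by
    rw [hP]; ext a b; simp [P, Matrix.one_apply]
  refine ⟨⟨Matrix.fromBlocks P 0 0 P, ?_⟩, ?_, ?_⟩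
  · rw [SymplecticGroup.fromBlocks_mem_iff]
    simp [hPt, hPP]
  · have : Integral P := fun a b => Integral.one _ _
    rw [integral_iff_blk]
    exact ⟨this, .zero, .zero, this⟩
  · intro g t s
    change (Matrix.fromBlocks P 0 0 P * g.1 : Matrix _ _ ℚ_[p]) t s = _
    rw [Matrix.mul_apply, Fintype.sum_sum_type]
    rcases t with t | t <;> simp [P, Matrix.one_apply]

theorem exists_weyl (i : Fin n) : ∃ k : Sp p n, Integral k.1 ∧ ∀ (g : Sp p n) t s,
    ‖(k * g).1 t s‖ = ‖g.1 (Equiv.swap (Sum.inl i) (Sum.inr i) t) s‖ := by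
  let α : Fin n → ℚ_[p] := fun l => if l = i then 0 else 1
  let ε : Fin n → ℚ_[p] := fun l => if l = i then 1 else 0
  have hk : Matrix.fromBlocks (Matrix.diagonal α) (Matrix.diagonal (-ε)) (Matrix.diagonal ε)
      (Matrix.diagonal α) ∈ Matrix.symplecticGroup (Fin n) ℚ_[p] := by
    rw [SymplecticGroup.fromBlocks_mem_iff]
    simp only [Matrix.diagonal_transpose, Matrix.diagonal_mul_diagonal, Matrix.diagonal_sub]
    refine ⟨?_, ?_, ?_⟩
    · congr 1; funext l; exact mul_comm _ _
    · congr 1; funext l; exact mul_comm _ _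
    · rw [← Matrix.diagonal_one]; congr 1; funext l
      by_cases hl : l = i <;> simp [α, ε, hl]
  have hα : ∀ l, ‖α l‖ ≤ 1 := fun l => by by_cases hl : l = i <;> simp [α, hl]
  have hε : ∀ l, ‖ε l‖ ≤ 1 := fun l => by by_cases hl : l = i <;> simp [ε, hl]
  refine ⟨⟨_, hk⟩, ?_, ?_⟩
  · rw [integral_iff_blk]
    exact ⟨.diagonal hα, .diagonal fun l => by simpa using hε l, .diagonal hε, .diagonal hα⟩
  · intro g t s
    have e : ∀ t, ((⟨_, hk⟩ * g : Sp p n)).1 t s = Sum.elim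
        (fun l => α l * g.1 (Sum.inl l) s - ε l * g.1 (Sum.inr l) s)
        (fun l => ε l * g.1 (Sum.inl l) s + α l * g.1 (Sum.inr l) s) t := by
      intro t
      change (Matrix.fromBlocks (Matrix.diagonal α) (Matrix.diagonal (-ε)) (Matrix.diagonal ε)
        (Matrix.diagonal α) * g.1 : Matrix _ _ ℚ_[p]) t s = _
      rw [Matrix.mul_apply, Fintype.sum_sum_type]
      rcases t with t | t <;> simp [Matrix.diagonal_apply]
      ring
    rw [e]
    rcases t with t | t
    · by_cases hl : t = i
      · subst hl; simp [α, ε]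
      · rw [Equiv.swap_apply_of_ne_of_ne (by simpa using hl) (by simp)]; simp [α, ε, hl]
    · by_cases hl : t = i
      · subst hl; simp [α, ε]
      · rw [Equiv.swap_apply_of_ne_of_ne (by simp) (by simpa using hl)]; simp [α, ε, hl]

theorem ht_swap (i : Fin n) (t : Fin n ⊕ Fin n) :
    ht (Equiv.swap (Sum.inl i) (Sum.inr i) t) = ht t := by
  rw [Equiv.swap_apply_def]
  split_ifs with h1 h2
  · rw [h1]; rfl
  · rw [h2]; rfl
  · rfl

/-- An integral symplectic matrix which moves a given row to position `n + j`. -/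
theorem exists_row_move {r : Fin n ⊕ Fin n} {j : Fin n} (hr : ht r ≤ j) :
    ∃ k : Sp p n, Integral k.1 ∧ ∃ e : Fin n ⊕ Fin n → Fin n ⊕ Fin n,
      (∀ (g : Sp p n) t s, ‖(k * g).1 t s‖ = ‖g.1 (e t) s‖) ∧ e (Sum.inr j) = r ∧
      (∀ t, j < ht t → e t = t) ∧ ∀ t, ht t ≤ j → ht (e t) ≤ j := by
  obtain ⟨k, hk, h⟩ := exists_swap (p := p) (ht r) j
  have hlt : ∀ l, j < l → Equiv.swap (ht r) j l = l := fun l hl =>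
    Equiv.swap_apply_of_ne_of_ne (hr.trans_lt hl).ne' hl.ne'
  have hle : ∀ l, l ≤ j → Equiv.swap (ht r) j l ≤ j := fun l hl => by
    rw [Equiv.swap_apply_def]; split_ifs <;> first | exact le_rfl | assumption
  have h1 : ∀ t, j < ht t → Sum.map (Equiv.swap (ht r) j) (Equiv.swap (ht r) j) t = t := by
    rintro (t | t) hj
    · exact congrArg Sum.inl (hlt _ hj)
    · exact congrArg Sum.inr (hlt _ hj)
  have h2 : ∀ t, ht t ≤ j → ht (Sum.map (Equiv.swap (ht r) j) (Equiv.swap (ht r) j) t) ≤ j := by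
    rintro (t | t) hj
    · exact hle _ hj
    · exact hle _ hj
  rcases r with r | r
  · obtain ⟨w, hw, h'⟩ := exists_weyl (p := p) j
    refine ⟨w * k, hw.mul hk, fun t => Sum.map (Equiv.swap r j) (Equiv.swap r j)
      (Equiv.swap (Sum.inl j) (Sum.inr j) t), fun g t s => ?_, ?_, fun t ht' => ?_, fun t ht' => ?_⟩
    · rw [mul_assoc, h', h]; rfl
    · simp
    · beta_reduce
      rw [Equiv.swap_apply_of_ne_of_ne]
      · exact h1 t ht'
      · rintro rfl; exact lt_irrefl _ ht'
      · rintro rfl; exact lt_irrefl _ ht'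
    · exact h2 _ (by rwa [ht_swap])
  · exact ⟨k, hk, _, fun g t s => by rw [h], by simp [ht], h1, h2⟩

/-- Clearing the column of index `n + j` by an integral element of the Siegel parabolic. -/
theorem exists_clear {g : Sp p n} {j : Fin n} (h0 : g.1 (Sum.inr j) (Sum.inr j) ≠ 0)
    (hmax : ∀ t, ‖g.1 t (Sum.inr j)‖ ≤ ‖g.1 (Sum.inr j) (Sum.inr j)‖)
    (hiso : ∀ i, j < i → Isolated g i) :
    ∃ k : siegelP p n, Integral k.1.1 ∧ (∀ t, t ≠ Sum.inr j → (k.1 * g).1 t (Sum.inr j) = 0) ∧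
      (∀ i, j < i → Isolated (k.1 * g) i) ∧
      ∃ z : Fin n → ℚ_[p], (∀ i, j ≤ i → z i = 0) ∧
        ∀ i s, (k.1 * g).1 (Sum.inr i) s = g.1 (Sum.inr i) s - z i * g.1 (Sum.inr j) s := by
  set x := g.1 (Sum.inr j) (Sum.inr j) with hx
  let y1 : Fin n → ℚ_[p] := fun i => g.1 (Sum.inl i) (Sum.inr j) / x
  let y2 : Fin n → ℚ_[p] := fun i => g.1 (Sum.inr i) (Sum.inr j) / x
  let e : Fin n → ℚ_[p] := Pi.single j 1
  let z : Fin n → ℚ_[p] := y2 - e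
  have hy1 : ∀ i, ‖y1 i‖ ≤ 1 := fun i => by
    rw [norm_div]; exact div_le_one_of_le₀ (hmax _) (norm_nonneg _)
  have hy2 : ∀ i, ‖y2 i‖ ≤ 1 := fun i => by
    rw [norm_div]; exact div_le_one_of_le₀ (hmax _) (norm_nonneg _)
  have he : ∀ i, ‖e i‖ ≤ 1 := fun i => by
    simp only [e, Pi.single_apply]; split_ifs <;> simp
  have hy2j : y2 j = 1 := div_self h0
  have hzj : z j = 0 := by simp [z, hy2j, e]
  have hz0 : ∀ i, j ≤ i → z i = 0 := by
    intro i hi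
    rcases hi.eq_or_lt with rfl | hi
    · exact hzj
    · have : g.1 (Sum.inr i) (Sum.inr j) = 0 :=
        (hiso i hi _ (by simpa using hi.ne)).1
      simp [z, y2, e, this, hi.ne']
  have hz : ∀ i, ‖z i‖ ≤ 1 := fun i => by
    simp only [z, sub_eq_add_neg]
    refine (IsUltrametricDist.norm_add_le_max _ _).trans (max_le (hy2 i) ?_)
    rw [Pi.neg_apply, norm_neg]; exact he i
  have hez : e ⬝ᵥ z = 0 := by simp [e, hzj]
  have hint : ∀ {v w : Fin n → ℚ_[p]}, (∀ i, ‖v i‖ ≤ 1) → (∀ i, ‖w i‖ ≤ 1) →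
      Integral (Matrix.vecMulVec v w) := fun hv hw a b => by
    rw [Matrix.vecMulVec_apply, norm_mul]; exact mul_le_one₀ (hv a) (norm_nonneg _) (hw b)
  have hzz : Matrix.vecMulVec z e * Matrix.vecMulVec z e = 0 := by
    rw [Matrix.vecMulVec_mul_vecMulVec, hez]; simp
  let u : GL (Fin n) ℚ_[p] := ⟨1 - Matrix.vecMulVec z e, 1 + Matrix.vecMulVec z e,
    by rw [mul_add, sub_mul, sub_mul, hzz]; simp, by rw [mul_sub, add_mul, add_mul, hzz]; simp⟩
  let y1' : Fin n → ℚ_[p] := y1 + (z ⬝ᵥ y1) • e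
  have hy1' : ∀ i, ‖y1' i‖ ≤ 1 := fun i => by
    refine (IsUltrametricDist.norm_add_le_max _ _).trans (max_le (hy1 i) ?_)
    rw [Pi.smul_apply, smul_eq_mul, norm_mul]
    exact mul_le_one₀ (zLattice_dot (mem_zLattice.2 hz) (mem_zLattice.2 hy1)) (norm_nonneg _) (he i)
  let S : Matrix (Fin n) (Fin n) ℚ_[p] := (y1' j) • Matrix.vecMulVec e e -
    (Matrix.vecMulVec y1' e + Matrix.vecMulVec e y1')
  have hS : Sᵀ = S := by
    simp only [S, Matrix.transpose_sub, Matrix.transpose_add, Matrix.transpose_smul,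
      Matrix.transpose_vecMulVec]
    rw [add_comm]
  have hSint : Integral S := by
    refine Integral.sub (fun a b => ?_) ((hint hy1' he).add (hint he hy1'))
    rw [Matrix.smul_apply, smul_eq_mul, norm_mul]
    exact mul_le_one₀ (hy1' j) (norm_nonneg _) (hint he he a b)
  have hSe : S *ᵥ e = -y1' := by
    simp only [S, Matrix.sub_mulVec, Matrix.add_mulVec, Matrix.smul_mulVec,
      Matrix.vecMulVec_mulVec]
    ext i
    simp [e]
  let k : siegelP p n := siegelN S hS * siegelDiag u
  have hA : blkA k.1 = 1 + Matrix.vecMulVec e z := by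
    rw [blkA_mulP, blkA_siegelN, one_mul, blkA_siegelDiag]
    change (1 + Matrix.vecMulVec z e)ᵀ = _
    rw [Matrix.transpose_add, Matrix.transpose_one, Matrix.transpose_vecMulVec]
  have hB : blkB k.1 = S * (1 - Matrix.vecMulVec z e) := by
    rw [blkB_mulP, blkB_siegelN, blkB_siegelDiag, mul_zero, zero_add, blkD_siegelDiag]
  have hD : blkD k.1 = 1 - Matrix.vecMulVec z e := by
    rw [blkD_mulP, blkD_siegelN, one_mul, blkD_siegelDiag]
  have hrow : ∀ i s, (k.1 * g).1 (Sum.inr i) s = g.1 (Sum.inr i) s - z i * g.1 (Sum.inr j) s := by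
    intro i s
    rw [Submonoid.coe_mul, eq_fromBlocks k.1, show blkC k.1 = 0 from k.2, hD, Matrix.mul_apply,
      Fintype.sum_sum_type]
    simp [Matrix.sub_apply, Matrix.vecMulVec_apply, sub_mul, Matrix.one_apply, e, Pi.single_apply]
  have hinl : ∀ i s, (k.1 * g).1 (Sum.inl i) s = (blkA k.1 *ᵥ fun l => g.1 (Sum.inl l) s) i +
      (blkB k.1 *ᵥ fun l => g.1 (Sum.inr l) s) i := by
    intro i s
    rw [Submonoid.coe_mul, eq_fromBlocks k.1, Matrix.mul_apply, Fintype.sum_sum_type]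
    rfl
  refine ⟨k, ?_, ?_, ?_, z, hz0, hrow⟩
  · rw [integral_iff_blk, hA, hB, hD, show blkC k.1 = 0 from k.2]
    exact ⟨Integral.one.add (hint he hz), hSint.mul (Integral.one.sub (hint hz he)), .zero,
      Integral.one.sub (hint hz he)⟩
  · rintro (i | i) hi
    · rw [hinl, hA, hB]
      have e1 : (fun l => g.1 (Sum.inl l) (Sum.inr j)) = x • y1 := by
        ext l; simp [y1, mul_div_cancel₀ _ h0]
      have e2 : (fun l => g.1 (Sum.inr l) (Sum.inr j)) = x • (z + e) := by
        ext l; simp [z, y2, mul_div_cancel₀ _ h0]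
      have e3 : (1 - Matrix.vecMulVec z e) *ᵥ (z + e) = e := by
        rw [Matrix.sub_mulVec, Matrix.vecMulVec_mulVec, dotProduct_add, hez]
        simp [e]
      rw [e1, e2, Matrix.mulVec_smul, Matrix.mulVec_smul, ← Matrix.mulVec_mulVec, e3, hSe,
        Matrix.add_mulVec, Matrix.vecMulVec_mulVec]
      simp [y1']
      ring
    · rw [hrow]
      have : i ≠ j := by simpa using hi
      simp only [z, y2, e, Pi.sub_apply, Pi.single_apply, if_neg this, sub_zero]
      rw [← hx, div_mul_cancel₀ _ h0, sub_self]
  · intro i hi t ht'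
    refine ⟨?_, ?_⟩
    · rw [hrow, hz0 i hi.le, zero_mul, sub_zero]
      exact (hiso i hi t ht').1
    · have hji : g.1 (Sum.inr j) (Sum.inr i) = 0 := (hiso i hi _ (by simpa using hi.ne)).2
      rcases t with t | t
      · rw [hinl, hA, hB]
        have e1 : (fun l => g.1 (Sum.inl l) (Sum.inr i)) = 0 := by
          ext l; exact (hiso i hi _ (by simp)).2
        have e2 : (fun l => g.1 (Sum.inr l) (Sum.inr i)) =
            g.1 (Sum.inr i) (Sum.inr i) • Pi.single i 1 := by
          ext l
          by_cases hl : l = i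
          · subst hl; simp
          · simp [hl, (hiso i hi (Sum.inr l) (by simpa using hl)).2]
        have e3 : (1 - Matrix.vecMulVec z e) *ᵥ (Pi.single i 1) = Pi.single i 1 := by
          rw [Matrix.sub_mulVec, Matrix.vecMulVec_mulVec, Matrix.one_mulVec]
          simp [e, hi.ne']
        have hy1i : y1' i = 0 := by
          have : g.1 (Sum.inl i) (Sum.inr j) = 0 := (hiso i hi).inl_row _ (by simp)
          simp [y1', y1, this, e, hi.ne']
        have e4 : S *ᵥ (Pi.single i 1) = 0 := by
          simp only [S, Matrix.sub_mulVec, Matrix.add_mulVec, Matrix.smul_mulVec,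
            Matrix.vecMulVec_mulVec]
          simp [e, hi.ne', hy1i]
        rw [e1, e2, Matrix.mulVec_smul, ← Matrix.mulVec_mulVec, e3, e4]
        simp
      · rw [hrow, hji, mul_zero, sub_zero]
        exact (hiso i hi _ ht').2

end Cartan

section Extremal

variable {p : ℕ} [Fact p.Prime] {n : ℕ} {L : Level}

theorem exists_units_mul_eq_zpow {v : Fin n → ℚ_[p]} {a : Fin n → ℤ}
    (h : ∀ i, ‖v i‖ = ‖(p : ℚ_[p]) ^ a i‖) :
    ∃ u : Fin n → ℚ_[p]ˣ, (∀ i, (u i : ℚ_[p]) * v i = (p : ℚ_[p]) ^ a i) ∧ diagGL u ∈ glZ p n := by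
  have hv : ∀ i, v i ≠ 0 := fun i => by
    rw [← norm_ne_zero_iff, h]; exact norm_ne_zero_iff.2 (zpow_ne_zero _ p_ne_zero)
  have hu : ∀ i, (p : ℚ_[p]) ^ a i / v i ≠ 0 := fun i =>
    div_ne_zero (zpow_ne_zero _ p_ne_zero) (hv i)
  have hn : ∀ i, ‖(p : ℚ_[p]) ^ a i / v i‖ = 1 := fun i => by
    rw [norm_div, h, div_self (norm_ne_zero_iff.2 (zpow_ne_zero _ p_ne_zero))]
  refine ⟨fun i => Units.mk0 _ (hu i), fun i => div_mul_cancel₀ _ (hv i), mem_glZ.2 ⟨?_, ?_⟩⟩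
  · exact Integral.diagonal fun i => (hn i).le
  · refine Integral.diagonal fun i => ?_
    rw [Units.val_inv_eq_inv_val, Units.val_mk0, norm_inv, hn, inv_one]

theorem siegelDiag_integral {u : GL (Fin n) ℚ_[p]} (hu : u ∈ glZ p n) :
    Integral (siegelDiag u).1.1 := by
  obtain ⟨h1, h2⟩ := mem_glZ.1 hu
  rw [integral_iff_blk, blkA_siegelDiag, blkB_siegelDiag, blkD_siegelDiag,
    show blkC (siegelDiag u).1 = 0 from (siegelDiag u).2]
  exact ⟨h2.transpose, .zero, .zero, h1⟩

/-- A symplectic matrix with all indices isolated is diagonal. -/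
theorem eq_siegelDiag_of_isolated {g : Sp p n} {a : Fin n → ℤ} (hiso : ∀ i, Isolated g i)
    (ha : ∀ i, ‖g.1 (Sum.inr i) (Sum.inr i)‖ = ‖(p : ℚ_[p]) ^ a i‖) :
    ∃ u ∈ glZ p n, (siegelDiag u).1 * g = (siegelDiag (diagP p a)).1 := by
  obtain ⟨u, hu, hu'⟩ := exists_units_mul_eq_zpow ha
  refine ⟨diagGL u, hu', ?_⟩
  have hC : blkC g = 0 := by
    ext i j; exact (hiso i (Sum.inl j) (by simp)).1
  have hB : blkB g = 0 := by
    ext i j; exact (hiso j (Sum.inl i) (by simp)).2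
  have hD : blkD g = Matrix.diagonal fun i => g.1 (Sum.inr i) (Sum.inr i) := by
    ext i j
    rw [Matrix.diagonal_apply]
    split_ifs with h
    · subst h; rfl
    · exact (hiso i (Sum.inr j) (by simpa using fun h' => h h'.symm)).1
  let g' : siegelP p n := ⟨g, hC⟩
  have hD' : blkD (siegelDiag (diagGL u) * g').1 = blkD (siegelDiag (diagP p a)).1 := by
    rw [blkD_mulP, blkD_siegelDiag, blkD_siegelDiag, diagP_val]
    change Matrix.diagonal _ * blkD g = _
    rw [hD, Matrix.diagonal_mul_diagonal]
    congr 1; funext i; exact hu i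
  have hA : ∀ x y : siegelP p n, blkD x.1 = blkD y.1 → blkA x.1 = blkA y.1 := by
    intro x y h
    have h1 := siegelP_mul_transpose x
    have h2 := siegelP_D_mul y
    have h3 : (blkD y.1)ᵀ * blkA y.1 = 1 := mul_eq_one_comm.1 (siegelP_mul_transpose y)
    rw [h] at h1
    calc blkA x.1 = blkA x.1 * ((blkD y.1)ᵀ * blkA y.1) := by rw [h3, mul_one]
      _ = blkA y.1 := by rw [← mul_assoc, h1, one_mul]
  change (siegelDiag (diagGL u) * g').1 = _
  refine congrArg Subtype.val (siegelP_ext (hA _ _ hD') ?_ hD')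
  rw [blkB_mulP, blkB_siegelDiag, blkB_siegelDiag, zero_mul, add_zero]
  change _ * blkB g = 0
  rw [hB, mul_zero]

theorem Isolated.of_norm {g g' : Sp p n} {i : Fin n} {e e' : Fin n ⊕ Fin n → Fin n ⊕ Fin n}
    (h : Isolated g i) (hn : ∀ t s, ‖g'.1 t s‖ = ‖g.1 (e t) (e' s)‖)
    (he : ∀ t, ht t = i → e t = t) (he' : ∀ t, ht t = i → e' t = t)
    (hne : ∀ t, ht t ≠ i → ht (e t) ≠ i) (hne' : ∀ t, ht t ≠ i → ht (e' t) ≠ i) :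
    Isolated g' i := by
  intro t hti
  have key : ∀ {ε : Fin n ⊕ Fin n → Fin n ⊕ Fin n}, (∀ t, ht t = i → ε t = t) →
      (∀ t, ht t ≠ i → ht (ε t) ≠ i) → ε t ≠ Sum.inr i := by
    intro ε h1 h2
    by_cases hh : ht t = i
    · rw [h1 t hh]; exact hti
    · intro hh'; exact h2 t hh (by rw [hh']; rfl)
  rw [← norm_eq_zero, ← norm_eq_zero (a := g'.1 t _), hn, hn, he (Sum.inr i) rfl,
    he' (Sum.inr i) rfl, norm_eq_zero,
    norm_eq_zero]
  exact ⟨(h _ (key he' hne')).1, (h _ (key he hne)).2⟩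

/-- The Cartan decomposition, starting from a matrix that is already diagonal in the indices
`i ≥ j`. -/
theorem exists_cartan (j : ℕ) (hj : j ≤ n) (g : Sp p n) (hiso : ∀ i : Fin n, j ≤ i → Isolated g i) :
    ∃ k₁ k₂ : Sp p n, Integral k₁.1 ∧ Integral k₂.1 ∧ ∃ a : Fin n → ℤ,
      (siegelDiag (diagP p a)).1 = k₁ * g * k₂ ∧
      (∀ i : Fin n, j ≤ i → ‖g.1 (Sum.inr i) (Sum.inr i)‖ = ‖(p : ℚ_[p]) ^ a i‖) ∧
      ∀ i : Fin n, (i : ℕ) + 1 = j → ∀ r s, ht r ≤ i → ht s ≤ i →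
        ‖g.1 r s‖ ≤ ‖(p : ℚ_[p]) ^ a i‖ := by
  induction j generalizing g with
  | zero =>
    have hiso' : ∀ i, Isolated g i := fun i => hiso i (Nat.zero_le _)
    choose a ha using fun i => exists_norm_eq (hiso' i).ne_zero
    obtain ⟨u, hu, h⟩ := eq_siegelDiag_of_isolated hiso' ha
    exact ⟨(siegelDiag u).1, 1, siegelDiag_integral hu, Integral.one, a, by rw [mul_one, h],
      fun i _ => ha i, fun i hi => by omega⟩
  | succ j ih =>
    let J : Fin n := ⟨j, hj⟩
    have hisoJ : ∀ i, J < i → Isolated g i := fun i hi => hiso i hi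
    obtain ⟨⟨r, s⟩, hrs, hmax⟩ := Finset.exists_max_image
      (Finset.univ.filter fun q : (Fin n ⊕ Fin n) × (Fin n ⊕ Fin n) => ht q.1 ≤ J ∧ ht q.2 ≤ J)
      (fun q => ‖g.1 q.1 q.2‖) ⟨(Sum.inr J, Sum.inr J),
        Finset.mem_filter.2 ⟨Finset.mem_univ _, le_rfl, le_rfl⟩⟩
    simp only [Finset.mem_filter, Finset.mem_univ, true_and, Prod.forall] at hrs hmax
    obtain ⟨k₁, hk₁, e₁, hn₁, hr₁, hf₁, hb₁⟩ := exists_row_move (p := p) hrs.1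
    obtain ⟨k₂, hk₂, e₂, hn₂, hr₂, hf₂, hb₂⟩ := exists_row_move (p := p) hrs.2
    have hn : ∀ t u, ‖(k₁ * (g * spT k₂)).1 t u‖ = ‖g.1 (e₁ t) (e₂ u)‖ := by
      intro t u
      rw [hn₁, ← spT_apply, spT_mul, spT_spT, hn₂]; rfl
    set g₁ := k₁ * (g * spT k₂) with hg₁
    have hne : ∀ {e : Fin n ⊕ Fin n → Fin n ⊕ Fin n}, (∀ t, J < ht t → e t = t) →
        (∀ t, ht t ≤ J → ht (e t) ≤ J) → ∀ i, J < i → ∀ t, ht t ≠ i → ht (e t) ≠ i := by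
      intro e h1 h2 i hi t hti
      rcases le_or_gt (ht t) J with h | h
      · exact ((h2 t h).trans_lt hi).ne
      · rwa [h1 t h]
    have hiso₁ : ∀ i, J < i → Isolated g₁ i := fun i hi =>
      (hisoJ i hi).of_norm hn (fun t h => hf₁ t (h ▸ hi)) (fun t h => hf₂ t (h ▸ hi))
        (hne hf₁ hb₁ i hi) (hne hf₂ hb₂ i hi)
    have hpiv : ‖g₁.1 (Sum.inr J) (Sum.inr J)‖ = ‖g.1 r s‖ := by rw [hn, hr₁, hr₂]
    have hmax₁ : ∀ t u, ht t ≤ J → ht u ≤ J →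
        ‖g₁.1 t u‖ ≤ ‖g₁.1 (Sum.inr J) (Sum.inr J)‖ := by
      intro t u ht' hu'
      rw [hpiv, hn]
      exact hmax _ _ ⟨hb₁ t ht', hb₂ u hu'⟩
    have hcol : ∀ {h : Sp p n}, (∀ i, J < i → Isolated h i) →
        (∀ t, ht t ≤ J → ‖h.1 t (Sum.inr J)‖ ≤ ‖h.1 (Sum.inr J) (Sum.inr J)‖) →
        ∀ t, ‖h.1 t (Sum.inr J)‖ ≤ ‖h.1 (Sum.inr J) (Sum.inr J)‖ := by
      intro h h1 h2 t
      rcases le_or_gt (ht t) J with h' | h'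
      · exact h2 t h'
      · rw [(h1 _ h').zero_of_ht rfl (show ht (Sum.inr J) ≠ ht t from h'.ne), norm_zero]
        exact norm_nonneg _
    have h0 : g₁.1 (Sum.inr J) (Sum.inr J) ≠ 0 := by
      intro h0
      have hz : ∀ t, g₁.1 t (Sum.inr J) = 0 := fun t => by
        have := hcol hiso₁ (fun t ht' => hmax₁ t _ ht' le_rfl) t
        rw [h0, norm_zero] at this
        exact norm_le_zero_iff.1 this
      have h1 := congrFun (congrFun (congrArg Subtype.val (inv_mul_cancel g₁)) (Sum.inr J))
        (Sum.inr J)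
      rw [Submonoid.coe_mul, Matrix.mul_apply, Submonoid.coe_one, Matrix.one_apply_eq] at h1
      simp [hz] at h1
    obtain ⟨k, hk, hkcol, hkiso, z, hz, hkrow⟩ := exists_clear h0
      (hcol hiso₁ fun t ht' => hmax₁ t _ ht' le_rfl) hiso₁
    set g₂ := k.1 * g₁ with hg₂
    have hrow₂ : ∀ i, J ≤ i → ∀ s, g₂.1 (Sum.inr i) s = g₁.1 (Sum.inr i) s := fun i hi s => by
      rw [hkrow, hz i hi, zero_mul, sub_zero]
    obtain ⟨k', hk', hkcol', hkiso', z', hz', hkrow'⟩ := exists_clear (g := spT g₂) (j := J)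
      (by rw [spT_apply, hrow₂ J le_rfl]; exact h0)
      (hcol (fun i hi => (hkiso i hi).spT) fun t ht' => by
        rw [spT_apply, spT_apply, hrow₂ J le_rfl, hrow₂ J le_rfl]
        exact hmax₁ _ _ le_rfl ht') (fun i hi => (hkiso i hi).spT)
    set g₃ := spT (k'.1 * spT g₂) with hg₃
    have hrow₃ : ∀ i, J ≤ i → ∀ s, g₃.1 s (Sum.inr i) = g₂.1 s (Sum.inr i) := fun i hi s => by
      rw [hg₃, spT_apply, hkrow', hz' i hi, zero_mul, sub_zero, spT_apply]
    have hiso₃ : ∀ i : Fin n, j ≤ i → Isolated g₃ i := by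
      intro i hi
      rcases (show J ≤ i from hi).eq_or_lt with rfl | hi'
      · intro t htJ
        refine ⟨hkcol' t htJ, ?_⟩
        rw [hrow₃ _ le_rfl]
        exact hkcol t htJ
      · exact (hkiso' i hi').spT
    have hdiag : ∀ i, J ≤ i → g₃.1 (Sum.inr i) (Sum.inr i) = g₁.1 (Sum.inr i) (Sum.inr i) :=
      fun i hi => by rw [hrow₃ i hi, hrow₂ i hi]
    obtain ⟨q₁, q₂, hq₁, hq₂, a, h, ha, -⟩ := ih (Nat.le_of_succ_le hj) g₃ hiso₃
    have hJ : ‖g.1 r s‖ = ‖(p : ℚ_[p]) ^ a J‖ := by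
      rw [← hpiv, ← ha J le_rfl, hdiag J le_rfl]
    refine ⟨q₁ * k.1 * k₁, spT k₂ * spT k'.1 * q₂, (hq₁.mul hk).mul hk₁,
      ((hk₂.transpose).mul hk'.transpose).mul hq₂, a, ?_, ?_, ?_⟩
    · rw [h, hg₃, spT_mul, spT_spT, hg₂, hg₁]
      simp only [mul_assoc]
    · intro i hi
      have hi' : J < i := hi
      rw [← ha i (Nat.le_of_succ_le hi), hdiag i hi'.le, hn,
        hf₁ (Sum.inr i) hi', hf₂ (Sum.inr i) hi']
    · intro i hi t u ht' hu'
      obtain rfl : i = J := Fin.ext (by simpa [J] using hi)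
      rw [← hJ]
      exact hmax t u ⟨ht', hu'⟩

/-- An exponent vector in `Q` that is minimal in the lexicographic order which compares the last
coordinates first. -/
theorem exists_lex_min {Q : Set (Fin n → ℤ)} (hfin : Q.Finite) (hne : Q.Nonempty) :
    ∃ a ∈ Q, ∀ a' ∈ Q, ∀ j, (∀ i, j < i → a' i = a i) → a j ≤ a' j := by
  obtain ⟨a, ha, hmin⟩ := hfin.exists_minimalFor
    (fun a => toLex fun i : Fin n => a (Fin.rev i)) Q hne
  refine ⟨a, ha, fun a' ha' j hj => ?_⟩
  by_contra! hlt
  have h : (toLex fun i : Fin n => a' (Fin.rev i)) < toLex fun i : Fin n => a (Fin.rev i) := by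
    refine ⟨Fin.rev j, fun i hi => ?_, by simpa using hlt⟩
    exact hj _ (by rwa [Fin.lt_rev_iff])
  exact absurd (hmin ha' h.le) (not_le.2 h)

/-- If `a` is extremal among the exponents of the diagonal elements of a union `Q` of double cosets,
then an element of `P_p ∩ Q` with `d` upper triangular of diagonal `p^a` lies in the coset of
`diag[p^{-a}, p^a]`. -/
theorem exists_eq_siegelDiag {Q : siegelP p n → Prop}
    (hQ : ∀ (g g' : siegelP p n) (k₁ k₂ : Sp p n), Integral k₁.1 → Integral k₂.1 →
      g'.1 = k₁ * g.1 * k₂ → Q g → Q g') {a : Fin n → ℤ}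
    (hmin : ∀ a', Q (siegelDiag (diagP p a')) → ∀ j, (∀ i, j < i → a' i = a i) → a j ≤ a' j)
    (j : ℕ) (hj : j ≤ n) (g : siegelP p n) (hg : Q g)
    (htri : ∀ i l, l < i → blkD g.1 i l = 0) (hdiag : ∀ i, ‖blkD g.1 i i‖ = ‖(p : ℚ_[p]) ^ a i‖)
    (hiso : ∀ i : Fin n, j ≤ i → Isolated g.1 i) :
    ∃ κ : siegelP p n, Integral κ.1.1 ∧ κ * g = siegelDiag (diagP p a) := by
  induction j generalizing g with
  | zero =>
    obtain ⟨u, hu, h⟩ := eq_siegelDiag_of_isolated (fun i => hiso i (Nat.zero_le _)) hdiag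
    exact ⟨siegelDiag u, siegelDiag_integral hu, Subtype.ext h⟩
  | succ j ih =>
    let J : Fin n := ⟨j, hj⟩
    have hisoJ : ∀ i, J < i → Isolated g.1 i := fun i hi => hiso i hi
    obtain ⟨k₁, k₂, hk₁, hk₂, a', h, ha', hmax⟩ := exists_cartan (j + 1) hj g.1 hiso
    have haJ : a J ≤ a' J := hmin a' (hQ _ _ k₁ k₂ hk₁ hk₂ h hg) J fun i hi =>
      (norm_p_zpow_inj ((hdiag i).symm.trans (ha' i hi))).symm
    have hcol : ∀ t, ‖g.1.1 t (Sum.inr J)‖ ≤ ‖g.1.1 (Sum.inr J) (Sum.inr J)‖ := by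
      intro t
      rcases le_or_gt (ht t) J with h' | h'
      · refine (hmax J rfl t (Sum.inr J) h' le_rfl).trans ((norm_p_zpow_le_iff.2 haJ).trans ?_)
        exact (hdiag J).ge
      · rw [(hisoJ _ h').zero_of_ht rfl (show ht (Sum.inr J) ≠ ht t from h'.ne), norm_zero]
        exact norm_nonneg _
    have h0 : g.1.1 (Sum.inr J) (Sum.inr J) ≠ 0 := by
      rw [← norm_ne_zero_iff]
      exact (hdiag J).trans_ne (norm_ne_zero_iff.2 (zpow_ne_zero _ p_ne_zero))
    obtain ⟨k, hk, hkcol, hkiso, z, hz, hkrow⟩ := exists_clear h0 hcol hisoJ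
    have hrow : ∀ i l, blkD (k * g).1 i l = blkD g.1 i l - z i * blkD g.1 J l := fun i l =>
      hkrow i (Sum.inr l)
    obtain ⟨κ, hκ, hκg⟩ := ih (Nat.le_of_succ_le hj) (k * g)
      (hQ g (k * g) k.1 1 hk Integral.one (by rw [mul_one]; rfl) hg)
      (fun i l hl => by
        rw [hrow, htri i l hl]
        rcases le_or_gt J i with hi | hi
        · rw [hz i hi]; simp
        · rw [htri J l (hl.trans hi)]; simp)
      (fun i => by
        rw [← hdiag i, hrow]
        rcases le_or_gt J i with hi | hi
        · rw [hz i hi]; simp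
        · rw [htri J i hi]; simp)
      (fun i hi => by
        rcases (show J ≤ i from hi).eq_or_lt with rfl | hi'
        · intro t htJ
          refine ⟨?_, hkcol t htJ⟩
          rw [Subgroup.coe_mul, hkrow, hz _ le_rfl, zero_mul, sub_zero]
          rcases t with t | t
          · exact congrFun (congrFun g.2 _) _
          · have htJ' : t ≠ J := by simpa using htJ
            rcases lt_or_gt_of_ne htJ' with hlt | hgt
            · exact htri J t hlt
            · exact (hisoJ t hgt _ (by simpa using htJ'.symm)).2
        · exact hkiso i hi')
    exact ⟨κ * k, hκ.mul hk, by rw [mul_assoc, hκg]⟩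

end Extremal

section Smith

variable {p : ℕ} [Fact p.Prime] {n : ℕ} {L : Level}

/-- The row and the column of index `i` vanish off the diagonal. -/
def IsolatedGL (d : GL (Fin n) ℚ_[p]) (i : Fin n) : Prop :=
  ∀ t, t ≠ i → d.1 i t = 0 ∧ d.1 t i = 0

/-- The transpose of an invertible matrix. -/
noncomputable def glT (d : GL (Fin n) ℚ_[p]) : GL (Fin n) ℚ_[p] :=
  ⟨d.1ᵀ, (d⁻¹).1ᵀ, by rw [← Matrix.transpose_mul, Units.inv_mul, Matrix.transpose_one],
    by rw [← Matrix.transpose_mul, Units.mul_inv, Matrix.transpose_one]⟩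

theorem glT_mul (d e : GL (Fin n) ℚ_[p]) : glT (d * e) = glT e * glT d :=
  Units.ext (Matrix.transpose_mul _ _)

theorem glT_glT (d : GL (Fin n) ℚ_[p]) : glT (glT d) = d := Units.ext rfl

theorem glT_apply (d : GL (Fin n) ℚ_[p]) (i j : Fin n) : (glT d).1 i j = d.1 j i := rfl

theorem glT_mem {d : GL (Fin n) ℚ_[p]} (h : d ∈ glZ p n) : glT d ∈ glZ p n := by
  rw [mem_glZ] at h ⊢
  exact ⟨h.1.transpose, h.2.transpose⟩

theorem IsolatedGL.glT {d : GL (Fin n) ℚ_[p]} {i : Fin n} (h : IsolatedGL d i) :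
    IsolatedGL (glT d) i := fun t ht => (h t ht).symm

theorem IsolatedGL.isolated {d : GL (Fin n) ℚ_[p]} {i : Fin n} (h : IsolatedGL d i) :
    Isolated (siegelDiag d).1 i := by
  rintro (t | t) ht
  · exact ⟨congrFun (congrFun (show blkC (siegelDiag d).1 = 0 from (siegelDiag d).2) i) t,
      congrFun (congrFun (blkB_siegelDiag d) t) i⟩
  · exact h t (by simpa using ht)

theorem isolatedGL_of_blkD {d : GL (Fin n) ℚ_[p]} {g : siegelP p n} {i : Fin n}
    (h : Isolated g.1 i) (hd : levi g = d) : IsolatedGL d i := by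
  subst hd
  exact fun t ht => h (Sum.inr t) (by simpa using ht)

theorem exists_swap_GL (i j : Fin n) : ∃ u ∈ glZ p n, ∀ (d : GL (Fin n) ℚ_[p]) t s,
    (u * d).1 t s = d.1 (Equiv.swap i j t) s := by
  let P : Matrix (Fin n) (Fin n) ℚ_[p] :=
    (1 : Matrix (Fin n) (Fin n) ℚ_[p]).submatrix (Equiv.swap i j) id
  have hP : ∀ (M : Matrix (Fin n) (Fin n) ℚ_[p]) t s, (P * M) t s = M (Equiv.swap i j t) s := by
    intro M t s
    simp [P, Matrix.mul_apply, Matrix.one_apply]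
  have hPP : P * P = 1 := by
    ext a b; rw [hP]; simp [P, Matrix.one_apply]
  have hPi : Integral P := fun a b => Integral.one _ _
  exact ⟨⟨P, P, hPP, hPP⟩, mem_glZ.2 ⟨hPi, hPi⟩, fun d => hP d.1⟩

/-- Clearing the column `j` by an element of `GL_n(ℤ_p)`. -/
theorem exists_clear_GL {d : GL (Fin n) ℚ_[p]} {j : Fin n} (h0 : d.1 j j ≠ 0)
    (hmax : ∀ t, ‖d.1 t j‖ ≤ ‖d.1 j j‖) (hiso : ∀ i, j < i → IsolatedGL d i) :
    ∃ u ∈ glZ p n, (∀ t, t ≠ j → (u * d).1 t j = 0) ∧ (∀ i, j < i → IsolatedGL (u * d) i) ∧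
      ∃ z : Fin n → ℚ_[p], (∀ i, j ≤ i → z i = 0) ∧
        ∀ i s, (u * d).1 i s = d.1 i s - z i * d.1 j s := by
  obtain ⟨k, hk, hkcol, hkiso, z, hz, hkrow⟩ := exists_clear (g := (siegelDiag d).1) (j := j) h0
    (by
      rintro (t | t)
      · rw [show (siegelDiag d).1.1 (Sum.inl t) (Sum.inr j) = 0 from
          congrFun (congrFun (blkB_siegelDiag d) t) j, norm_zero]
        exact norm_nonneg _
      · exact hmax t) (fun i hi => (hiso i hi).isolated)
  have e : levi (k * siegelDiag d) = levi k * d := by rw [map_mul, levi_siegelDiag]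
  have e' : ∀ i s, (levi k * d).1 i s = (k.1 * (siegelDiag d).1).1 (Sum.inr i) (Sum.inr s) := by
    intro i s; rw [← e]; rfl
  obtain ⟨ha, -, -, hd⟩ := integral_iff_blk.1 hk
  refine ⟨levi k, mem_glZ.2 ⟨hd, ha.transpose⟩, fun t ht => ?_,
    fun i hi => isolatedGL_of_blkD (g := k * siegelDiag d) (hkiso i hi) e, z, hz, fun i s => ?_⟩
  · rw [e']; exact hkcol _ (by simpa using ht)
  · rw [e', hkrow]; rfl

theorem eq_diagP_of_isolated {d : GL (Fin n) ℚ_[p]} {a : Fin n → ℤ} (hiso : ∀ i, IsolatedGL d i)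
    (ha : ∀ i, ‖d.1 i i‖ = ‖(p : ℚ_[p]) ^ a i‖) : ∃ u ∈ glZ p n, u * d = diagP p a := by
  obtain ⟨u, hu, h⟩ := eq_siegelDiag_of_isolated (fun i => (hiso i).isolated) ha
  have h' := congrArg levi (Subtype.ext h : siegelDiag u * siegelDiag d = siegelDiag (diagP p a))
  rw [map_mul, levi_siegelDiag, levi_siegelDiag, levi_siegelDiag] at h'
  exact ⟨u, hu, h'⟩

/-- The Smith normal form, starting from a matrix that is already diagonal in the indices
`i ≥ j`. -/
theorem exists_smith (j : ℕ) (hj : j ≤ n) (d : GL (Fin n) ℚ_[p])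
    (hiso : ∀ i : Fin n, j ≤ i → IsolatedGL d i) :
    ∃ u ∈ glZ p n, ∃ v ∈ glZ p n, ∃ a : Fin n → ℤ, diagP p a = u * d * v ∧
      (∀ i : Fin n, j ≤ i → ‖d.1 i i‖ = ‖(p : ℚ_[p]) ^ a i‖) ∧
      ∀ i : Fin n, (i : ℕ) + 1 = j → ∀ r s, r ≤ i → s ≤ i → ‖d.1 r s‖ ≤ ‖(p : ℚ_[p]) ^ a i‖ := by
  induction j generalizing d with
  | zero =>
    have hiso' : ∀ i, IsolatedGL d i := fun i => hiso i (Nat.zero_le _)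
    choose a ha using fun i => exists_norm_eq (hiso' i).isolated.ne_zero
    obtain ⟨u, hu, h⟩ := eq_diagP_of_isolated hiso' ha
    exact ⟨u, hu, 1, one_mem _, a, by rw [mul_one, h], fun i _ => ha i, fun i hi => by omega⟩
  | succ j ih =>
    let J : Fin n := ⟨j, hj⟩
    have hisoJ : ∀ i, J < i → IsolatedGL d i := fun i hi => hiso i hi
    obtain ⟨⟨r, s⟩, hrs, hmax⟩ := Finset.exists_max_image
      (Finset.univ.filter fun q : Fin n × Fin n => q.1 ≤ J ∧ q.2 ≤ J)
      (fun q => ‖d.1 q.1 q.2‖) ⟨(J, J), Finset.mem_filter.2 ⟨Finset.mem_univ _, le_rfl, le_rfl⟩⟩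
    simp only [Finset.mem_filter, Finset.mem_univ, true_and, Prod.forall] at hrs hmax
    obtain ⟨k₁, hk₁, hs₁⟩ := exists_swap_GL (p := p) r J
    obtain ⟨k₂, hk₂, hs₂⟩ := exists_swap_GL (p := p) s J
    have hn : ∀ t u, (k₁ * (d * glT k₂)).1 t u = d.1 (Equiv.swap r J t) (Equiv.swap s J u) := by
      intro t u
      rw [hs₁, ← glT_apply, glT_mul, glT_glT, hs₂]; rfl
    set d₁ := k₁ * (d * glT k₂) with hd₁
    have hf : ∀ r, r ≤ J → ∀ l, J < l → Equiv.swap r J l = l := fun r hr l hl =>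
      Equiv.swap_apply_of_ne_of_ne (hr.trans_lt hl).ne' hl.ne'
    have hb : ∀ r, r ≤ J → ∀ l, l ≤ J → Equiv.swap r J l ≤ J := fun r hr l hl => by
      rw [Equiv.swap_apply_def]; split_ifs <;> first | exact le_rfl | assumption
    have hiso₁ : ∀ i, J < i → IsolatedGL d₁ i := by
      intro i hi t hti
      rw [hn, hn, hf r hrs.1 i hi, hf s hrs.2 i hi]
      refine ⟨(hisoJ i hi _ fun h => hti ?_).1, (hisoJ i hi _ fun h => hti ?_).2⟩
      · rw [← hf s hrs.2 i hi] at h; exact (Equiv.swap s J).injective h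
      · rw [← hf r hrs.1 i hi] at h; exact (Equiv.swap r J).injective h
    have hpiv : d₁.1 J J = d.1 r s := by simp [hn]
    have hmax₁ : ∀ t u, t ≤ J → u ≤ J → ‖d₁.1 t u‖ ≤ ‖d₁.1 J J‖ := by
      intro t u ht' hu'
      rw [hpiv, hn]
      exact hmax _ _ ⟨hb r hrs.1 t ht', hb s hrs.2 u hu'⟩
    have hcol : ∀ {h : GL (Fin n) ℚ_[p]}, (∀ i, J < i → IsolatedGL h i) →
        (∀ t, t ≤ J → ‖h.1 t J‖ ≤ ‖h.1 J J‖) → ∀ t, ‖h.1 t J‖ ≤ ‖h.1 J J‖ := by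
      intro h h1 h2 t
      rcases le_or_gt t J with h' | h'
      · exact h2 t h'
      · rw [(h1 _ h' J h'.ne).1, norm_zero]
        exact norm_nonneg _
    have h0 : d₁.1 J J ≠ 0 := by
      intro h0
      have hz : ∀ t, d₁.1 t J = 0 := fun t => by
        have := hcol hiso₁ (fun t ht' => hmax₁ t _ ht' le_rfl) t
        rw [h0, norm_zero] at this
        exact norm_le_zero_iff.1 this
      have h1 := congrFun (congrFun d₁.inv_mul J) J
      rw [Matrix.mul_apply, Matrix.one_apply_eq] at h1
      simp [hz] at h1
    obtain ⟨k, hk, hkcol, hkiso, z, hz, hkrow⟩ := exists_clear_GL h0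
      (hcol hiso₁ fun t ht' => hmax₁ t _ ht' le_rfl) hiso₁
    set d₂ := k * d₁ with hd₂
    have hrow₂ : ∀ i, J ≤ i → ∀ s, d₂.1 i s = d₁.1 i s := fun i hi s => by
      rw [hkrow, hz i hi, zero_mul, sub_zero]
    obtain ⟨k', hk', hkcol', hkiso', z', hz', hkrow'⟩ := exists_clear_GL (d := glT d₂) (j := J)
      (by rw [glT_apply, hrow₂ J le_rfl]; exact h0)
      (hcol (fun i hi => (hkiso i hi).glT) fun t ht' => by
        rw [glT_apply, glT_apply, hrow₂ J le_rfl, hrow₂ J le_rfl]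
        exact hmax₁ _ _ le_rfl ht') (fun i hi => (hkiso i hi).glT)
    set d₃ := glT (k' * glT d₂) with hd₃
    have hrow₃ : ∀ i, J ≤ i → ∀ s, d₃.1 s i = d₂.1 s i := fun i hi s => by
      rw [hd₃, glT_apply, hkrow', hz' i hi, zero_mul, sub_zero, glT_apply]
    have hiso₃ : ∀ i : Fin n, j ≤ i → IsolatedGL d₃ i := by
      intro i hi
      rcases (show J ≤ i from hi).eq_or_lt with rfl | hi'
      · intro t htJ
        refine ⟨hkcol' t htJ, ?_⟩
        rw [hrow₃ _ le_rfl]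
        exact hkcol t htJ
      · exact (hkiso' i hi').glT
    have hdiag : ∀ i, J ≤ i → d₃.1 i i = d₁.1 i i :=
      fun i hi => by rw [hrow₃ i hi, hrow₂ i hi]
    obtain ⟨q₁, hq₁, q₂, hq₂, a, h, ha, -⟩ := ih (Nat.le_of_succ_le hj) d₃ hiso₃
    have hJ : ‖d.1 r s‖ = ‖(p : ℚ_[p]) ^ a J‖ := by
      rw [← hpiv, ← ha J le_rfl, hdiag J le_rfl]
    refine ⟨q₁ * k * k₁, mul_mem (mul_mem hq₁ hk) hk₁, glT k₂ * glT k' * q₂,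
      mul_mem (mul_mem (glT_mem hk₂) (glT_mem hk')) hq₂, a, ?_, ?_, ?_⟩
    · rw [h, hd₃, glT_mul, glT_glT, hd₂, hd₁]
      simp only [mul_assoc]
    · intro i hi
      have hi' : J < i := hi
      rw [← ha i (Nat.le_of_succ_le hi), hdiag i hi'.le, hn, hf r hrs.1 _ hi', hf s hrs.2 _ hi']
    · intro i hi t u ht' hu'
      obtain rfl : i = J := Fin.ext (by simpa [J] using hi)
      rw [← hJ]
      exact hmax t u ⟨ht', hu'⟩

/-- If `a` is extremal among the exponents of the diagonal elements of a union `Q` of double cosets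
of `GL_n(ℤ_p)`, then an upper triangular element of `Q` with diagonal `p^a` lies in the coset of
`diag[p^a]`. -/
theorem exists_eq_diagP {Q : GL (Fin n) ℚ_[p] → Prop}
    (hQ : ∀ d u v, u ∈ glZ p n → v ∈ glZ p n → Q d → Q (u * d * v)) {a : Fin n → ℤ}
    (hmin : ∀ a', Q (diagP p a') → ∀ j, (∀ i, j < i → a' i = a i) → a j ≤ a' j)
    (j : ℕ) (hj : j ≤ n) (d : GL (Fin n) ℚ_[p]) (hd : Q d)
    (htri : ∀ i l, l < i → d.1 i l = 0) (hdiag : ∀ i, ‖d.1 i i‖ = ‖(p : ℚ_[p]) ^ a i‖)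
    (hiso : ∀ i : Fin n, j ≤ i → IsolatedGL d i) :
    ∃ u ∈ glZ p n, u * d = diagP p a := by
  induction j generalizing d with
  | zero => exact eq_diagP_of_isolated (fun i => hiso i (Nat.zero_le _)) hdiag
  | succ j ih =>
    let J : Fin n := ⟨j, hj⟩
    have hisoJ : ∀ i, J < i → IsolatedGL d i := fun i hi => hiso i hi
    obtain ⟨k₁, hk₁, k₂, hk₂, a', h, ha', hmax⟩ := exists_smith (j + 1) hj d hiso
    have haJ : a J ≤ a' J := hmin a' (h ▸ hQ _ _ _ hk₁ hk₂ hd) J fun i hi =>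
      (norm_p_zpow_inj ((hdiag i).symm.trans (ha' i hi))).symm
    have hcol : ∀ t, ‖d.1 t J‖ ≤ ‖d.1 J J‖ := by
      intro t
      rcases le_or_gt t J with h' | h'
      · refine (hmax J rfl t J h' le_rfl).trans ((norm_p_zpow_le_iff.2 haJ).trans ?_)
        exact (hdiag J).ge
      · rw [htri t J h', norm_zero]
        exact norm_nonneg _
    have h0 : d.1 J J ≠ 0 := by
      rw [← norm_ne_zero_iff]
      exact (hdiag J).trans_ne (norm_ne_zero_iff.2 (zpow_ne_zero _ p_ne_zero))
    obtain ⟨k, hk, hkcol, hkiso, z, hz, hrow⟩ := exists_clear_GL h0 hcol hisoJ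
    obtain ⟨κ, hκ, hκg⟩ := ih (Nat.le_of_succ_le hj) (k * d)
      (by simpa using hQ d k 1 hk (one_mem _) hd)
      (fun i l hl => by
        rw [hrow, htri i l hl]
        rcases le_or_gt J i with hi | hi
        · rw [hz i hi]; simp
        · rw [htri J l (hl.trans hi)]; simp)
      (fun i => by
        rw [← hdiag i, hrow]
        rcases le_or_gt J i with hi | hi
        · rw [hz i hi]; simp
        · rw [htri J i hi]; simp)
      (fun i hi => by
        rcases (show J ≤ i from hi).eq_or_lt with rfl | hi'
        · intro t htJ
          refine ⟨?_, hkcol t htJ⟩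
          rw [hrow, hz _ le_rfl, zero_mul, sub_zero]
          rcases lt_or_gt_of_ne htJ with hlt | hgt
          · exact htri J t hlt
          · exact (hisoJ t hgt _ htJ.symm).2
        · exact hkiso i hi')
    exact ⟨κ * k, mul_mem hκ hk, by rw [mul_assoc, hκg]⟩

end Smith

section Coefficients

variable {p : ℕ} [Fact p.Prime] {n : ℕ} {L : Level}

theorem upper_mul_diag {u d : Matrix (Fin n) (Fin n) ℚ_[p]} (hu : ∀ i j, j < i → u i j = 0)
    (hd : ∀ i j, j < i → d i j = 0) (i : Fin n) : (u * d) i i = u i i * d i i := by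
  rw [Matrix.mul_apply, Finset.sum_eq_single i]
  · intro k _ hk
    rcases lt_or_gt_of_ne hk with h | h
    · rw [hu i k h, zero_mul]
    · rw [hd k i h, mul_zero]
  · simp

theorem hasDiag_unique {c : RightCosets (glZ p n)} {a a' : Fin n → ℤ} (h : HasDiag c a)
    (h' : HasDiag c a') : a = a' := by
  have key : ∀ {a a' : Fin n → ℤ}, HasDiag c a → HasDiag c a' → ∀ i, a i ≤ a' i := by
    rintro a a' ⟨d, hd, ht, hdiag⟩ ⟨d', hd', ht', hdiag'⟩ i
    have hu : d' * d⁻¹ ∈ glZ p n := rightCoset_eq.1 (hd.trans hd'.symm)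
    have hinv : ∀ i j, j < i → (d⁻¹).1 i j = 0 := by
      have hd1 : d.1.BlockTriangular id := fun i j hij => ht i j hij
      have : Invertible d.1 := d.invertible
      have h1 := Matrix.blockTriangular_inv_of_blockTriangular hd1
      rw [← Matrix.coe_units_inv] at h1
      exact fun i j hij => h1 hij
    have hut : ∀ i j, j < i → (d' * d⁻¹).1 i j = 0 := by
      intro i j hij
      rw [Units.val_mul, Matrix.mul_apply]
      refine Finset.sum_eq_zero fun k _ => ?_
      rcases lt_or_ge k i with hk | hk
      · rw [ht' i k hk, zero_mul]
      · rw [hinv k j (hij.trans_le hk), mul_zero]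
    have e := upper_mul_diag hut ht i
    rw [← Units.val_mul, inv_mul_cancel_right, hdiag, hdiag'] at e
    have h1 := (mem_glZ.1 hu).1 i i
    have h2 := congrArg norm e
    rw [norm_mul] at h2
    rw [← norm_p_zpow_le_iff (p := p), h2]
    exact mul_le_of_le_one_left (norm_nonneg _) h1
  exact funext fun i => le_antisymm (key h h' i) (key h' h i)

variable (p) in
/-- The weight `∏ (p^{-i})^{a_i}` of an exponent vector in the Satake map. -/
noncomputable def wt (a : Fin n → ℤ) : ℂ := ∏ i : Fin n, ((p : ℂ) ^ (-((i : ℤ) + 1))) ^ a i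

theorem wt_ne_zero (a : Fin n → ℤ) : wt p a ≠ 0 :=
  Finset.prod_ne_zero_iff.2 fun _ _ => zpow_ne_zero _ (zpow_ne_zero _
    (by exact_mod_cast (Fact.out : p.Prime).ne_zero))

theorem wt_add (a b : Fin n → ℤ) : wt p (a + b) = wt p a * wt p b := by
  unfold wt
  rw [← Finset.prod_mul_distrib]
  refine Finset.prod_congr rfl fun i _ => ?_
  rw [Pi.add_apply, zpow_add₀ (zpow_ne_zero _ (by exact_mod_cast (Fact.out : p.Prime).ne_zero))]

open Classical in
/-- The coefficient of `x^a` in the monomial attached to `g ∈ P_p`. -/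
noncomputable def monCoeff (a : Fin n → ℤ) (g : siegelP p n) : ℂ :=
  if HasDiag (rightCoset (glZ p n) (levi g)) a then wt p a else 0

open Classical in
theorem coeff_cosetMonomial (c : RightCosets (glZ p n)) (a : Fin n → ℤ) :
    (cosetMonomial c).coeff a = if HasDiag c a then wt p a else 0 := by
  unfold cosetMonomial
  split_ifs with h h' h'
  · rw [hasDiag_unique h.choose_spec h', AddMonoidAlgebra.coeff_single, Finsupp.single_eq_same]; rfl
  · rw [AddMonoidAlgebra.coeff_single, Finsupp.single_eq_of_ne]
    rintro rfl
    exact h' h.choose_spec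
  · exact absurd ⟨a, h'⟩ h
  · rfl

theorem monCoeff_eq_of_levi {a : Fin n → ℤ} {g g' : siegelP p n}
    (h : levi g' * (levi g)⁻¹ ∈ glZ p n) : monCoeff a g' = monCoeff a g := by
  unfold monCoeff
  rw [rightCoset_eq.2 h]

theorem monCoeff_left (hp : ¬ p ∣ L.c) {a : Fin n → ℤ} {k : siegelP p n} (hk : k ∈ levelD0 p n L)
    (g : siegelP p n) : monCoeff a (k * g) = monCoeff a g := by
  refine monCoeff_eq_of_levi ?_
  rw [map_mul, mul_inv_cancel_right]
  exact levi_mem hp hk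

theorem left_inv (T : HeckeS0 p n L) {k : siegelP p n} (hk : k ∈ levelD0 p n L) (g : siegelP p n) :
    T (k * g) = T g := by
  rw [T.left_eq hk, MonoidHom.one_apply, one_mul]

theorem right_inv (T : HeckeS0 p n L) {k : siegelP p n} (hk : k ∈ levelD0 p n L)
    (g : siegelP p n) : T (g * k) = T g := by
  rw [T.right_eq hk, MonoidHom.one_apply, one_mul]

theorem coeff_omegaS (T : HeckeS0 p n L) (a : Fin n → ℤ) :
    (omegaS p n L T).coeff a =
      HeckeAlg.cosetSum (levelD0 p n L) fun g => monCoeff a g * T g := by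
  have h1 : omegaS p n L T = (HeckeAlg.toFormalSum (levelD0 p n L) T).sum fun c x =>
      x • cosetMonomial (rightCoset (glZ p n) (levi c.out)) := by
    change Finsupp.linearCombination ℂ cosetMonomial (Finsupp.mapDomain _ _) = _
    rw [Finsupp.linearCombination_mapDomain, Finsupp.linearCombination_apply]
    rfl
  rw [h1, AddMonoidAlgebra.coeff_finsuppSum, Finsupp.sum, Finsupp.finsetSum_apply]
  unfold HeckeAlg.cosetSum
  rw [finsum_eq_sum_of_support_subset
    (s := (HeckeAlg.toFormalSum (levelD0 p n L) T).support)]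
  · refine Finset.sum_congr rfl fun c _ => ?_
    change T c.out * (cosetMonomial _).coeff a = _
    rw [coeff_cosetMonomial, mul_comm]
    rfl
  · intro c hc
    rw [Finset.mem_coe, Finsupp.mem_support_iff]
    exact right_ne_zero_of_mul hc

theorem frobU_apply (g : siegelP p n) [Decidable (∃ k₁ ∈ levelD0 p n L, ∃ k₂ ∈ levelD0 p n L,
    g = k₁ * frobElt p n * k₂)] : frobU p n L g =
    if ∃ k₁ ∈ levelD0 p n L, ∃ k₂ ∈ levelD0 p n L, g = k₁ * frobElt p n * k₂ then 1 else 0 := by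
  change (@ite ℂ _ (Classical.propDecidable _) 1 0) = _
  congr

theorem levi_frob : levi (frobElt p n) = scalarP p n := levi_siegelDiag _

theorem scalarP_val : (scalarP p n).1 = (p : ℚ_[p]) • (1 : Matrix (Fin n) (Fin n) ℚ_[p]) := by
  rw [← blkD_frob]; exact (blkD_siegelDiag _).symm

theorem scalarP_comm (d : GL (Fin n) ℚ_[p]) : scalarP p n * d = d * scalarP p n := by
  refine Units.ext ?_
  rw [Units.val_mul, Units.val_mul, scalarP_val, Matrix.smul_mul, Matrix.mul_smul, one_mul, mul_one]

/-- The double coset of `diag[p⁻¹, p]` consists of the cosets of `diag[p⁻¹, p] n(S)`. -/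
theorem exists_of_frobU_ne_zero (hp : ¬ p ∣ L.c) {h : siegelP p n} (hh : frobU p n L h ≠ 0) :
    ∃ k ∈ levelD0 p n L, ∃ (S : Matrix (Fin n) (Fin n) ℚ_[p]) (hS : Sᵀ = S), Integral S ∧
      h = k * (frobElt p n * siegelN S hS) := by
  classical
  rw [frobU_apply] at hh
  obtain ⟨k₁, h₁, k₂, h₂, rfl⟩ : ∃ k₁ ∈ levelD0 p n L, ∃ k₂ ∈ levelD0 p n L,
      h = k₁ * frobElt p n * k₂ := by
    by_contra hcon
    exact hh (if_neg hcon)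
  obtain ⟨ha, hb, -, hd⟩ := integral_iff_blk.1 ((mem_levelD0 hp).1 h₂)
  refine ⟨k₁ * siegelDiag (levi k₂), mul_mem h₁ (siegelDiag_mem hp (levi_mem hp h₂)), _,
    siegelP_transpose_D_mul_B k₂, hd.transpose.mul hb, ?_⟩
  conv_lhs => rw [siegelP_eq k₂]
  rw [mul_assoc, mul_assoc, ← mul_assoc (frobElt p n), ← mul_assoc (siegelDiag _)]
  congr 2
  rw [frobElt, ← siegelDiag_mul, ← siegelDiag_mul, scalarP_comm]

theorem frobU_apply_of (hp : ¬ p ∣ L.c) {S : Matrix (Fin n) (Fin n) ℚ_[p]} (hS : Sᵀ = S)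
    (hSi : Integral S) : frobU p n L (frobElt p n * siegelN S hS) = 1 := by
  classical
  rw [frobU_apply]
  exact if_pos ⟨1, one_mem _, _, siegelN_mem hp hS hSi, by rw [one_mul]⟩

theorem hasDiag_mul_scalarP (d : GL (Fin n) ℚ_[p]) (a : Fin n → ℤ) :
    HasDiag (rightCoset (glZ p n) (d * scalarP p n)) a ↔
      HasDiag (rightCoset (glZ p n) d) (a - 1) := by
  have hv : ∀ e : GL (Fin n) ℚ_[p], ∀ i j, (e * scalarP p n).1 i j = (p : ℚ_[p]) * e.1 i j := by
    intro e i j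
    rw [Units.val_mul, scalarP_val, Matrix.mul_smul, mul_one, Matrix.smul_apply, smul_eq_mul]
  constructor
  · rintro ⟨e, he, ht, hd⟩
    have hv' : ∀ i j, e.1 i j = (p : ℚ_[p]) * (e * (scalarP p n)⁻¹).1 i j := by
      intro i j; rw [← hv, inv_mul_cancel_right]
    refine ⟨e * (scalarP p n)⁻¹, ?_, fun i j hij => ?_, fun i => ?_⟩
    · rw [rightCoset_eq] at he ⊢
      rw [mul_inv_rev, inv_inv, ← mul_assoc]
      exact he
    · have := ht i j hij
      rw [hv'] at this
      exact (mul_eq_zero.1 this).resolve_left p_ne_zero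
    · have := hd i
      rw [hv'] at this
      rw [Pi.sub_apply, Pi.one_apply, zpow_sub_one₀ p_ne_zero, ← this, mul_comm,
        inv_mul_cancel_left₀ p_ne_zero]
  · rintro ⟨e, he, ht, hd⟩
    refine ⟨e * scalarP p n, ?_, fun i j hij => ?_, fun i => ?_⟩
    · rw [rightCoset_eq] at he ⊢
      simpa [mul_assoc] using he
    · rw [hv, ht i j hij, mul_zero]
    · rw [hv, hd, Pi.sub_apply, Pi.one_apply, zpow_sub_one₀ p_ne_zero, mul_comm, mul_assoc,
        inv_mul_cancel₀ p_ne_zero, mul_one]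

theorem monCoeff_mul_frob (a : Fin n → ℤ) (g : siegelP p n)
    {S : Matrix (Fin n) (Fin n) ℚ_[p]} (hS : Sᵀ = S) :
    monCoeff a (g * (frobElt p n * siegelN S hS)) = wt p (1 : Fin n → ℤ) * monCoeff (a - 1) g := by
  have hl : levi (g * (frobElt p n * siegelN S hS)) = levi g * scalarP p n := by
    rw [map_mul, map_mul, levi_frob]
    have : levi (siegelN S hS) = 1 := Units.ext (blkD_siegelN hS)
    rw [this, mul_one]
  unfold monCoeff
  rw [hl]
  split_ifs with h h' h'
  · rw [← wt_add]; congr 1; abel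
  · exact absurd ((hasDiag_mul_scalarP _ _).1 h) h'
  · exact absurd ((hasDiag_mul_scalarP _ _).2 h') h
  · rw [mul_zero]

/-- The sum over the cosets of `T h`, weighted by a left invariant function. -/
theorem cosetSum_mul (μ : siegelP p n → ℂ) (hμ : ∀ k ∈ levelD0 p n L, ∀ g, μ (k * g) = μ g)
    (T U : HeckeS0 p n L) :
    HeckeAlg.cosetSum (levelD0 p n L) (fun g => μ g * (T * U) g) =
      HeckeAlg.cosetSum (levelD0 p n L) (fun h => U h *
        HeckeAlg.cosetSum (levelD0 p n L) fun g => μ (g * h) * T g) := by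
  have step : ∀ h : siegelP p n, HeckeAlg.cosetSum (levelD0 p n L) (fun g => μ (g * h) * T g) =
      HeckeAlg.cosetSum (levelD0 p n L) fun g => μ g * T (g * h⁻¹) := by
    intro h
    rw [← HeckeAlg.cosetSum_translate (φ := fun g => μ g * T (g * h⁻¹)) (fun k hk g => by
      rw [hμ k hk, mul_assoc, left_inv T hk]) h]
    simp only [mul_inv_cancel_right]
  simp only [step]
  let A : Set (RightCosets (levelD0 p n L)) := rightCoset _ '' Function.support U
  have hA : A.Finite := U.finite_supp
  have hA' : ∀ c : RightCosets (levelD0 p n L), U c.out ≠ 0 → c ∈ A :=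
    fun c hc => ⟨_, hc, Quotient.out_eq c⟩
  let B : Set (RightCosets (levelD0 p n L)) := ⋃ c ∈ A,
    (fun d : RightCosets (levelD0 p n L) => rightCoset _ (d.out * c.out)) ''
      (rightCoset _ '' Function.support T)
  have hB : B.Finite := hA.biUnion fun c _ => T.finite_supp.image _
  have hB' : ∀ c d : RightCosets (levelD0 p n L), U c.out ≠ 0 → T (d.out * c.out⁻¹) ≠ 0 →
      d ∈ B := by
    intro c d hc hd
    refine Set.mem_biUnion (hA' c hc) ⟨rightCoset _ (d.out * c.out⁻¹), ⟨_, hd, rfl⟩, ?_⟩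
    obtain ⟨k, hk, h⟩ := out_spec (levelD0 p n L) (d.out * c.out⁻¹)
    simp only [h]
    conv_rhs => rw [← Quotient.out_eq d]
    rw [eq_comm, rightCoset_eq]
    simpa [mul_assoc] using hk
  simp only [HeckeAlg.mul_apply]
  unfold HeckeAlg.cosetSum
  have l1 : ∀ c : RightCosets (levelD0 p n L),
      μ c.out * ∑ᶠ d : RightCosets (levelD0 p n L), T (c.out * d.out⁻¹) * U d.out =
      ∑ d ∈ hA.toFinset, μ c.out * (T (c.out * d.out⁻¹) * U d.out) := by
    intro c
    rw [finsum_eq_sum_of_support_subset (s := hA.toFinset), Finset.mul_sum]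
    intro d hd
    simpa using hA' d (right_ne_zero_of_mul hd)
  have l2 : ∀ d : RightCosets (levelD0 p n L),
      U d.out * ∑ᶠ c : RightCosets (levelD0 p n L), μ c.out * T (c.out * d.out⁻¹) =
      ∑ c ∈ hB.toFinset, μ c.out * (T (c.out * d.out⁻¹) * U d.out) := by
    intro d
    by_cases hd : U d.out = 0
    · simp [hd]
    · rw [finsum_eq_sum_of_support_subset (s := hB.toFinset), Finset.mul_sum]
      · exact Finset.sum_congr rfl fun _ _ => by ring
      · intro c hc
        simpa using hB' d c hd (right_ne_zero_of_mul hc)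
  simp only [l1, l2]
  rw [finsum_eq_sum_of_support_subset (s := hB.toFinset),
    finsum_eq_sum_of_support_subset (s := hA.toFinset), Finset.sum_comm]
  · intro d hd
    obtain ⟨c, -, hc⟩ := Finset.exists_ne_zero_of_sum_ne_zero hd
    simpa using hA' d (right_ne_zero_of_mul (right_ne_zero_of_mul hc))
  · intro c hc
    obtain ⟨d, -, hd⟩ := Finset.exists_ne_zero_of_sum_ne_zero hc
    simpa using hB' d c (right_ne_zero_of_mul (right_ne_zero_of_mul hd))
      (left_ne_zero_of_mul (right_ne_zero_of_mul hd))

theorem norm_sub_nat_le {a b : ℕ} (ha : a < p ^ 2) (hb : b < p ^ 2)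
    (h : ‖(p : ℚ_[p]) ^ (-2 : ℤ) * ((a : ℚ_[p]) - b)‖ ≤ 1) : a = b := by
  have h1 : ‖(((a : ℤ) - b : ℤ) : ℚ_[p])‖ ≤ (p : ℝ) ^ (-(2 : ℕ) : ℤ) := by
    rw [norm_mul, Padic.norm_p_zpow] at h
    have hpr : (0 : ℝ) < p := by exact_mod_cast (Fact.out : p.Prime).pos
    rw [neg_neg] at h
    push_cast
    rw [zpow_neg, ← one_div, le_div_iff₀ (by positivity), mul_comm]
    exact h
  rw [Padic.norm_int_le_pow_iff_dvd] at h1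
  have h2 : (a : ℤ) ≡ b [ZMOD (p : ℤ) ^ 2] := (Int.modEq_iff_dvd.2 (by
    rw [← neg_sub]; exact (dvd_neg.2 (by exact_mod_cast h1)))).symm.symm
  have h3 : a ≡ b [MOD p ^ 2] := by
    rw [← Int.natCast_modEq_iff]; exact_mod_cast h2
  exact Nat.ModEq.eq_of_lt_of_lt h3 ha hb

theorem frob_conj_siegelN {S S' : Matrix (Fin n) (Fin n) ℚ_[p]} (hS : Sᵀ = S) (hS' : S'ᵀ = S') :
    frobElt p n * siegelN S hS * (frobElt p n * siegelN S' hS')⁻¹ =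
      siegelN ((p : ℚ_[p]) ^ (-2 : ℤ) • (S - S'))
        (by rw [Matrix.transpose_smul, Matrix.transpose_sub, hS, hS']) := by
  rw [mul_inv_eq_iff_eq_mul]
  have hp2 : (p : ℚ_[p]) ^ (-2 : ℤ) * p = (p : ℚ_[p])⁻¹ := by
    rw [zpow_neg]; field_simp [p_ne_zero (p := p)]
  refine siegelP_ext ?_ ?_ ?_
  · rw [blkA_mulP, blkA_mulP, blkA_mulP, blkA_siegelN, blkA_siegelN, blkA_siegelN, one_mul]
  · rw [blkB_mulP, blkB_mulP, blkB_mulP, blkA_siegelN, blkB_siegelN, blkB_siegelN, blkB_siegelN,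
      blkD_mulP, blkD_siegelN, blkD_siegelN, blkB_frob, blkA_frob, blkD_frob]
    simp only [mul_one, add_zero, one_mul, Matrix.smul_mul, Matrix.mul_smul, smul_smul,
      smul_sub]
    rw [mul_comm (p : ℚ_[p]), hp2]
    abel
  · rw [blkD_mulP, blkD_mulP, blkD_mulP, blkD_siegelN, blkD_siegelN, blkD_siegelN, one_mul]

/-- The degree of `U_p` is `p^{n(n+1)}`. -/
theorem cosetSum_frobU (hp : ¬ p ∣ L.c) :
    HeckeAlg.cosetSum (levelD0 p n L) (frobU p n L) = (p : ℂ) ^ (n * (n + 1)) := by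
  let S : (Sym2 (Fin n) → Fin (p ^ 2)) → Matrix (Fin n) (Fin n) ℚ_[p] := fun f i j =>
    ((f s(i, j) : ℕ) : ℚ_[p])
  have hS : ∀ f, (S f)ᵀ = S f := fun f => by
    ext i j
    change ((f s(j, i) : ℕ) : ℚ_[p]) = ((f s(i, j) : ℕ) : ℚ_[p])
    rw [Sym2.eq_swap]
  have hSi : ∀ f, Integral (S f) := fun f i j => by
    exact_mod_cast Padic.norm_int_le_one (p := p) ((f s(i, j) : ℕ) : ℤ)
  let β : (Sym2 (Fin n) → Fin (p ^ 2)) → RightCosets (levelD0 p n L) := fun f =>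
    rightCoset _ (frobElt p n * siegelN (S f) (hS f))
  have hβ : Function.Injective β := by
    intro f f' h
    have h1 := rightCoset_eq.1 h
    rw [frob_conj_siegelN, mem_levelD0 hp, integral_iff_blk, blkB_siegelN] at h1
    funext z
    induction z using Sym2.ind with
    | _ i j =>
      have h2 := h1.2.1 i j
      exact (Fin.ext (norm_sub_nat_le (f' s(i, j)).2 (f s(i, j)).2 h2)).symm
  have hsurj : ∀ c : RightCosets (levelD0 p n L), frobU p n L c.out ≠ 0 → c ∈ Set.range β := by
    intro c hc
    obtain ⟨k, hk, S', hS', hSi', h⟩ := exists_of_frobU_ne_zero hp hc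
    let f : Sym2 (Fin n) → Fin (p ^ 2) := Sym2.lift ⟨fun i j =>
      ⟨PadicInt.appr ⟨S' i j, hSi' i j⟩ 2, PadicInt.appr_lt _ _⟩, fun i j => by
        have : S' i j = S' j i := congrFun (congrFun hS' j) i
        simp only [this]⟩
    refine ⟨f, ?_⟩
    rw [← Quotient.out_eq c, h]
    refine rightCoset_eq.2 ?_
    rw [mul_assoc, frob_conj_siegelN]
    refine mul_mem hk (siegelN_mem hp _ fun i j => ?_)
    have h1 := PadicInt.appr_spec 2 (⟨S' i j, hSi' i j⟩ : ℤ_[p])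
    rw [← PadicInt.norm_le_pow_iff_mem_span_pow] at h1
    have h2 : ‖S' i j - S f i j‖ ≤ (p : ℝ) ^ (-(2 : ℕ) : ℤ) := h1
    have hpr : (0 : ℝ) < p := by exact_mod_cast (Fact.out : p.Prime).pos
    rw [Matrix.smul_apply, Matrix.sub_apply, smul_eq_mul, norm_mul, Padic.norm_p_zpow]
    calc _ ≤ (p : ℝ) ^ (-(-2) : ℤ) * (p : ℝ) ^ (-(2 : ℕ) : ℤ) := by gcongr
      _ = 1 := by rw [← zpow_add₀ hpr.ne']; simp
  have hval : ∀ f, frobU p n L (β f).out = 1 := fun f => by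
    rw [HeckeAlg.inv_out (φ := frobU p n L) (fun k hk g => left_inv _ hk g)]
    exact frobU_apply_of hp _ (hSi f)
  unfold HeckeAlg.cosetSum
  have h1 : (∑ᶠ c : RightCosets (levelD0 p n L), frobU p n L c.out) =
      ∑ᶠ (c : RightCosets (levelD0 p n L)) (_ : c ∈ Set.range β), frobU p n L c.out := by
    rw [finsum_mem_def]
    refine finsum_congr fun c => ?_
    by_cases hc : c ∈ Set.range β
    · rw [Set.indicator_of_mem hc]
    · rw [Set.indicator_of_notMem hc]
      by_contra hne
      exact hc (hsurj c hne)
  rw [h1, finsum_mem_range hβ, finsum_eq_sum_of_fintype]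
  simp only [hval, Finset.sum_const, Finset.card_univ, Fintype.card_fun, Fintype.card_fin,
    Sym2.card, nsmul_eq_mul, mul_one]
  push_cast
  rw [← pow_mul, Nat.choose_two_right, Nat.add_sub_cancel, mul_comm (n + 1),
    Nat.mul_div_cancel' (Nat.even_mul_succ_self n).two_dvd]

/-- `ω'(T U_p) = p^{n(n+1)} ∏ p^{-i} x_i · ω'(T)`, on coefficients. -/
theorem coeff_omegaS_mul_frobU (hp : ¬ p ∣ L.c) (T : HeckeS0 p n L) (a : Fin n → ℤ) :
    (omegaS p n L (T * frobU p n L)).coeff a =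
      (p : ℂ) ^ (n * (n + 1)) * wt p (1 : Fin n → ℤ) * (omegaS p n L T).coeff (a - 1) := by
  rw [coeff_omegaS, cosetSum_mul _ (fun k hk g => monCoeff_left hp hk g), coeff_omegaS,
    ← cosetSum_frobU (L := L) hp, mul_assoc, ← HeckeAlg.cosetSum_const_mul, mul_comm,
    ← HeckeAlg.cosetSum_const_mul]
  congr 1
  funext h
  by_cases hU : frobU p n L h = 0
  · rw [hU, zero_mul, mul_zero]
  · rw [mul_comm]
    congr 1
    obtain ⟨k, hk, S, hS, -, rfl⟩ := exists_of_frobU_ne_zero hp hU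
    rw [← HeckeAlg.cosetSum_translate (K := levelD0 p n L)
      (φ := fun g => wt p (1 : Fin n → ℤ) * (monCoeff (a - 1) g * T g)) (fun k' hk' g => by
        rw [monCoeff_left hp hk', left_inv T hk']) k]
    congr 1
    funext g
    rw [← mul_assoc g k, monCoeff_mul_frob, right_inv T hk, mul_assoc]

end Coefficients

section Vanishing

variable {p : ℕ} [Fact p.Prime] {n : ℕ} {L : Level}

theorem siegelDiag_one : siegelDiag (1 : GL (Fin n) ℚ_[p]) = 1 := by
  have := siegelDiag_mul (1 : GL (Fin n) ℚ_[p]) 1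
  rw [mul_one] at this
  exact mul_eq_left.1 this.symm

theorem siegelDiag_pow (d : GL (Fin n) ℚ_[p]) (k : ℕ) : siegelDiag (d ^ k) = siegelDiag d ^ k := by
  induction k with
  | zero => rw [pow_zero, pow_zero, siegelDiag_one]
  | succ k ih => rw [pow_succ, pow_succ, siegelDiag_mul, ih]

theorem hasDiag_of_tri {d : GL (Fin n) ℚ_[p]} {a : Fin n → ℤ} (ht : ∀ i j, j < i → d.1 i j = 0)
    (hd : ∀ i, d.1 i i = (p : ℚ_[p]) ^ a i) : HasDiag (rightCoset (glZ p n) d) a :=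
  ⟨d, rfl, ht, hd⟩

theorem hasDiag_diagP (a : Fin n → ℤ) : HasDiag (rightCoset (glZ p n) (diagP p a)) a := by
  refine hasDiag_of_tri (fun i j h => ?_) fun i => ?_
  · rw [diagP_val, Matrix.diagonal_apply_ne _ h.ne']
  · rw [diagP_val, Matrix.diagonal_apply_eq]

theorem finite_exponents (hp : ¬ p ∣ L.c) (X : HeckeS0 p n L) :
    {a : Fin n → ℤ | X (siegelDiag (diagP p a)) ≠ 0}.Finite := by
  refine Set.Finite.of_finite_image (f := fun a => rightCoset (levelD0 p n L)
    (siegelDiag (diagP p a))) (X.finite_supp.subset ?_) ?_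
  · rintro _ ⟨a, ha, rfl⟩
    exact ⟨_, ha, rfl⟩
  · intro a _ a' _ h
    have h1 := levi_mem hp (rightCoset_eq.1 h)
    rw [map_mul, map_inv, levi_siegelDiag, levi_siegelDiag] at h1
    have h2 := hasDiag_diagP (p := p) a
    rw [rightCoset_eq.2 h1] at h2
    exact hasDiag_unique h2 (hasDiag_diagP a')

/-- If all the cosets contributing to the coefficient of `x^a` have the same weight as the coset of
`diag[p^{-a}, p^a]`, then this coefficient does not vanish. -/
theorem coeff_omegaS_ne_zero (hp : ¬ p ∣ L.c) (X : HeckeS0 p n L) {a : Fin n → ℤ}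
    (h0 : X (siegelDiag (diagP p a)) ≠ 0)
    (h : ∀ g, X g ≠ 0 → (∀ i j, j < i → (levi g).1 i j = 0) →
      (∀ i, (levi g).1 i i = (p : ℚ_[p]) ^ a i) → X g = X (siegelDiag (diagP p a))) :
    (omegaS p n L X).coeff a ≠ 0 := by
  have hinv : ∀ k ∈ levelD0 p n L, ∀ g, monCoeff a (k * g) * X (k * g) = monCoeff a g * X g :=
    fun k hk g => by rw [monCoeff_left hp hk, left_inv X hk]
  rw [coeff_omegaS]
  unfold HeckeAlg.cosetSum
  have hfin := HeckeAlg.finite_support_out (F := X) (φ := fun g => monCoeff a g * X g)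
    fun g => right_ne_zero_of_mul
  have hval : ∀ c ∈ hfin.toFinset, monCoeff a c.out * X c.out =
      wt p a * X (siegelDiag (diagP p a)) := by
    intro c hc
    rw [Set.Finite.mem_toFinset, Function.mem_support] at hc
    have hm := left_ne_zero_of_mul hc
    have hX := right_ne_zero_of_mul hc
    unfold monCoeff at hm ⊢
    split_ifs at hm ⊢ with hd
    · obtain ⟨d, hd, ht, hdiag⟩ := hd
      have hu := rightCoset_eq.1 hd.symm
      have hl : levi (siegelDiag (d * (levi c.out)⁻¹) * c.out) = d := by
        rw [map_mul, levi_siegelDiag, inv_mul_cancel_right]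
      have hXe := left_inv X (siegelDiag_mem hp hu) c.out
      rw [← hXe, h _ (by rwa [hXe]) (by rwa [hl]) (by rwa [hl])]
    · exact absurd rfl hm
  rw [finsum_eq_sum_of_support_subset (s := hfin.toFinset) _ (by simp), Finset.sum_congr rfl hval,
    Finset.sum_const, nsmul_eq_mul]
  refine mul_ne_zero (Nat.cast_ne_zero.2 (Finset.card_ne_zero.2
    ⟨rightCoset _ (siegelDiag (diagP p a)), ?_⟩)) (mul_ne_zero (wt_ne_zero a) h0)
  rw [Set.Finite.mem_toFinset, Function.mem_support,
    HeckeAlg.inv_out (φ := fun g => monCoeff a g * X g) hinv]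
  refine mul_ne_zero ?_ h0
  unfold monCoeff
  rw [levi_siegelDiag, if_pos (hasDiag_diagP a)]
  exact wt_ne_zero a

/-- The Satake map is injective on the elements supported on double cosets of block diagonal
matrices. -/
theorem eq_zero_of_omegaS_eq_zero (hp : ¬ p ∣ L.c) {X : HeckeS0 p n L}
    (hX : ∀ x, X x ≠ 0 → ∃ d, ∃ κ ∈ levelD0 p n L, x = siegelDiag d * κ)
    (h : omegaS p n L X = 0) : X = 0 := by
  by_contra hne
  obtain ⟨x, hx⟩ : ∃ x, X x ≠ 0 := by
    by_contra! hcon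
    exact hne (HeckeAlg.ext hcon)
  have hQ : ∀ d u v, u ∈ glZ p n → v ∈ glZ p n →
      X (siegelDiag (u * d * v)) = X (siegelDiag d) := by
    intro d u v hu hv
    rw [siegelDiag_mul, siegelDiag_mul, right_inv X (siegelDiag_mem hp hv),
      left_inv X (siegelDiag_mem hp hu)]
  have hiso : ∀ d : GL (Fin n) ℚ_[p], ∀ i : Fin n, n ≤ i → IsolatedGL d i :=
    fun d i hi => absurd i.2 hi.not_gt
  obtain ⟨a, ha, hmin⟩ : ∃ a ∈ {a : Fin n → ℤ | X (siegelDiag (diagP p a)) ≠ 0},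
      ∀ a' ∈ {a : Fin n → ℤ | X (siegelDiag (diagP p a)) ≠ 0}, ∀ j,
        (∀ i, j < i → a' i = a i) → a j ≤ a' j := by
    refine exists_lex_min (finite_exponents hp X) ?_
    obtain ⟨d, κ, hκ, rfl⟩ := hX x hx
    rw [right_inv X hκ] at hx
    obtain ⟨u, hu, v, hv, a, h, -⟩ := exists_smith n le_rfl d (hiso d)
    refine ⟨a, ?_⟩
    rw [Set.mem_ofPred_eq, h, hQ _ _ _ hu hv]
    exact hx
  refine coeff_omegaS_ne_zero hp X ha ?_ (by rw [h]; rfl)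
  intro g hg ht hd
  obtain ⟨d, κ, hκ, rfl⟩ := hX g hg
  have hl : siegelDiag d * κ =
      siegelDiag (levi (siegelDiag d * κ)) * (siegelDiag (levi κ)⁻¹ * κ) := by
    rw [map_mul, levi_siegelDiag, siegelDiag_mul, mul_assoc, ← mul_assoc (siegelDiag (levi κ)),
      ← siegelDiag_mul, mul_inv_cancel]
    congr 1
    rw [siegelDiag_one, one_mul]
  have hm : siegelDiag (levi κ)⁻¹ * κ ∈ levelD0 p n L :=
    mul_mem (siegelDiag_mem hp (inv_mem (levi_mem hp hκ))) hκ
  rw [hl, right_inv X hm] at hg ⊢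
  generalize levi (siegelDiag d * κ) = e at *
  obtain ⟨u, hu, he⟩ := exists_eq_diagP (Q := fun d => X (siegelDiag d) ≠ 0)
    (fun d u v hu hv hd => by rw [hQ _ _ _ hu hv]; exact hd) (a := a) (fun a' ha' => hmin a' ha')
    n le_rfl e hg ht (fun i => by rw [hd]) (hiso e)
  rw [← he, siegelDiag_mul, left_inv X (siegelDiag_mem hp hu)]

/-- A lower bound for the exponents of `x_n` in `ω_p(F)` bounds the denominators of the support
of `ε(F)`. -/
theorem norm_le_of_eps_ne_zero (hp : ¬ p ∣ L.c) (F : HeckeR p n L) {b : ℤ}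
    (hF : ∀ a : Fin n → ℤ, (omegaR p n L F).coeff a ≠ 0 → ∀ i, b ≤ a i) {g : siegelP p n}
    (hg : eps p n L F g ≠ 0) (r s : Fin n ⊕ Fin n) : ‖g.1.1 r s‖ ≤ ‖(p : ℚ_[p]) ^ b‖ := by
  have hQ : ∀ (g g' : siegelP p n) (k₁ k₂ : Sp p n), Integral k₁.1 → Integral k₂.1 →
      g'.1 = k₁ * g.1 * k₂ → eps p n L F g ≠ 0 → eps p n L F g' ≠ 0 :=
    fun g g' k₁ k₂ h₁ h₂ h hg =>
      heckeR_ne_zero hp F ((mem_levelD hp).2 h₁) ((mem_levelD hp).2 h₂) h hg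
  have hiso : ∀ x : Sp p n, ∀ i : Fin n, n ≤ i → Isolated x i :=
    fun d i hi => absurd i.2 hi.not_gt
  obtain ⟨k₁, k₂, hk₁, hk₂, a', ha', -, hmax⟩ := exists_cartan n le_rfl g.1 (hiso _)
  have hQa' : eps p n L F (siegelDiag (diagP p a')) ≠ 0 := hQ g _ k₁ k₂ hk₁ hk₂ ha' hg
  obtain ⟨a, ha, hmin⟩ := exists_lex_min (finite_exponents hp (eps p n L F)) ⟨a', hQa'⟩
  let J : Fin n := ⟨n - 1, by have := (ht r).2; omega⟩
  have hJ : ∀ i, i ≤ J := fun i => by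
    have := i.2
    exact Fin.mk_le_mk.2 (show (i : ℕ) ≤ n - 1 by omega)
  have hJ1 : (J : ℕ) + 1 = n := by
    have := (ht r).2
    change n - 1 + 1 = n
    omega
  have h1 : a J ≤ a' J := hmin a' hQa' J fun i hi => absurd (hJ i) (not_le.2 hi)
  refine (hmax J hJ1 r s (hJ _) (hJ _)).trans (norm_p_zpow_le_iff.2 (le_trans (hF a ?_ J) h1))
  refine coeff_omegaS_ne_zero hp (eps p n L F) ha ?_
  intro x hx ht hd
  obtain ⟨κ, hκ, he⟩ := exists_eq_siegelDiag hQ (fun a' ha' => hmin a' ha') n le_rfl x hx ht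
    (fun i => by rw [← hd i]; rfl) (hiso _)
  rw [← he, left_inv _ ((mem_levelD0 hp).2 hκ)]

theorem siegelN_congr {S S' : Matrix (Fin n) (Fin n) ℚ_[p]} {hS : Sᵀ = S} {hS' : S'ᵀ = S'}
    (h : S = S') : siegelN S hS = siegelN S' hS' := by subst h; rfl

theorem siegelN_mul_frob {S : Matrix (Fin n) (Fin n) ℚ_[p]} (hS : Sᵀ = S) :
    siegelN S hS * frobElt p n = frobElt p n * siegelN ((p : ℚ_[p]) ^ 2 • S)
      (by rw [Matrix.transpose_smul, hS]) := by
  refine siegelP_ext ?_ ?_ ?_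
  · rw [blkA_mulP, blkA_mulP, blkA_siegelN, blkA_siegelN, one_mul, mul_one]
  · rw [blkB_mulP, blkB_mulP, blkA_siegelN, blkB_siegelN, blkB_siegelN, blkD_siegelN, blkB_frob,
      blkA_frob, blkD_frob]
    simp only [mul_zero, add_zero, zero_add, Matrix.mul_smul, mul_one, Matrix.smul_mul,
      one_mul, smul_smul]
    congr 1
    field_simp [p_ne_zero (p := p)]
  · rw [blkD_mulP, blkD_mulP, blkD_siegelN, blkD_siegelN, one_mul, mul_one]

theorem siegelDiag_mul_frob (d : GL (Fin n) ℚ_[p]) :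
    siegelDiag d * frobElt p n = frobElt p n * siegelDiag d := by
  unfold frobElt
  rw [← siegelDiag_mul, ← siegelDiag_mul, scalarP_comm]

theorem siegelN_mul_frob_pow {S : Matrix (Fin n) (Fin n) ℚ_[p]} (hS : Sᵀ = S) (k : ℕ) :
    siegelN S hS * frobElt p n ^ k = frobElt p n ^ k * siegelN ((p : ℚ_[p]) ^ (2 * k) • S)
      (by rw [Matrix.transpose_smul, hS]) := by
  induction k with
  | zero =>
    rw [pow_zero, mul_one, one_mul]
    exact siegelN_congr (by rw [mul_zero, pow_zero, one_smul])
  | succ k ih =>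
    rw [pow_succ, ← mul_assoc, ih, mul_assoc, siegelN_mul_frob, ← mul_assoc]
    congr 1
    exact siegelN_congr (by rw [smul_smul, ← pow_add]; congr 2; ring)

theorem integral_smul_pow (k : ℕ) {S : Matrix (Fin n) (Fin n) ℚ_[p]} (hS : Integral S) :
    Integral ((p : ℚ_[p]) ^ k • S) := fun i j => by
  rw [Matrix.smul_apply, smul_eq_mul, norm_mul]
  refine mul_le_one₀ ?_ (norm_nonneg _) (hS i j)
  rw [norm_pow]
  exact pow_le_one₀ (norm_nonneg _) Padic.norm_p_lt_one.le

theorem mem_mul_frob_pow (hp : ¬ p ∣ L.c) {κ : siegelP p n} (hκ : κ ∈ levelD0 p n L) (k : ℕ) :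
    ∃ κ' ∈ levelD0 p n L, κ * frobElt p n ^ k = frobElt p n ^ k * κ' := by
  obtain ⟨-, hb, -, hd⟩ := integral_iff_blk.1 ((mem_levelD0 hp).1 hκ)
  have hc : Commute (siegelDiag (levi κ)) (frobElt p n) := siegelDiag_mul_frob _
  refine ⟨siegelDiag (levi κ) * siegelN _ (by rw [Matrix.transpose_smul,
    siegelP_transpose_D_mul_B]), mul_mem (siegelDiag_mem hp (levi_mem hp hκ)) (siegelN_mem hp _
    (integral_smul_pow (2 * k) (hd.transpose.mul hb))), ?_⟩
  conv_lhs => rw [siegelP_eq κ]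
  rw [mul_assoc, siegelN_mul_frob_pow, ← mul_assoc, (hc.pow_right k).eq, mul_assoc]

theorem exists_of_mul_apply_ne_zero {X Y : HeckeS0 p n L} {x : siegelP p n} (h : (X * Y) x ≠ 0) :
    ∃ y, X (x * y⁻¹) ≠ 0 ∧ Y y ≠ 0 := by
  rw [HeckeAlg.mul_apply] at h
  obtain ⟨c, hc⟩ : ∃ c : RightCosets (levelD0 p n L), X (x * c.out⁻¹) * Y c.out ≠ 0 := by
    by_contra! hcon
    exact h (by unfold HeckeAlg.cosetSum; simp [hcon])
  exact ⟨_, left_ne_zero_of_mul hc, right_ne_zero_of_mul hc⟩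

theorem exists_of_frobU_pow_ne_zero (hp : ¬ p ∣ L.c) {k : ℕ} {x : siegelP p n}
    (h : (frobU p n L ^ k) x ≠ 0) : ∃ κ₁ ∈ levelD0 p n L, ∃ κ₂ ∈ levelD0 p n L,
      x = κ₁ * frobElt p n ^ k * κ₂ := by
  induction k generalizing x with
  | zero =>
    refine ⟨1, one_mem _, x, ?_, by simp⟩
    by_contra hx
    exact h (by rw [pow_zero]; exact HeckeAlg.one_apply_of_notMem hx)
  | succ k ih =>
    rw [pow_succ] at h
    obtain ⟨y, h1, h2⟩ := exists_of_mul_apply_ne_zero h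
    obtain ⟨κ₁, hκ₁, κ₂, hκ₂, e⟩ := ih h1
    obtain ⟨κ₃, hκ₃, S, hS, hSi, rfl⟩ := exists_of_frobU_ne_zero hp h2
    obtain ⟨κ, hκ, e'⟩ := mem_mul_frob_pow hp (mul_mem hκ₂ hκ₃) 1
    rw [pow_one] at e'
    refine ⟨κ₁, hκ₁, κ * siegelN S hS, mul_mem hκ (siegelN_mem hp hS hSi), ?_⟩
    rw [mul_inv_eq_iff_eq_mul] at e
    rw [e, pow_succ, mul_assoc _ κ₂, ← mul_assoc κ₂, ← mul_assoc (κ₂ * κ₃), e']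
    simp only [mul_assoc]

/-- Multiplying by a large power of `U_p` makes the support block diagonal. -/
theorem exists_of_mul_frobU_pow_ne_zero (hp : ¬ p ∣ L.c) {X : HeckeS0 p n L} {k : ℕ}
    (hX : ∀ g, X g ≠ 0 → ∀ r s, ‖g.1.1 r s‖ ≤ ‖(p : ℚ_[p]) ^ (-k : ℤ)‖) {x : siegelP p n}
    (h : (X * frobU p n L ^ k) x ≠ 0) : ∃ d, ∃ κ ∈ levelD0 p n L, x = siegelDiag d * κ := by
  obtain ⟨y, h1, h2⟩ := exists_of_mul_apply_ne_zero h
  obtain ⟨κ₁, hκ₁, κ₂, hκ₂, e⟩ := exists_of_frobU_pow_ne_zero hp h2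
  obtain ⟨z, hz⟩ : ∃ z, z = x * y⁻¹ * κ₁ := ⟨_, rfl⟩
  have hzX : X z ≠ 0 := by rw [hz, right_inv X hκ₁]; exact h1
  have hx : x = z * (frobElt p n ^ k * κ₂) := by
    rw [hz, mul_assoc (x * y⁻¹), ← mul_assoc κ₁, ← e, inv_mul_cancel_right]
  have hsc : ∀ m : Matrix (Fin n) (Fin n) ℚ_[p], (∀ i j, ‖m i j‖ ≤ ‖(p : ℚ_[p]) ^ (-k : ℤ)‖) →
      Integral ((p : ℚ_[p]) ^ k • m) := fun m hm i j => by
    rw [Matrix.smul_apply, smul_eq_mul, norm_mul]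
    calc _ ≤ ‖(p : ℚ_[p]) ^ k‖ * ‖(p : ℚ_[p]) ^ (-k : ℤ)‖ := by gcongr; exact hm i j
      _ = 1 := by
        rw [← norm_mul, zpow_neg, zpow_natCast, mul_inv_cancel₀ (pow_ne_zero _ p_ne_zero), norm_one]
  have hint : Integral ((p : ℚ_[p]) ^ (2 * k) • ((blkD z.1)ᵀ * blkB z.1)) := by
    have e2 : (p : ℚ_[p]) ^ (2 * k) • ((blkD z.1)ᵀ * blkB z.1) =
        ((p : ℚ_[p]) ^ k • blkD z.1)ᵀ * ((p : ℚ_[p]) ^ k • blkB z.1) := by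
      rw [Matrix.transpose_smul, Matrix.smul_mul, Matrix.mul_smul, smul_smul, ← pow_add, two_mul]
    rw [e2]
    exact (hsc _ fun i j => hX z hzX _ _).transpose.mul (hsc _ fun i j => hX z hzX _ _)
  refine ⟨levi z * scalarP p n ^ k, siegelN _ (by rw [Matrix.transpose_smul,
    siegelP_transpose_D_mul_B]) * κ₂, mul_mem (siegelN_mem hp _ hint) hκ₂, ?_⟩
  rw [hx, siegelDiag_mul, siegelDiag_pow]
  conv_lhs => rw [siegelP_eq z]
  rw [← mul_assoc, mul_assoc (siegelDiag _), siegelN_mul_frob_pow]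
  simp only [mul_assoc, frobElt]

end Vanishing

section Telescope

open Polynomial

variable {A : Type*} [Ring A] (t : ℕ → A) (U : A)

theorem sum_mul_pow_succ (m : ℕ) :
    ∑ l ∈ Finset.range (m + 1 + 1), t l * U ^ (m + 1 - l) =
      (∑ l ∈ Finset.range (m + 1), t l * U ^ (m - l)) * U + t (m + 1) := by
  rw [Finset.sum_range_succ, Nat.sub_self, pow_zero, mul_one, Finset.sum_mul]
  congr 1
  refine Finset.sum_congr rfl fun l hl => ?_
  rw [Nat.succ_sub (Nat.lt_succ_iff.1 (Finset.mem_range.1 hl)), pow_succ, mul_assoc]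

theorem sum_mul_one_sub (M : ℕ) :
    (∑ m ∈ Finset.range (M + 1), C (∑ l ∈ Finset.range (m + 1), t l * U ^ (m - l)) * X ^ m) *
        (1 - C U * X) =
      (∑ m ∈ Finset.range (M + 1), C (t m) * X ^ m) -
        C ((∑ l ∈ Finset.range (M + 1), t l * U ^ (M - l)) * U) * X ^ (M + 1) := by
  have h : ∀ (v : A) (m : ℕ), C v * X ^ m * (1 - C U * X) =
      C v * X ^ m - C (v * U) * X ^ (m + 1) := by
    intro v m
    rw [mul_sub, mul_one, C_mul, pow_succ, mul_assoc (C v), ← mul_assoc (X ^ m), X_pow_mul_C]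
    simp only [mul_assoc]
  induction M with
  | zero => simp [mul_sub, mul_assoc]
  | succ M ih =>
    rw [Finset.sum_range_succ, add_mul, ih, h, sum_mul_pow_succ,
      Finset.sum_range_succ (fun m => C (t m) * X ^ m) (M + 1), C_add, add_mul]
    abel

/-- Division by `1 - U z`, if the remainder vanishes. -/
theorem eq_sum_mul_one_sub (N : ℕ) (hN : 1 ≤ N)
    (h : ∑ l ∈ Finset.range (N + 1), t l * U ^ (N - l) = 0) :
    ∑ m ∈ Finset.range (N + 1), C (t m) * X ^ m =
      (∑ m ∈ Finset.range N, C (∑ l ∈ Finset.range (m + 1), t l * U ^ (m - l)) * X ^ m) *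
        (1 - C U * X) := by
  obtain ⟨M, rfl⟩ := Nat.exists_eq_add_of_le' hN
  rw [sum_mul_pow_succ] at h
  rw [sum_mul_one_sub, Finset.sum_range_succ, eq_neg_of_add_eq_zero_left h, C_neg, neg_mul,
    sub_neg_eq_add]

end Telescope

section LaurentPolynomials

open Polynomial

variable {p n : ℕ} {L : Level}

theorem coeff_mul_monomial (f : Laurent n) (a b : Fin n → ℤ) (r : ℂ) :
    (f * AddMonoidAlgebra.single b r).coeff a = f.coeff (a - b) * r :=
  AddMonoidAlgebra.coeff_mul_single_eq_coeff_mul _ fun _ _ => eq_sub_iff_add_eq.symm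

theorem coeff_heckeProd_ne_zero (s : Finset (Fin n → ℤˣ)) (r : ℂ) (m : ℕ) (a : Fin n → ℤ)
    (h : ((∏ δ ∈ s, (1 - C (AddMonoidAlgebra.single (fun i => (δ i : ℤ)) r : Laurent n) * X)).coeff
      m).coeff a ≠ 0) : ∃ t ⊆ s, t.card = m ∧ a = ∑ δ ∈ t, fun i => (δ i : ℤ) := by
  classical
  induction s using Finset.induction_on generalizing m a with
  | empty =>
    rw [Finset.prod_empty, coeff_one] at h
    refine ⟨∅, subset_rfl, ?_, ?_⟩
    · by_contra hm
      rw [Finset.card_empty] at hm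
      rw [if_neg (Ne.symm hm)] at h
      exact h rfl
    · by_contra ha
      split_ifs at h
      · rw [AddMonoidAlgebra.one_def, AddMonoidAlgebra.coeff_single,
          Finsupp.single_eq_of_ne (by simpa using ha)] at h
        exact h rfl
      · exact h rfl
  | insert δ s hδ ih =>
    rw [Finset.prod_insert hδ, mul_comm, mul_sub, mul_one, mul_comm (C _) X, ← mul_assoc,
      coeff_sub, coeff_mul_C, AddMonoidAlgebra.coeff_sub, Finsupp.sub_apply] at h
    rcases ne_or_eq (((∏ δ ∈ s, (1 - C (AddMonoidAlgebra.single (fun i => (δ i : ℤ)) r :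
      Laurent n) * X)).coeff m).coeff a) 0 with h1 | h1
    · obtain ⟨t, ht, hc, ha⟩ := ih m a h1
      exact ⟨t, ht.trans (Finset.subset_insert _ _), hc, ha⟩
    · rw [h1, zero_sub, neg_ne_zero] at h
      cases m with
      | zero =>
        rw [coeff_mul_X_zero, zero_mul] at h
        exact absurd rfl h
      | succ m =>
        rw [coeff_mul_X, coeff_mul_monomial] at h
        obtain ⟨t, ht, hc, ha⟩ := ih m _ (left_ne_zero_of_mul h)
        have hδt : δ ∉ t := fun h => hδ (ht h)
        refine ⟨insert δ t, Finset.insert_subset_insert _ ht, ?_, ?_⟩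
        · rw [Finset.card_insert_of_notMem hδt, hc]
        · rw [Finset.sum_insert hδt, ← ha]; abel

theorem sum_sign (i : Fin n) : ∑ δ : Fin n → ℤˣ, (δ i : ℤ) = 0 := by
  have h : ∑ δ : Fin n → ℤˣ, (((-δ) i : ℤˣ) : ℤ) = ∑ δ : Fin n → ℤˣ, (δ i : ℤ) :=
    Equiv.sum_comp (Equiv.neg (Fin n → ℤˣ)) fun δ => (δ i : ℤ)
  simp only [Pi.neg_apply, Units.val_neg, Finset.sum_neg_distrib] at h
  omega

theorem card_signs : Fintype.card (Fin n → ℤˣ) = 2 ^ n := by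
  rw [Fintype.card_fun, Fintype.card_fin, Fintype.card_units_int]

theorem le_of_coeff_TTilde_ne_zero {m : ℕ} {a : Fin n → ℤ}
    (h : (TTilde p n m).coeff a ≠ 0) (i : Fin n) : -((2 ^ n - m : ℕ) : ℤ) ≤ a i := by
  classical
  have h' : ((heckePolyTilde p n).coeff m).coeff a ≠ 0 := by
    unfold TTilde at h
    rcases neg_one_pow_eq_or (Laurent n) m with e | e <;> rw [e] at h
    · rwa [one_mul] at h
    · rw [neg_mul, one_mul] at h
      exact neg_ne_zero.1 h
  obtain ⟨t, -, hc, rfl⟩ := coeff_heckeProd_ne_zero _ _ _ _ h'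
  have h1 := sum_sign i
  rw [← Finset.sum_add_sum_compl t] at h1
  have h2 : ∑ δ ∈ tᶜ, (δ i : ℤ) ≤ ∑ δ ∈ tᶜ, 1 := Finset.sum_le_sum fun δ _ => by
    rcases Int.units_eq_one_or (δ i) with e | e <;> rw [e] <;> simp
  rw [Finset.sum_const, Finset.card_compl, card_signs, hc, nsmul_eq_mul, mul_one] at h2
  rw [Finset.sum_apply]
  omega

variable (p n) in
/-- The image of `U_p` under `ω'`. -/
noncomputable def frobMonomial : Laurent n :=
  AddMonoidAlgebra.single 1 ((p : ℂ) ^ (n * (n + 1) / 2))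

theorem natDegree_heckePolyTilde_le : (heckePolyTilde p n).natDegree ≤ 2 ^ n := by
  unfold heckePolyTilde
  refine (natDegree_prod_le _ _).trans ?_
  refine (Finset.sum_le_card_nsmul _ _ 1 fun δ _ => ?_).trans ?_
  · compute_degree
  · rw [Finset.card_univ, card_signs, smul_eq_mul, mul_one]

variable [Fact p.Prime]

theorem wt_one : (p : ℂ) ^ (n * (n + 1)) * wt p (1 : Fin n → ℤ) = (p : ℂ) ^ (n * (n + 1) / 2) := by
  have hp0 : (p : ℂ) ≠ 0 := by exact_mod_cast (Fact.out : p.Prime).ne_zero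
  have h : wt p (1 : Fin n → ℤ) * (p : ℂ) ^ (n * (n + 1) / 2) = 1 := by
    have hs : n * (n + 1) / 2 = ∑ i : Fin n, ((i : ℕ) + 1) := by
      have h1 := Finset.sum_range_succ' (fun i => i) n
      rw [Finset.sum_range_id, Nat.add_sub_cancel, mul_comm, add_zero] at h1
      rw [Fin.sum_univ_eq_sum_range (fun i => i + 1) n, h1]
    rw [hs, ← Finset.prod_pow_eq_pow_sum]
    unfold wt
    rw [← Finset.prod_mul_distrib]
    refine Finset.prod_eq_one fun i _ => ?_
    rw [Pi.one_apply, zpow_one, zpow_neg, ← zpow_natCast]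
    push_cast
    exact inv_mul_cancel₀ (zpow_ne_zero _ hp0)
  have h2 : n * (n + 1) = n * (n + 1) / 2 + n * (n + 1) / 2 := by
    have := Nat.div_mul_cancel (Nat.even_mul_succ_self n).two_dvd
    omega
  rw [h2, pow_add, ← h2]
  linear_combination ((p : ℂ) ^ (n * (n + 1) / 2)) * h

theorem omegaS_mul_frobU (hp : ¬ p ∣ L.c) (T : HeckeS0 p n L) :
    omegaS p n L (T * frobU p n L) = omegaS p n L T * frobMonomial p n := by
  refine AddMonoidAlgebra.ext (Finsupp.ext fun a => ?_)
  rw [coeff_omegaS_mul_frobU hp, wt_one, frobMonomial]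
  rw [coeff_mul_monomial, mul_comm]

theorem omegaS_mul_frobU_pow (hp : ¬ p ∣ L.c) (T : HeckeS0 p n L) (k : ℕ) :
    omegaS p n L (T * frobU p n L ^ k) = omegaS p n L T * frobMonomial p n ^ k := by
  induction k with
  | zero => rw [pow_zero, pow_zero, mul_one, mul_one]
  | succ k ih => rw [pow_succ, ← mul_assoc, omegaS_mul_frobU hp, ih, pow_succ, mul_assoc]

theorem exists_frobMonomial_inv : ∃ w : Laurent n, frobMonomial p n * w = 1 := by
  have hp0 : (p : ℂ) ≠ 0 := by exact_mod_cast (Fact.out : p.Prime).ne_zero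
  refine ⟨AddMonoidAlgebra.single (-1) ((p : ℂ) ^ (n * (n + 1) / 2))⁻¹, ?_⟩
  rw [frobMonomial, AddMonoidAlgebra.single_mul_single, add_neg_cancel,
    mul_inv_cancel₀ (pow_ne_zero _ hp0), AddMonoidAlgebra.one_def]

/-- `x₁ ⋯ x_n p^{n(n+1)/2}` is a reciprocal root of the Hecke polynomial. -/
theorem sum_TTilde_mul_frobMonomial : ∑ m ∈ Finset.range (2 ^ n + 1),
    (-1) ^ m * TTilde p n m * frobMonomial p n ^ (2 ^ n - m) = 0 := by
  obtain ⟨w, hw⟩ := exists_frobMonomial_inv (p := p) (n := n)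
  have h1 : (heckePolyTilde p n).eval w = 0 := by
    unfold heckePolyTilde
    rw [eval_prod]
    refine Finset.prod_eq_zero (Finset.mem_univ 1) ?_
    rw [eval_sub, eval_one, eval_mul, eval_C, eval_X, sub_eq_zero]
    exact hw.symm
  rw [eval_eq_sum_range' (Nat.lt_succ_of_le natDegree_heckePolyTilde_le)] at h1
  have h2 := congrArg (frobMonomial p n ^ 2 ^ n * ·) h1
  rw [mul_zero, Finset.mul_sum] at h2
  rw [← h2]
  refine Finset.sum_congr rfl fun m hm => ?_
  have hm' : m ≤ 2 ^ n := Nat.lt_succ_iff.1 (Finset.mem_range.1 hm)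
  have h3 : (-1 : Laurent n) ^ m * (-1) ^ m = 1 := by rw [← mul_pow]; simp
  have h4 : frobMonomial p n ^ 2 ^ n * w ^ m = frobMonomial p n ^ (2 ^ n - m) := by
    conv_lhs => rw [← Nat.sub_add_cancel hm']
    rw [pow_add, mul_assoc, ← mul_pow, hw, one_pow, mul_one]
  rw [TTilde, ← mul_assoc, h3, one_mul, ← h4]
  ring

end LaurentPolynomials

section Factorization

variable {p : ℕ} [Fact p.Prime] {n : ℕ} {L : Level}

theorem sum_eps_mul_frobU_pow (hp : ¬ p ∣ L.c) (T : ℕ → HeckeR p n L)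
    (hT : ∀ m ≤ 2 ^ n, omegaR p n L (T m) = TTilde p n m) :
    ∑ m ∈ Finset.range (2 ^ n + 1),
      (-1) ^ m * eps p n L (T m) * frobU p n L ^ (2 ^ n - m) = 0 := by
  refine eq_zero_of_omegaS_eq_zero hp ?_ ?_
  · refine Finset.sum_induction _ (fun X : HeckeS0 p n L => ∀ x, X x ≠ 0 →
      ∃ d, ∃ κ ∈ levelD0 p n L, x = siegelDiag d * κ) ?_ ?_ ?_
    · intro X Y hX hY x hx
      by_cases h : X x = 0
      · exact hY x fun h' => hx (by rw [HeckeAlg.add_apply, h, h', add_zero])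
      · exact hX x h
    · intro x hx
      exact absurd rfl hx
    · intro m hm x hx
      have hm' : m ≤ 2 ^ n := Nat.lt_succ_iff.1 (Finset.mem_range.1 hm)
      refine exists_of_mul_frobU_pow_ne_zero hp (X := eps p n L (T m)) (k := 2 ^ n - m)
        (fun g hg r s => norm_le_of_eps_ne_zero hp (T m) (fun a ha i => ?_) hg r s) (x := x) ?_
      · rw [hT m hm'] at ha
        exact le_of_coeff_TTilde_ne_zero ha i
      · rcases neg_one_pow_eq_or (HeckeS0 p n L) m with e | e <;> rw [e] at hx
        · rwa [one_mul] at hx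
        · rw [neg_mul, neg_mul, one_mul] at hx
          exact neg_ne_zero.1 hx
  · rw [map_sum, ← sum_TTilde_mul_frobMonomial (p := p) (n := n)]
    refine Finset.sum_congr rfl fun m hm => ?_
    rw [omegaS_mul_frobU_pow hp, ← hT m (Nat.lt_succ_iff.1 (Finset.mem_range.1 hm))]
    congr 1
    rcases Nat.even_or_odd m with e | e
    · rw [e.neg_one_pow, e.neg_one_pow, one_mul, one_mul]; rfl
    · rw [e.neg_one_pow, e.neg_one_pow, neg_mul, neg_mul, one_mul, one_mul, map_neg]; rfl

end Factorization

end MetaHecke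

theorem mainTheorem3 (p : ℕ) [Fact p.Prime] (n : ℕ) (hn : 1 ≤ n)
    (L : MetaHecke.Level) (hp : ¬ p ∣ L.c)
    (T : ℕ → MetaHecke.HeckeR p n L)
    (hT : ∀ m ≤ 2 ^ n, MetaHecke.omegaR p n L (T m) = MetaHecke.TTilde p n m) :
    (∑ m ∈ Finset.range (2 ^ n + 1),
      (-1) ^ m * MetaHecke.eps p n L (T m) * MetaHecke.frobU p n L ^ (2 ^ n - m) = 0) ∧
    MetaHecke.heckePoly T =
      (∑ m ∈ Finset.range (2 ^ n), Polynomial.C (MetaHecke.heckeV T m) * Polynomial.X ^ m) *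
        (1 - Polynomial.C (MetaHecke.frobU p n L) * Polynomial.X) := by
  have h := MetaHecke.sum_eps_mul_frobU_pow hp T hT
  exact ⟨h, MetaHecke.eq_sum_mul_one_sub
    (fun m => (-1) ^ m * MetaHecke.eps p n L (T m)) _ _ Nat.one_le_two_pow h⟩
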